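/- Let $p$ be a prime, $A$ a commutative affinoid algebra over $\mathbb{Q}_p$, $I$ a finite set and $r_{I,0}=(r_{\alpha,0})_{\alpha\in I}$ a tuple with $r_{\alpha,0}\in\mathbb{Q}_{>0}\cup\{\infty\}$. For a multi-interval $[s_I,r_I]=\prod_\alpha[s_\alpha,r_\alpha]$ with $s_\alpha\in\mathbb{Q}_{>0}$, $r_\alpha\in\mathbb{Q}_{>0}\cup\{\infty\}$ and $s_\alpha\le r_\alpha$, let $\Pi_{[s_I,r_I],I,A}$ be the ring of analytic functions on $\mathrm{Max}(A)\times\{(T_\alpha)_{\alpha\in I} : p^{-r_\alpha/(p-1)}\le |T_\alpha|\le p^{-s_\alpha/(p-1)}\}$ (with $p^{-\infty}=0$), i.e. the completion of the ring of Laurent polynomials $\sum_n a_nT^n$ over $A$ (with only exponents $n_\alpha\ge 0$ allowed where $r_\alpha=\infty$) for the norm $\max_{t}\sup_{n}\|a_n\|\,p^{-\sum_\alpha t_\alpha n_\alpha/(p-1)}$, $t$ running over the tuples with $t_\alpha\in\{s_\alpha,r_\alpha\}$. Let $\Pi_{\mathrm{an},r_{I,0},I,A}=\bigcap_{0<s_I\le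 r_{I,0}}\Pi_{[s_I,r_{I,0}],I,A}$. A coherent sheaf over $\Pi_{\mathrm{an},r_{I,0},I,A}$ is a family of finitely generated $\Pi_{[s_I,r_I],I,A}$-modules $M_{[s_I,r_I]}$, one for each $[s_I,r_I]\subset(0,r_{I,0}]=\prod_\alpha(0,r_{\alpha,0}]$, with isomorphisms $M_{[s'_I,r'_I]}\otimes_{\Pi_{[s'_I,r'_I],I,A}}\Pi_{[s''_I,r''_I],I,A}\cong M_{[s''_I,r''_I]}$ for $[s''_I,r''_I]\subset[s'_I,r'_I]$ that satisfy the cocycle condition. Its global section is $M=\varprojlim_{s_I\to 0^+}M_{[s_I,r_{I,0}]}$; it is a vector bundle if every $M_{[s_I,r_I]}$ is flat over $\Pi_{[s_I,r_I],I,A}$. A covering of $(0,r_{I,0}]$ by multi-intervals is admissible if each member has $s_\alpha<r_\alpha$ for all $\alpha$ and the covering has a locally finite refinement by multi-intervals. The sheaf is uniformly finitely generated if there are an integer $n\ge1$ and an admissible covering such that, for every member $[s_I,r_I]$, the module $M_{[s_I,r_I]}$ is generated by $n$ elements; it is uniformly finitely presented if there are integers $m,n\ge1$ and an admissible covering such that,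 for every member $[s_I,r_I]$, there is an exact sequence $\Pi_{[s_I,r_I],I,A}^m\to\Pi_{[s_I,r_I],I,A}^n\to M_{[s_I,r_I]}\to0$. Then for every coherent sheaf over $\Pi_{\mathrm{an},r_{I,0},I,A}$ with global section $M$: I. the sheaf is uniformly finitely generated if and only if $M$ is a finitely generated $\Pi_{\mathrm{an},r_{I,0},I,A}$-module; II. the sheaf is uniformly finitely presented if and only if $M$ is a finitely presented $\Pi_{\mathrm{an},r_{I,0},I,A}$-module; III. the sheaf is a uniformly finitely presented vector bundle if and only if $M$ is a finite projective $\Pi_{\mathrm{an},r_{I,0},I,A}$-module. -/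

import Mathlib

open Filter Topology
open scoped NNReal ENNReal

noncomputable section

namespace MultiRobba

/-! ### Affinoid algebras -/

/-- The Tate algebra `ℚ_p⟨X_1, …, X_n⟩`: power series whose coefficients tend to zero. -/
abbrev TateAlgebra (p : ℕ) [Fact p.Prime] (n : ℕ) : Type :=
  MvPowerSeries.IsRestricted.subring (R := ℚ_[p]) (fun _ : Fin n => (1 : ℝ))

/-- A commutative Banach algebra over `ℚ_p` is affinoid if it is the image of a Tate algebra
under a surjective `ℚ_p`-algebra homomorphism that is continuous, i.e. bounded with respect to
the Gauss norm. -/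
def IsAffinoidAlgebra (p : ℕ) [Fact p.Prime] (A : Type*) [NormedCommRing A]
    [NormedAlgebra ℚ_[p] A] : Prop :=
  CompleteSpace A ∧ ∃ (n : ℕ) (φ : TateAlgebra p n →+* A),
    Function.Surjective φ ∧
    (∀ c : ℚ_[p], φ ⟨MvPowerSeries.C c, MvPowerSeries.isRestricted_C _ c⟩ = algebraMap ℚ_[p] A c) ∧
    ∃ C : ℝ, ∀ f : TateAlgebra p n,
      ‖φ f‖ ≤ C * MvPowerSeries.gaussNorm (fun a : ℚ_[p] => ‖a‖) (fun _ => (1 : ℝ)) f.1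

/-! ### Weighted Gauss norms on monoid algebras -/

section Gauss

variable {R S ι : Type*} [NormedCommRing R] [AddCommMonoid S]

/-- The Gauss norm `sup_n |a_n| w(n)` of `∑ a_n T^n`. -/
def gaussNNNorm (w : Multiplicative S →* ℝ≥0) (f : AddMonoidAlgebra R S) : ℝ≥0 :=
  f.coeff.support.sup fun n => ‖f.coeff n‖₊ * w (Multiplicative.ofAdd n)

theorem gaussNNNorm_le_iff (w : Multiplicative S →* ℝ≥0) (f : AddMonoidAlgebra R S) (c : ℝ≥0) :
    gaussNNNorm w f ≤ c ↔ ∀ n, ‖f.coeff n‖₊ * w (Multiplicative.ofAdd n) ≤ c := by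
  unfold gaussNNNorm
  rw [Finset.sup_le_iff]
  refine ⟨fun h n => ?_, fun h n _ => h n⟩
  by_cases hn : n ∈ f.coeff.support
  · exact h n hn
  · rw [Finsupp.notMem_support_iff] at hn
    simp [hn]

theorem le_gaussNNNorm (w : Multiplicative S →* ℝ≥0) (f : AddMonoidAlgebra R S) (n : S) :
    ‖f.coeff n‖₊ * w (Multiplicative.ofAdd n) ≤ gaussNNNorm w f :=
  (gaussNNNorm_le_iff w f _).1 le_rfl n

/-- The maximum of the Gauss norms attached to a finite family of weights. -/
def maxGaussNNNorm [Fintype ι] (w : ι → Multiplicative S →* ℝ≥0) (f : AddMonoidAlgebra R S) :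
    ℝ≥0 :=
  Finset.univ.sup fun i => gaussNNNorm (w i) f

theorem maxGaussNNNorm_le_iff [Fintype ι] (w : ι → Multiplicative S →* ℝ≥0)
    (f : AddMonoidAlgebra R S) (c : ℝ≥0) :
    maxGaussNNNorm w f ≤ c ↔
      ∀ i n, ‖f.coeff n‖₊ * w i (Multiplicative.ofAdd n) ≤ c := by
  simp [maxGaussNNNorm, gaussNNNorm_le_iff]

theorem le_maxGaussNNNorm [Fintype ι] (w : ι → Multiplicative S →* ℝ≥0)
    (f : AddMonoidAlgebra R S) (i : ι) (n : S) :
    ‖f.coeff n‖₊ * w i (Multiplicative.ofAdd n) ≤ maxGaussNNNorm w f :=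
  (maxGaussNNNorm_le_iff w f _).1 le_rfl i n

theorem gaussNNNorm_single_le (w : Multiplicative S →* ℝ≥0) (n : S) (a : R) :
    gaussNNNorm w (AddMonoidAlgebra.single n a) ≤ ‖a‖₊ * w (Multiplicative.ofAdd n) := by
  classical
  rw [gaussNNNorm_le_iff]
  intro m
  rw [AddMonoidAlgebra.coeff_single, Finsupp.single_apply]
  split_ifs with h
  · rw [h]
  · simp

variable [IsUltrametricDist R]

theorem gaussNNNorm_add_le (w : Multiplicative S →* ℝ≥0) (f g : AddMonoidAlgebra R S) :
    gaussNNNorm w (f + g) ≤ max (gaussNNNorm w f) (gaussNNNorm w g) := by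
  rw [gaussNNNorm_le_iff]
  intro n
  rw [AddMonoidAlgebra.coeff_add, Finsupp.add_apply]
  have h : ‖f.coeff n + g.coeff n‖₊ ≤ max ‖f.coeff n‖₊ ‖g.coeff n‖₊ :=
    IsUltrametricDist.norm_add_le_max _ _
  calc _ ≤ max ‖f.coeff n‖₊ ‖g.coeff n‖₊ * w (Multiplicative.ofAdd n) := by gcongr
    _ = max (‖f.coeff n‖₊ * w (Multiplicative.ofAdd n))
          (‖g.coeff n‖₊ * w (Multiplicative.ofAdd n)) := max_mul_of_nonneg _ _ zero_le
    _ ≤ _ := max_le_max (le_gaussNNNorm w f n) (le_gaussNNNorm w g n)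

theorem gaussNNNorm_sum_le {κ : Type*} (w : Multiplicative S →* ℝ≥0) (s : Finset κ)
    (f : κ → AddMonoidAlgebra R S) (c : ℝ≥0) (h : ∀ k ∈ s, gaussNNNorm w (f k) ≤ c) :
    gaussNNNorm w (∑ k ∈ s, f k) ≤ c := by
  classical
  induction s using Finset.induction_on with
  | empty => simp [gaussNNNorm]
  | insert a s ha ih =>
    rw [Finset.sum_insert ha]
    exact (gaussNNNorm_add_le w _ _).trans (max_le (h a (by simp))
      (ih fun k hk => h k (by simp [hk])))

theorem gaussNNNorm_mul_le (w : Multiplicative S →* ℝ≥0) (f g : AddMonoidAlgebra R S) :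
    gaussNNNorm w (f * g) ≤ gaussNNNorm w f * gaussNNNorm w g := by
  rw [AddMonoidAlgebra.mul_def, Finsupp.sum]
  refine gaussNNNorm_sum_le w _ _ _ fun m _ => ?_
  rw [Finsupp.sum]
  refine gaussNNNorm_sum_le w _ _ _ fun n _ => ?_
  refine (gaussNNNorm_single_le w _ _).trans ?_
  rw [ofAdd_add, map_mul]
  calc _ ≤ (‖f.coeff m‖₊ * ‖g.coeff n‖₊) *
        (w (Multiplicative.ofAdd m) * w (Multiplicative.ofAdd n)) := by
        gcongr; exact nnnorm_mul_le _ _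
    _ = (‖f.coeff m‖₊ * w (Multiplicative.ofAdd m)) *
        (‖g.coeff n‖₊ * w (Multiplicative.ofAdd n)) := by ring
    _ ≤ _ := by gcongr <;> exact le_gaussNNNorm w _ _

/-- The ring seminorm `f ↦ max_i sup_n |a_n| w_i(n)`. -/
def gaussSeminorm (R : Type*) [NormedCommRing R] [IsUltrametricDist R] [Fintype ι]
    (w : ι → Multiplicative S →* ℝ≥0) : RingSeminorm (AddMonoidAlgebra R S) where
  toFun f := (maxGaussNNNorm w f : ℝ)
  map_zero' := by
    have : maxGaussNNNorm w (0 : AddMonoidAlgebra R S) = 0 :=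
      le_antisymm ((maxGaussNNNorm_le_iff w _ _).2 fun i n => by simp) zero_le
    exact_mod_cast this
  add_le' f g := by
    have h : maxGaussNNNorm w (f + g) ≤ maxGaussNNNorm w f + maxGaussNNNorm w g := by
      refine Finset.sup_le fun i _ => (gaussNNNorm_add_le _ _ _).trans (max_le ?_ ?_)
      · exact (Finset.le_sup (f := fun i => gaussNNNorm (w i) f) (Finset.mem_univ i)).trans
          (le_add_of_nonneg_right zero_le)
      · exact (Finset.le_sup (f := fun i => gaussNNNorm (w i) g) (Finset.mem_univ i)).trans
          (le_add_of_nonneg_left zero_le)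
    exact_mod_cast h
  neg' f := by
    have h : ∀ g : AddMonoidAlgebra R S, maxGaussNNNorm w (-g) ≤ maxGaussNNNorm w g := by
      intro g
      rw [maxGaussNNNorm_le_iff]
      intro i n
      rw [AddMonoidAlgebra.coeff_neg, Finsupp.neg_apply, nnnorm_neg]
      exact le_maxGaussNNNorm w g i n
    have h2 := h (-f)
    rw [neg_neg] at h2
    exact_mod_cast le_antisymm (h f) h2
  mul_le' f g := by
    have h : maxGaussNNNorm w (f * g) ≤ maxGaussNNNorm w f * maxGaussNNNorm w g := by
      refine Finset.sup_le fun i _ => (gaussNNNorm_mul_le _ _ _).trans ?_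
      exact mul_le_mul' (Finset.le_sup (f := fun i => gaussNNNorm (w i) f) (Finset.mem_univ i))
        (Finset.le_sup (f := fun i => gaussNNNorm (w i) g) (Finset.mem_univ i))
    exact_mod_cast h

theorem maxGaussNNNorm_mapDomain_le {S' ι' : Type*} [AddCommMonoid S'] [Fintype ι] [Fintype ι']
    (w : ι → Multiplicative S →* ℝ≥0) (w' : ι' → Multiplicative S' →* ℝ≥0) (j : S →+ S')
    (hj : ∀ i' n, ∃ i, w' i' (Multiplicative.ofAdd (j n)) ≤ w i (Multiplicative.ofAdd n))
    (f : AddMonoidAlgebra R S) :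
    maxGaussNNNorm w' (AddMonoidAlgebra.mapDomainRingHom R j f) ≤ maxGaussNNNorm w f := by
  refine Finset.sup_le fun i' _ => ?_
  conv_lhs => rw [← AddMonoidAlgebra.sum_coeff_single f, Finsupp.sum, map_sum]
  refine gaussNNNorm_sum_le _ _ _ _ fun n _ => ?_
  have : AddMonoidAlgebra.mapDomainRingHom R j (AddMonoidAlgebra.single n (f.coeff n)) =
      AddMonoidAlgebra.single (j n) (f.coeff n) := by simp
  rw [this]
  obtain ⟨i, hi⟩ := hj i' n
  exact (gaussNNNorm_single_le _ _ _).trans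
    ((mul_le_mul_right hi _).trans (le_maxGaussNNNorm w f i n))

end Gauss

/-! ### Multi-intervals and the rings of analytic functions on relative polyannuli -/

section Rings

variable {I : Type*}

/-- A closed multi-interval `[s_I, r_I]`, `0 < s_I ≤ r_I`, with rational end points; the outer
radii `r_α` may be infinite. -/
@[ext]
structure MultiInterval (I : Type*) where
  lo : I → ℚ
  hi : I → WithTop ℚ
  lo_pos : ∀ α, 0 < lo α
  lo_le_hi : ∀ α, (lo α : WithTop ℚ) ≤ hi α

/-- `a ≤ b` means that the multi-interval `a` is contained in `b`. -/
instance : PartialOrder (MultiInterval I) where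
  le a b := (∀ α, b.lo α ≤ a.lo α) ∧ ∀ α, a.hi α ≤ b.hi α
  le_refl a := ⟨fun _ => le_rfl, fun _ => le_rfl⟩
  le_trans a b c h h' := ⟨fun α => (h'.1 α).trans (h.1 α), fun α => (h.2 α).trans (h'.2 α)⟩
  le_antisymm a b h h' := MultiInterval.ext
    (funext fun α => le_antisymm (h'.1 α) (h.1 α)) (funext fun α => le_antisymm (h.2 α) (h'.2 α))

/-- The exponents of the monomials that are regular on the polyannulus with outer radii `r`:
all of `ℤ^I`, except that `n_α ≥ 0` is required where `r_α = ∞` (there the annulus becomes a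
disc). -/
def exponents (r : I → WithTop ℚ) : AddSubmonoid (I → ℤ) where
  carrier := {n | ∀ α, r α = ⊤ → 0 ≤ n α}
  zero_mem' := fun _ _ => le_rfl
  add_mem' := fun hm hn α h => add_nonneg (hm α h) (hn α h)

/-- The value `p^{-t n/(p-1)}` of `|T^n|` on the circle of radius `t`; for `t = ∞` this is the
centre `T = 0` of the disc. -/
def radialFactor (p : ℕ) (t : WithTop ℚ) (n : ℤ) : ℝ≥0 :=
  match t with
  | ⊤ => if n = 0 then 1 else 0
  | (q : ℚ) => (p : ℝ≥0) ^ (-((q : ℝ) * n) / ((p : ℝ) - 1))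

theorem radialFactor_zero (p : ℕ) (t : WithTop ℚ) : radialFactor p t 0 = 1 := by
  cases t <;> simp [radialFactor]

theorem radialFactor_add (p : ℕ) [hp : Fact p.Prime] (t : WithTop ℚ) (m n : ℤ)
    (hm : t = ⊤ → 0 ≤ m) (hn : t = ⊤ → 0 ≤ n) :
    radialFactor p t (m + n) = radialFactor p t m * radialFactor p t n := by
  cases t with
  | top =>
    have h1 := hm rfl
    have h2 := hn rfl
    simp only [radialFactor]
    split_ifs <;> first | omega | simp
  | coe q =>
    have hp0 : (p : ℝ≥0) ≠ 0 := by exact_mod_cast hp.out.ne_zero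
    simp only [radialFactor]
    rw [← NNReal.rpow_add hp0]
    congr 1
    push_cast
    ring

/-- The corners of a multi-interval: `t_α ∈ {s_α, r_α}` for every `α`. -/
def MultiInterval.corner (b : MultiInterval I) (c : I → Bool) (α : I) : WithTop ℚ :=
  if c α then b.hi α else (b.lo α : WithTop ℚ)

theorem MultiInterval.corner_eq_top (b : MultiInterval I) (c : I → Bool) (α : I)
    (h : b.corner c α = ⊤) : b.hi α = ⊤ := by
  unfold MultiInterval.corner at h
  split_ifs at h
  · exact h
  · exact absurd h (WithTop.coe_ne_top)

theorem exponents_mono {a b : MultiInterval I} (h : a ≤ b) : exponents b.hi ≤ exponents a.hi :=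
  fun _ hn α hα => hn α (top_le_iff.1 (hα ▸ h.2 α))

/-- The multi-intervals contained in `(0, r_{I,0}]`. -/
abbrev Below (r₀ : I → WithTop ℚ) : Type _ := {b : MultiInterval I // ∀ α, b.hi α ≤ r₀ α}

/-- The inner multi-radii `0 < s_I ≤ r_{I,0}`. -/
abbrev InnerRadius (r₀ : I → WithTop ℚ) : Type _ :=
  {s : I → ℚ // ∀ α, 0 < s α ∧ (s α : WithTop ℚ) ≤ r₀ α}

/-- The multi-interval `[s_I, r_{I,0}]`. -/
def full {r₀ : I → WithTop ℚ} (s : InnerRadius r₀) : Below r₀ :=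
  ⟨⟨s.1, r₀, fun α => (s.2 α).1, fun α => (s.2 α).2⟩, fun _ => le_rfl⟩

theorem full_le {r₀ : I → WithTop ℚ} {s t : InnerRadius r₀} (h : s ≤ t) : full t ≤ full s :=
  ⟨fun α => h α, fun _ => le_rfl⟩

theorem radialFactor_le (p : ℕ) [hp : Fact p.Prime] (b : MultiInterval I) (α : I)
    (t : WithTop ℚ) (h1 : (b.lo α : WithTop ℚ) ≤ t) (h2 : t ≤ b.hi α) (n : ℤ)
    (hn : b.hi α = ⊤ → 0 ≤ n) :
    ∃ c : Bool, radialFactor p t n ≤ radialFactor p (if c then b.hi α else (b.lo α : WithTop ℚ)) n := by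
  have hp1 : (1 : ℝ≥0) ≤ p := by exact_mod_cast hp.out.one_lt.le
  have hp2 : (0 : ℝ) < (p : ℝ) - 1 := by
    have : (1 : ℝ) < p := by exact_mod_cast hp.out.one_lt
    linarith
  have key : ∀ q q' : ℚ, (q' : ℝ) * n ≤ q * n →
      radialFactor p (q : WithTop ℚ) n ≤ radialFactor p (q' : WithTop ℚ) n := by
    intro q q' h
    simp only [radialFactor]
    apply NNReal.rpow_le_rpow_of_exponent_le hp1
    gcongr
  rcases le_or_gt 0 n with h0 | h0
  · refine ⟨false, ?_⟩
    simp only [Bool.false_eq_true, if_false]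
    have h0' : (0 : ℝ) ≤ n := by exact_mod_cast h0
    cases t with
    | top =>
      by_cases hz : n = 0
      · simp [hz, radialFactor_zero]
      · simp [radialFactor, hz]
    | coe q =>
      refine key q (b.lo α) ?_
      have : b.lo α ≤ q := by exact_mod_cast h1
      have : (b.lo α : ℝ) ≤ q := by exact_mod_cast this
      gcongr
  · refine ⟨true, ?_⟩
    simp only [if_true]
    have hfin : b.hi α ≠ ⊤ := fun h => absurd (hn h) (not_le.2 h0)
    obtain ⟨r, hr⟩ := WithTop.ne_top_iff_exists.1 hfin
    rw [← hr] at h2 ⊢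
    have h0' : (n : ℝ) ≤ 0 := by exact_mod_cast h0.le
    cases t with
    | top => exact absurd h2 (by simp)
    | coe q =>
      refine key q r ?_
      have : q ≤ r := by exact_mod_cast h2
      have : (q : ℝ) ≤ r := by exact_mod_cast this
      exact mul_le_mul_of_nonpos_right this h0'

variable [Fintype I]

/-- The weight `n ↦ p^{-∑ t_α n_α/(p-1)}` at the corner `t` of a multi-interval. -/
def cornerWeight (p : ℕ) [Fact p.Prime] (b : MultiInterval I) (c : I → Bool) :
    Multiplicative (exponents b.hi) →* ℝ≥0 where
  toFun n := ∏ α, radialFactor p (b.corner c α) (n.toAdd.1 α)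
  map_one' := by simp [radialFactor_zero]
  map_mul' m n := by
    rw [← Finset.prod_mul_distrib]
    refine Finset.prod_congr rfl fun α _ => ?_
    exact radialFactor_add p _ _ _ (fun h => m.toAdd.2 α (b.corner_eq_top c α h))
      (fun h => n.toAdd.2 α (b.corner_eq_top c α h))

/-- The ring `A[T_α^{±1} : α ∈ I]` of Laurent polynomials over `A` (polynomials in the variables
`T_α` with `r_α = ∞`), tagged by the multi-interval whose Gauss norm it carries. -/
def LaurentPolynomials (_p : ℕ) (A : Type*) [NormedCommRing A] (b : MultiInterval I) : Type _ :=
  AddMonoidAlgebra A (exponents b.hi)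

theorem cornerWeight_le (p : ℕ) [Fact p.Prime] {a b : MultiInterval I} (h : a ≤ b) (c' : I → Bool)
    (n : exponents b.hi) :
    ∃ c : I → Bool, cornerWeight p a c'
      (Multiplicative.ofAdd (AddSubmonoid.inclusion (exponents_mono h) n)) ≤
        cornerWeight p b c (Multiplicative.ofAdd n) := by
  have h1 : ∀ α, (b.lo α : WithTop ℚ) ≤ a.corner c' α := by
    intro α
    have h2 : (b.lo α : WithTop ℚ) ≤ a.lo α := by exact_mod_cast h.1 α
    unfold MultiInterval.corner
    split_ifs
    · exact h2.trans (a.lo_le_hi α)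
    · exact h2
  have h2 : ∀ α, a.corner c' α ≤ b.hi α := by
    intro α
    unfold MultiInterval.corner
    split_ifs
    · exact h.2 α
    · exact (a.lo_le_hi α).trans (h.2 α)
  choose c hc using fun α => radialFactor_le p b α (a.corner c' α) (h1 α) (h2 α) (n.1 α) (n.2 α)
  exact ⟨c, Finset.prod_le_prod' fun α _ => hc α⟩

variable [DecidableEq I] (p : ℕ) [hp : Fact p.Prime] (A : Type*) [NormedCommRing A]
  [IsUltrametricDist A]

/-- The norm on Laurent polynomials is `max_t sup_n |a_n| p^{-∑ t_α n_α/(p-1)}`, with `t` running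
over the corners of `[s_I, r_I]`. -/
instance (b : MultiInterval I) : SeminormedCommRing (LaurentPolynomials p A b) :=
  { (gaussSeminorm A (cornerWeight p b)).toSeminormedRing with
    mul_comm := fun f g : AddMonoidAlgebra A (exponents b.hi) => mul_comm f g }

/-- The ring `Π_{[s_I, r_I], I, A}` of analytic functions on `Max A × A^I[s_I, r_I]`: the
completion of the Laurent polynomials for the Gauss norm of `[s_I, r_I]`. -/
abbrev IntervalRing (b : MultiInterval I) : Type _ :=
  UniformSpace.Completion (LaurentPolynomials p A b)

/-- Restriction of Laurent polynomials to a smaller multi-interval: the identity on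
coefficients. -/
def polyRestrict {a b : MultiInterval I} (h : a ≤ b) :
    LaurentPolynomials p A b →+* LaurentPolynomials p A a :=
  AddMonoidAlgebra.mapDomainRingHom A (AddSubmonoid.inclusion (exponents_mono h))

theorem continuous_polyRestrict {a b : MultiInterval I} (h : a ≤ b) :
    Continuous (polyRestrict p A h) := by
  refine AddMonoidHomClass.continuous_of_bound (polyRestrict p A h) 1 fun f => ?_
  rw [one_mul]
  have := maxGaussNNNorm_mapDomain_le (cornerWeight p b) (cornerWeight p a)
    (AddSubmonoid.inclusion (exponents_mono h)) (cornerWeight_le p h) f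
  exact NNReal.coe_le_coe.2 this

/-- The restriction homomorphism `Π_{[s', r'], I, A} → Π_{[s'', r''], I, A}` for
`[s'', r''] ⊆ [s', r']`. -/
def restrict {a b : MultiInterval I} (h : a ≤ b) : IntervalRing p A b →+* IntervalRing p A a :=
  UniformSpace.Completion.mapRingHom (polyRestrict p A h) (continuous_polyRestrict p A h)

/-- The ring `Π_{an, r_{I,0}, I, A} = ⋂_{0 < s_I ≤ r_{I,0}} Π_{[s_I, r_{I,0}], I, A}`, the
intersection being formed as the inverse limit along the restriction maps. -/
def AnRing (r₀ : I → WithTop ℚ) :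
    Subring (∀ s : InnerRadius r₀, IntervalRing p A (full s).1) where
  carrier := {f | ∀ (s t : InnerRadius r₀) (h : s ≤ t), restrict p A (full_le h) (f s) = f t}
  zero_mem' := fun _ _ _ => map_zero _
  one_mem' := fun _ _ _ => map_one _
  add_mem' := fun hf hg s t h => by
    rw [Pi.add_apply, Pi.add_apply, map_add, hf s t h, hg s t h]
  mul_mem' := fun hf hg s t h => by
    rw [Pi.mul_apply, Pi.mul_apply, map_mul, hf s t h, hg s t h]
  neg_mem' := fun hf s t h => by
    rw [Pi.neg_apply, Pi.neg_apply, map_neg, hf s t h]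

end Rings

/-! ### Finiteness notions -/

section Finiteness

variable (R : Type*) [CommRing R] (M : Type*) [AddCommGroup M] [Module R M]

/-- `M` is generated by `n` elements. -/
def IsNGenerated (n : ℕ) : Prop :=
  ∃ g : (Fin n → R) →ₗ[R] M, Function.Surjective g

/-- `M` has a presentation `R^m → R^n → M → 0`. -/
def IsMNPresented (m n : ℕ) : Prop :=
  ∃ (f : (Fin m → R) →ₗ[R] (Fin n → R)) (g : (Fin n → R) →ₗ[R] M),
    Function.Exact f g ∧ Function.Surjective g

end Finiteness

/-- For a ring homomorphism `f : R → S`, an `R`-module `M`, an `S`-module `N` and an `f`-semilinear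
map `ρ : M → N`, the induced `S`-linear map `M ⊗_R S → N` is an isomorphism. -/
def InducesBaseChangeIso {R S : Type*} [CommRing R] [CommRing S] {f : R →+* S} {M N : Type*}
    [AddCommGroup M] [Module R M] [AddCommGroup N] [Module S N] (ρ : M →ₛₗ[f] N) : Prop :=
  letI : Algebra R S := f.toAlgebra
  letI : Module R N := Module.compHom N f
  haveI : IsScalarTower R S N := ⟨fun r s n => mul_smul (f r) s n⟩
  IsBaseChange S ({ toFun := ρ, map_add' := ρ.map_add, map_smul' := ρ.map_smulₛₗ } : M →ₗ[R] N)

/-! ### Coherent sheaves -/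

section Sheaves

variable {I : Type*} [Fintype I] [DecidableEq I] (p : ℕ) [Fact p.Prime]
  (A : Type*) [NormedCommRing A] [IsUltrametricDist A]

/-- A coherent sheaf over `Π_{an, r_{I,0}, I, A}`: finitely generated modules `M_{[s_I, r_I]}` over
`Π_{[s_I, r_I], I, A}` for all `[s_I, r_I] ⊆ (0, r_{I,0}]`, with transitive restriction maps that
induce isomorphisms after base change. -/
structure CoherentSheaf (r₀ : I → WithTop ℚ) where
  sec : Below r₀ → Type*
  [addCommGroup : ∀ b, AddCommGroup (sec b)]
  [module : ∀ b, Module (IntervalRing p A b.1) (sec b)]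
  finite : ∀ b, Module.Finite (IntervalRing p A b.1) (sec b)
  res : ∀ {a b : Below r₀} (h : a ≤ b), sec b →ₛₗ[restrict p A h] sec a
  res_self : ∀ (b : Below r₀) (m : sec b), res (le_refl b) m = m
  res_res : ∀ {a b c : Below r₀} (hab : a ≤ b) (hbc : b ≤ c) (m : sec c),
    res hab (res hbc m) = res (hab.trans hbc) m
  baseChange : ∀ {a b : Below r₀} (h : a ≤ b), InducesBaseChangeIso (res h)

attribute [instance] CoherentSheaf.addCommGroup CoherentSheaf.module

variable {p A} {r₀ : I → WithTop ℚ}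

namespace CoherentSheaf

/-- The global section `M = lim_{s_I → 0} M_{[s_I, r_{I,0}]}`, a module over
`Π_{an, r_{I,0}, I, A}`. -/
def globalSection (F : CoherentSheaf p A r₀) :
    Submodule (AnRing p A r₀) (∀ s : InnerRadius r₀, F.sec (full s)) where
  carrier := {m | ∀ (s t : InnerRadius r₀) (h : s ≤ t), F.res (full_le h) (m s) = m t}
  zero_mem' := fun _ _ _ => map_zero _
  add_mem' := fun hm hn s t h => by
    rw [Pi.add_apply, Pi.add_apply, map_add, hm s t h, hn s t h]
  smul_mem' := fun f m hm s t h => by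
    change F.res (full_le h) (f.1 s • m s) = f.1 t • m t
    rw [LinearMap.map_smulₛₗ, hm s t h, f.2 s t h]

/-- A coherent sheaf is a vector bundle if all its sections over multi-intervals are flat. -/
def IsVectorBundle (F : CoherentSheaf p A r₀) : Prop :=
  ∀ b, Module.Flat (IntervalRing p A b.1) (F.sec b)

end CoherentSheaf

/-! ### Admissible coverings and uniform finiteness -/

/-- A radius in `(0, ∞]`, as an extended nonnegative real. -/
def radiusToENNReal : WithTop ℚ → ℝ≥0∞
  | ⊤ => ⊤
  | (q : ℚ) => ENNReal.ofReal (q : ℝ)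

/-- The space `(0, r_{I,0}]` of (real) multi-radii. -/
def radiiSpace {I : Type*} (r₀ : I → WithTop ℚ) : Set (I → ℝ≥0∞) :=
  {t | ∀ α, 0 < t α ∧ t α ≤ radiusToENNReal (r₀ α)}

/-- The set of (real) multi-radii in `[s_I, r_I]`. -/
def MultiInterval.carrier {I : Type*} (b : MultiInterval I) : Set (I → ℝ≥0∞) :=
  {t | ∀ α, ENNReal.ofReal (b.lo α : ℝ) ≤ t α ∧ t α ≤ radiusToENNReal (b.hi α)}

/-- The multi-intervals in `U` cover `(0, r_{I,0}]`. -/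
def IsCovering {I : Type*} {r₀ : I → WithTop ℚ} (U : Set (Below r₀)) : Prop :=
  ∀ t ∈ radiiSpace r₀, ∃ b ∈ U, t ∈ b.1.carrier

/-- Every point of `(0, r_{I,0}]` has a neighbourhood meeting only finitely many members. -/
def IsLocallyFinite {I : Type*} {r₀ : I → WithTop ℚ} (U : Set (Below r₀)) : Prop :=
  ∀ t ∈ radiiSpace r₀, ∃ V ∈ 𝓝 t, {b ∈ U | (b.1.carrier ∩ V).Nonempty}.Finite

/-- A covering of `(0, r_{I,0}]` by multi-intervals is admissible if its members have nonempty
interior in every direction and it has a locally finite refinement. -/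
def IsAdmissibleCovering {I : Type*} {r₀ : I → WithTop ℚ} (U : Set (Below r₀)) : Prop :=
  IsCovering U ∧ (∀ b ∈ U, ∀ α, (b.1.lo α : WithTop ℚ) < b.1.hi α) ∧
    ∃ V : Set (Below r₀), IsCovering V ∧ IsLocallyFinite V ∧ ∀ v ∈ V, ∃ u ∈ U, v ≤ u

namespace CoherentSheaf

/-- For some positive `n`, all members of some admissible covering have `n`-generated
sections. -/
def UniformlyFinitelyGenerated (F : CoherentSheaf p A r₀) : Prop :=
  ∃ n : ℕ, 0 < n ∧ ∃ U : Set (Below r₀), IsAdmissibleCovering U ∧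
    ∀ b ∈ U, IsNGenerated (IntervalRing p A b.1) (F.sec b) n

/-- For some positive `m, n`, all members of some admissible covering have `(m, n)`-finitely
presented sections. -/
def UniformlyFinitelyPresented (F : CoherentSheaf p A r₀) : Prop :=
  ∃ m n : ℕ, 0 < m ∧ 0 < n ∧ ∃ U : Set (Below r₀), IsAdmissibleCovering U ∧
    ∀ b ∈ U, IsMNPresented (IntervalRing p A b.1) (F.sec b) m n

end CoherentSheaf

end Sheaves

end MultiRobba

end

noncomputable section

universe u

namespace MultiRobba

/-! ### Perturbation of generators -/

section Perturb

variable {R : Type*} [NormedCommRing R] [CompleteSpace R] {V : Type*} [AddCommGroup V] [Module R V]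
  {ι : Type*} [Fintype ι]

-- The space `(0, r₀]` is exhausted by the intervals `[s, r₀]`, and the argument treats it as a
-- quasi-Stein space. Restrictions that only raise the inner end points have dense image. Hence,
-- along a cofinal sequence of radii, a coherent sheaf gives a tower of finite modules over Banach
-- rings for which the analogues of Cartan's theorems hold. Every cochain is a coboundary
-- (`exists_sub_eq_of_tower`), and global sections generate every local module
-- (`CoherentSheaf.span_range_sectionOver`). Neither fact bounds the number of generators; that is
-- what the uniformity hypothesis supplies.
--
-- For I, global generators restrict to generators over every interval. The converse has two halves.
-- First, the bound on the members of the covering must be carried to all intervals. An interval is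
-- cut by a finite grid into cells that lie in members of the covering. In one direction, generators
-- on alternate cells are merged into a single tuple with the help of high powers of a function `p^c
-- T^d` that is small on one side of a gap and large on the other
-- (`CoherentSheaf.exists_combined_generators`). Two tuples then serve all cells, so each direction
-- only doubles the number of generators. Gluing along a cut is
-- `CoherentSheaf.span_eq_top_of_parts`. Second, `N` generators at each stage of the tower must be
-- made compatible. Any two generating tuples, padded with `N` zeros, differ by a product of
-- unipotent block matrices, and such products can be approximated from the next stage
-- (`exists_compatible_generators`). The resulting `2N` global sections generate the whole module
-- because the sheaf of their relations is again coherent and has no first cohomology along the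
-- tower (`CoherentSheaf.span_eq_top_of_local`).
--
-- II is I applied to the sheaf of relations between global generators. For III, projectivity means
-- that the relation module is a retract of the free module. Over a noetherian ring, finite flat
-- modules are projective, so retractions exist at each stage. Two of them differ by an element of a
-- tower of modules to which the coboundary theorem applies, so they can be made compatible
-- (`exists_compatible_retraction`). Conversely, a global retraction restricts to every interval.
--
-- The ring theory rests on two devices. Each ring contains an open bounded subring that is finitely
-- generated modulo `p`, and the Hilbert basis theorem then gives noetherianity with control of
-- coefficients (`HasBoundedGeneration`). Moving one end point of an interval replaces `R` by a ring
-- of convergent series in one element `Y` with `a Y = b` (`IsSeriesExtension`), from which flatness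
-- and gluing are computed by hand.

attribute [local instance] Matrix.linftyOpNormedRing Matrix.linftyOpNormedAddCommGroup in
theorem isUnit_one_sub_matrix [DecidableEq ι] (D : Matrix ι ι R)
    (hD : ∀ i j, ‖D i j‖ * (Fintype.card ι + 1) ≤ 1) : IsUnit (1 - D) := by
  have h0 : @CompleteSpace (Matrix ι ι R)
      (Matrix.linftyOpNormedRing (n := ι) (α := R)).toPseudoMetricSpace.toUniformSpace :=
    inferInstanceAs (CompleteSpace (ι → ι → R))
  have : HasSummableGeomSeries (Matrix ι ι R) := 
    @instHasSummableGeomSeriesOfCompleteSpace _ (Matrix.linftyOpNormedRing (n := ι) (α := R)) h0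
  apply isUnit_one_sub_of_norm_lt_one
  have hc : (0 : ℝ) < Fintype.card ι + 1 := by positivity
  -- The norm is the largest row sum. The `+ 1` in the hypothesis makes it strictly less than one
  -- and also covers an empty index set.
  have h1 : ‖D‖₊ ≤ (Fintype.card ι : ℝ≥0) * ((Fintype.card ι : ℝ≥0) + 1)⁻¹ := by
    rw [Matrix.linfty_opNNNorm_def]
    refine Finset.sup_le fun i _ => ?_
    refine (Finset.sum_le_card_nsmul _ _ ((Fintype.card ι : ℝ≥0) + 1)⁻¹ fun j _ => ?_).trans ?_
    · rw [← one_div, le_div_iff₀ (by positivity)]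
      exact_mod_cast hD i j
    · simp
  have h2 : (Fintype.card ι : ℝ≥0) * ((Fintype.card ι : ℝ≥0) + 1)⁻¹ < 1 := by
    rw [← div_eq_mul_inv, div_lt_one (by positivity)]
    exact lt_add_one _
  exact_mod_cast h1.trans_lt h2

/-- If `e` agrees modulo `N` with a small combination of itself, then `e` lies in `N`. -/
theorem mem_of_sub_small_mem (e : ι → V) (N : Submodule R V) (δ : ι → ι → R)
    (hδ : ∀ i j, ‖δ i j‖ * (Fintype.card ι + 1) ≤ 1)
    (h : ∀ i, e i - ∑ j, δ i j • e j ∈ N) (i : ι) : e i ∈ N := by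
  classical
  obtain ⟨B, hB⟩ := (isUnit_one_sub_matrix (Matrix.of δ) hδ).exists_left_inv
  -- The elements of `N` supplied by `h` are `(1 - δ) e`, so the inverse matrix recovers `e` from
  -- them.
  have key : e i = ∑ k, B i k • (e k - ∑ j, δ k j • e j) := by
    have h1 : ∀ j, ∑ k, B i k * ((1 : Matrix ι ι R) k j - δ k j) = (1 : Matrix ι ι R) i j := by
      intro j
      conv_rhs => rw [← hB, Matrix.mul_apply]
      rfl
    have h2 : ∀ k, e k - ∑ j, δ k j • e j = ∑ j, ((1 : Matrix ι ι R) k j - δ k j) • e j := by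
      intro k
      simp [sub_smul, Finset.sum_sub_distrib, Matrix.one_apply]
    simp_rw [h2, Finset.smul_sum, smul_smul]
    rw [Finset.sum_comm]
    simp_rw [← Finset.sum_smul, h1]
    simp [Matrix.one_apply]
  rw [key]
  exact Submodule.sum_mem _ fun k _ => N.smul_mem _ (h k)

/-- Generation is an open condition: modulo the span of `f`, each `e i` is a small combination of
the `e j`. The modules carry no norm, so smallness is always measured on coefficients. -/
theorem span_eq_top_of_perturb (e f : ι → V) (he : Submodule.span R (Set.range e) = ⊤)
    (δ : ι → ι → R) (hδ : ∀ i j, ‖δ i j‖ * (Fintype.card ι + 1) ≤ 1)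
    (h : ∀ i, f i = e i + ∑ j, δ i j • e j) : Submodule.span R (Set.range f) = ⊤ := by
  rw [eq_top_iff, ← he, Submodule.span_le]
  rintro _ ⟨i, rfl⟩
  refine mem_of_sub_small_mem e _ (fun i j => - δ i j) (fun i j => by simpa using hδ i j) ?_ i
  intro i
  have : e i - ∑ j, (-δ i j) • e j = f i := by simp [h i]
  rw [this]
  exact Submodule.subset_span ⟨i, rfl⟩

theorem exists_coeff_of_span_eq_top {R V ι : Type*} [CommRing R] [AddCommGroup V] [Module R V]
    [Fintype ι] {e : ι → V}
    (he : Submodule.span R (Set.range e) = ⊤) (x : V) : ∃ c : ι → R, x = ∑ i, c i • e i := by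
  have : x ∈ Submodule.span R (Set.range e) := he ▸ Submodule.mem_top
  obtain ⟨c, hc⟩ := (Submodule.mem_span_range_iff_exists_fun R).1 this
  exact ⟨c, hc.symm⟩

end Perturb

/-! ### Summation along a tower of complete groups -/

/-- In a tower of complete groups with bounded transition maps, a sufficiently small sequence can be
summed. -/
theorem exists_tower_sum {L : ℕ → Type*} [∀ k, NormedAddCommGroup (L k)] [∀ k, CompleteSpace (L k)]
    (φ : ∀ k, L (k + 1) →+ L k) (c : ℕ → ℝ) (hc : ∀ k, 1 ≤ c k) (hφ : ∀ k a, ‖φ k a‖ ≤ c k * ‖a‖)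
    (a : ∀ k, L k) (ε : ℝ) (hε : 0 ≤ ε)
    (ha : ∀ k, (∏ j ∈ Finset.range k, c j) * ‖a k‖ ≤ ε * (1 / 2) ^ k) :
    ∃ s : ∀ k, L k, (∀ k, s k = a k + φ k (s (k + 1))) ∧ ∀ k, ‖s k‖ ≤ 2 * ε := by
  -- `b j k` is the image of `a (k + j)` in `L k`
  let b : ℕ → ∀ k, L k := fun j => Nat.rec (motive := fun _ => ∀ k, L k) a (fun _ b k => φ k (b (k + 1))) j
  have hb0 : ∀ k, b 0 k = a k := fun _ => rfl
  have hbs : ∀ j k, b (j + 1) k = φ k (b j (k + 1)) := fun _ _ => rfl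
  have hc0 : ∀ k, 0 < c k := fun k => zero_lt_one.trans_le (hc k)
  have hP : ∀ k, 1 ≤ ∏ j ∈ Finset.range k, c j := by
    intro k
    induction k with
    | zero => simp
    | succ k ih =>
      rw [Finset.prod_range_succ]
      exact one_le_mul_of_one_le_of_one_le ih (hc k)
  -- Keeping the product of the first `k` constants on the left is what makes the induction close:
  -- descending one level trades the factor `c k` for the transition map.
  have hbound : ∀ j k, (∏ i ∈ Finset.range k, c i) * ‖b j k‖ ≤ ε * (1 / 2) ^ (k + j) := by
    intro j
    induction j with
    | zero => exact fun k => by simpa [hb0] using ha k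
    | succ j ih =>
      intro k
      rw [hbs]
      have h1 := ih (k + 1)
      rw [Finset.prod_range_succ] at h1
      have h2 := hφ k (b j (k + 1))
      have h3 : 0 ≤ ∏ i ∈ Finset.range k, c i := zero_le_one.trans (hP k)
      calc _ ≤ (∏ i ∈ Finset.range k, c i) * (c k * ‖b j (k + 1)‖) := by gcongr
        _ = (∏ i ∈ Finset.range k, c i) * c k * ‖b j (k + 1)‖ := by ring
        _ ≤ _ := h1
        _ = _ := by congr 2; ring
  have hb : ∀ j k, ‖b j k‖ ≤ ε * (1 / 2) ^ j := by
    intro j k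
    calc ‖b j k‖ ≤ (∏ i ∈ Finset.range k, c i) * ‖b j k‖ :=
          le_mul_of_one_le_left (norm_nonneg _) (hP k)
      _ ≤ _ := hbound j k
      _ ≤ ε * (1 / 2) ^ j := by
        gcongr ε * ?_
        exact pow_le_pow_of_le_one (by norm_num) (by norm_num) (by omega)
  have hg : HasSum (fun j : ℕ => ε * (1 / 2 : ℝ) ^ j) (ε * 2) :=
    hasSum_geometric_two.mul_left ε
  have hsum : ∀ k, Summable fun j => b j k := fun k =>
    Summable.of_norm_bounded hg.summable (fun j => hb j k)
  refine ⟨fun k => ∑' j, b j k, fun k => ?_, fun k => ?_⟩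
  · change ∑' j, b j k = _
    rw [(hsum k).tsum_eq_zero_add, hb0]
    congr 1
    have hcont : Continuous (φ k) := AddMonoidHomClass.continuous_of_bound (φ k) (c k) (hφ k)
    exact ((hsum (k + 1)).map_tsum (φ k) hcont).symm
  · refine (tsum_of_norm_bounded hg fun j => hb j k).trans ?_
    linarith

/-! ### Towers of modules over towers of Banach rings -/

section Tower

variable {R : ℕ → Type*} [∀ k, NormedCommRing (R k)]
  {ρ : ∀ k, R (k + 1) →+* R k} {V : ℕ → Type*} [∀ k, AddCommGroup (V k)] [∀ k, Module (R k) (V k)]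

/-- Coefficients over `R` of a combination of images can be replaced by nearby elements coming from
`S`, and these move inside `φ`. The error is expressed in the generators `e`, which stand in for a
norm on `V`. -/
theorem exists_approx_of_span_range {R S : Type*} [NormedCommRing R] [NormedCommRing S]
    {ρ : S →+* R} (hd : DenseRange ρ) {V W : Type*} [AddCommGroup V] [Module R V]
    [AddCommGroup W] [Module S W] (φ : W →ₛₗ[ρ] V)
    (hφ : Submodule.span R (Set.range φ) = ⊤) {ι : Type*} [Fintype ι] (e : ι → V)
    (he : Submodule.span R (Set.range e) = ⊤) (x : V) (ε : ℝ) (hε : 0 < ε) :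
    ∃ (y : W) (a : ι → R), ‖a‖ ≤ ε ∧ x = φ y + ∑ i, a i • e i := by
  have hx : x ∈ Submodule.span R (Set.range φ) := hφ ▸ Submodule.mem_top
  induction hx using Submodule.span_induction generalizing ε with
  | mem x hx =>
    obtain ⟨y, rfl⟩ := hx
    exact ⟨y, 0, by simpa using hε.le, by simp⟩
  | zero => exact ⟨0, 0, by simpa using hε.le, by simp⟩
  | add x x' _ _ h h' =>
    obtain ⟨y, a, ha, rfl⟩ := h (ε / 2) (half_pos hε)
    obtain ⟨y', a', ha', rfl⟩ := h' (ε / 2) (half_pos hε)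
    refine ⟨y + y', a + a', (norm_add_le _ _).trans (by linarith), ?_⟩
    simp only [map_add, Pi.add_apply, add_smul, Finset.sum_add_distrib]
    abel
  | smul r x _ h =>
    obtain ⟨y, a, ha, rfl⟩ := h (ε / 2 / (‖r‖ + 1)) (by positivity)
    obtain ⟨c, hc⟩ := exists_coeff_of_span_eq_top he (φ y)
    -- The error `(r - ρ s) • φ y` has coefficients `(r - ρ s) • c`, so the tolerance is scaled by
    -- the size of `c`.
    obtain ⟨s, hs⟩ := hd.exists_dist_lt r (ε := ε / 2 / (‖c‖ + 1)) (by positivity)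
    rw [dist_eq_norm] at hs
    refine ⟨s • y, (r - ρ s) • c + r • a, ?_, ?_⟩
    · refine (norm_add_le _ _).trans ?_
      have h1 : ‖(r - ρ s) • c‖ ≤ ε / 2 := by
        refine (norm_smul_le _ _).trans ?_
        calc _ ≤ ε / 2 / (‖c‖ + 1) * (‖c‖ + 1) := by gcongr; linarith
          _ = ε / 2 := by field_simp
      have h2 : ‖r • a‖ ≤ ε / 2 := by
        refine (norm_smul_le _ _).trans ?_
        calc _ ≤ (‖r‖ + 1) * (ε / 2 / (‖r‖ + 1)) := by gcongr; linarith
          _ = ε / 2 := by field_simp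
      linarith
    · have h1 : ∑ i, ((r - ρ s) • c + r • a) i • e i = (r - ρ s) • φ y + r • ∑ i, a i • e i := by
        rw [hc]
        simp only [Pi.add_apply, Pi.smul_apply, add_smul, Finset.sum_add_distrib, smul_eq_mul,
          mul_smul, ← Finset.smul_sum]
      rw [h1, map_smulₛₗ, smul_add, sub_smul]
      abel

/-- In a tower of finite modules whose transition maps have spanning image, over a tower of Banach
rings with dense transition maps, every sequence is a coboundary, up to a small error at the
bottom. -/
theorem exists_primitive [∀ k, CompleteSpace (R k)] (hρ : ∀ k x, ‖ρ k x‖ ≤ ‖x‖)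
    (hd : ∀ k, DenseRange (ρ k))
    (φ : ∀ k, V (k + 1) →ₛₗ[ρ k] V k) (hφ : ∀ k, Submodule.span (R k) (Set.range (φ k)) = ⊤)
    {n : ℕ → ℕ} (e : ∀ k, Fin (n k) → V k) (he : ∀ k, Submodule.span (R k) (Set.range (e k)) = ⊤)
    (v : ∀ k, V k) (y₀ : V 0) (ε : ℝ) (hε : 0 < ε) :
    ∃ w : ∀ k, V k, (∀ k, w k - φ k (w (k + 1)) = v k) ∧
      ∃ a : Fin (n 0) → R 0, ‖a‖ ≤ ε ∧ w 0 + y₀ = ∑ i, a i • e 0 i := by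
  -- The transition maps are lifted to coefficient vectors, where norms and completeness are
  -- available.
  choose C hC using fun k i => exists_coeff_of_span_eq_top (he k) (φ k (e (k + 1) i))
  let φL : ∀ k, (Fin (n (k + 1)) → R (k + 1)) →+ (Fin (n k) → R k) := fun k =>
    { toFun := fun a j => ∑ i, ρ k (a i) * C k i j
      map_zero' := by ext; simp
      map_add' := fun a b => by ext; simp [add_mul, Finset.sum_add_distrib] }
  let c : ℕ → ℝ := fun k => 1 + ∑ i, ‖C k i‖
  have hc : ∀ k, 1 ≤ c k := fun k => by
    have : 0 ≤ ∑ i, ‖C k i‖ := Finset.sum_nonneg fun i _ => norm_nonneg _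
    simp only [c]; linarith
  have hφL : ∀ k (a : Fin (n (k + 1)) → R (k + 1)), ‖φL k a‖ ≤ c k * ‖a‖ := by
    intro k a
    have h0 : 0 ≤ ∑ i, ‖C k i‖ := Finset.sum_nonneg fun i _ => norm_nonneg _
    have h0' : 0 ≤ c k := zero_le_one.trans (hc k)
    rw [pi_norm_le_iff_of_nonneg (by positivity)]
    intro j
    change ‖∑ i, ρ k (a i) * C k i j‖ ≤ _
    refine (norm_sum_le _ _).trans ?_
    calc _ ≤ ∑ i, ‖a‖ * ‖C k i‖ := by
          refine Finset.sum_le_sum fun i _ => (norm_mul_le _ _).trans ?_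
          gcongr
          · exact (hρ k _).trans (norm_le_pi_norm a i)
          · exact norm_le_pi_norm (C k i) j
      _ = (∑ i, ‖C k i‖) * ‖a‖ := by rw [← Finset.mul_sum, mul_comm]
      _ ≤ _ := by simp only [c]; gcongr; linarith
  have hP : ∀ k, 0 < ∏ j ∈ Finset.range k, c j := fun k =>
    Finset.prod_pos fun j _ => zero_lt_one.trans_le (hc j)
  -- Small enough to survive all transition maps down to level zero; the half compensates the factor
  -- two in `exists_tower_sum`.
  let η : ℕ → ℝ := fun k => ε / 2 * (1 / 2) ^ k / ∏ j ∈ Finset.range k, c j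
  have hη : ∀ k, 0 < η k := fun k => div_pos (by positivity) (hP k)
  choose Y a ha hY using fun k x =>
    exists_approx_of_span_range (hd k) (φ k) (hφ k) (e k) (he k) x (η k) (hη k)
  -- By construction `v k + y k` is the image of `y (k + 1)` up to a small error, so `-y` is a
  -- primitive of `v` up to that error, with a freely chosen starting value. Summing the errors
  -- along the tower corrects it exactly.
  let y : ∀ k, V k := fun k => Nat.rec (motive := fun k => V k) y₀ (fun k y => Y k (v k + y)) k
  have hy : ∀ k, y (k + 1) = Y k (v k + y k) := fun k => rfl
  obtain ⟨s, hs, hsb⟩ := exists_tower_sum φL c hc hφL (fun k => a k (v k + y k)) (ε / 2)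
    (by positivity) (fun k => by
      have := ha k (v k + y k)
      calc _ ≤ (∏ j ∈ Finset.range k, c j) * η k := by gcongr
        _ = _ := mul_div_cancel₀ _ (hP k).ne')
  have hφe : ∀ k (t : Fin (n (k + 1)) → R (k + 1)),
      φ k (∑ i, t i • e (k + 1) i) = ∑ j, φL k t j • e k j := by
    intro k t
    simp only [map_sum, map_smulₛₗ, hC, Finset.smul_sum, smul_smul]
    rw [Finset.sum_comm]
    simp [φL, Finset.sum_smul]
  refine ⟨fun k => ∑ i, s k i • e k i - y k, fun k => ?_, s 0, by linarith [hsb 0], ?_⟩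
  · have h1 := hY k (v k + y k)
    rw [← hy] at h1
    simp only [map_sub, hφe]
    rw [hs k]
    simp only [Pi.add_apply, add_smul, Finset.sum_add_distrib]
    have h2 : v k = φ k (y (k + 1)) + ∑ i, a k (v k + y k) i • e k i - y k := eq_sub_of_add_eq h1
    generalize ∑ i, a k (v k + y k) i • e k i = z at h2 ⊢
    rw [h2]
    abel
  · have : y 0 = y₀ := rfl
    simp [this]

variable [∀ k, CompleteSpace (R k)] (hρ : ∀ k x, ‖ρ k x‖ ≤ ‖x‖) (hd : ∀ k, DenseRange (ρ k))
    (φ : ∀ k, V (k + 1) →ₛₗ[ρ k] V k) (hφ : ∀ k, Submodule.span (R k) (Set.range (φ k)) = ⊤)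
    [∀ k, Module.Finite (R k) (V k)]

include hρ hd hφ

/-- This is the vanishing of the first derived limit, the analogue of Theorem B. It is used whenever
local choices have to be made compatible. -/
theorem exists_sub_eq_of_tower (v : ∀ k, V k) : ∃ w : ∀ k, V k, ∀ k, w k - φ k (w (k + 1)) = v k := by
  choose n e he using fun k => Module.Finite.exists_fin (R := R k) (M := V k)
  obtain ⟨w, hw, _⟩ := exists_primitive hρ hd φ hφ e he v 0 1 one_pos
  exact ⟨w, hw⟩

/-- The analogue of Theorem A: a primitive of the zero sequence is a compatible family, and its
value at the bottom may be prescribed up to a small error, which is harmless for generation. -/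
theorem span_compatible_eq_top :
    Submodule.span (R 0) {x | ∃ w : ∀ k, V k, (∀ k, φ k (w (k + 1)) = w k) ∧ w 0 = x} = ⊤ := by
  choose n e he using fun k => Module.Finite.exists_fin (R := R k) (M := V k)
  have key : ∀ i : Fin (n 0), ∃ w : ∀ k, V k, (∀ k, φ k (w (k + 1)) = w k) ∧
      ∃ a : Fin (n 0) → R 0, ‖a‖ ≤ 1 / (n 0 + 1) ∧ w 0 = e 0 i + ∑ j, a j • e 0 j := by
    intro i
    obtain ⟨w, hw, a, ha, h⟩ := exists_primitive hρ hd φ hφ e he 0 (- e 0 i) (1 / (n 0 + 1))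
      (by positivity)
    exact ⟨w, fun k => (sub_eq_zero.1 (hw k)).symm, a, ha, by rw [← h]; abel⟩
  choose w hw a ha h using key
  rw [eq_top_iff, ← span_eq_top_of_perturb (e 0) (fun i => w i 0) (he 0) a (fun i j => ?_) h]
  · refine Submodule.span_mono ?_
    rintro _ ⟨i, rfl⟩
    exact ⟨w i, hw i, rfl⟩
  · have := (norm_le_pi_norm (a i) j).trans (ha i)
    rw [le_div_iff₀ (by positivity)] at this
    simpa using this

end Tower

/-! ### Elementary matrices and uniformly generated towers -/

section Elementary

variable {R V ι : Type*} [CommRing R] [AddCommGroup V] [Module R V] [Fintype ι]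

/-- The action of square matrices on tuples of elements of a module. -/
def matrixAct (X : Matrix ι ι R) (t : ι → V) (i : ι) : V := ∑ j, X i j • t j

theorem matrixAct_mul (X Y : Matrix ι ι R) (t : ι → V) :
    matrixAct (X * Y) t = matrixAct X (matrixAct Y t) := by
  ext i
  simp only [matrixAct, Matrix.mul_apply, Finset.sum_smul, Finset.smul_sum, mul_smul]
  exact Finset.sum_comm

theorem matrixAct_add (X Y : Matrix ι ι R) (t : ι → V) :
    matrixAct (X + Y) t = matrixAct X t + matrixAct Y t := by
  ext i
  simp [matrixAct, add_smul, Finset.sum_add_distrib]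

theorem matrixAct_one [DecidableEq ι] (t : ι → V) : matrixAct (1 : Matrix ι ι R) t = t := by
  ext i
  simp [matrixAct, Matrix.one_apply]

theorem span_matrixAct [DecidableEq ι] {X : Matrix ι ι R} (hX : IsUnit X) {t : ι → V}
    (ht : Submodule.span R (Set.range t) = ⊤) :
    Submodule.span R (Set.range (matrixAct X t)) = ⊤ := by
  obtain ⟨Y, hY⟩ := hX.exists_left_inv
  rw [eq_top_iff, ← ht, Submodule.span_le]
  rintro _ ⟨i, rfl⟩
  have : t i = matrixAct Y (matrixAct X t) i := by rw [← matrixAct_mul, hY, matrixAct_one]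
  rw [this]
  exact Submodule.sum_mem _ fun j _ => Submodule.smul_mem _ _ (Submodule.subset_span ⟨j, rfl⟩)

variable (R) [DecidableEq ι]

/-- The monoid generated by the unipotent block matrices. -/
def blockElementary (ι : Type*) [Fintype ι] [DecidableEq ι] : Submonoid (Matrix (ι ⊕ ι) (ι ⊕ ι) R) :=
  Submonoid.closure (Set.range (fun P : Matrix ι ι R => Matrix.fromBlocks 1 P 0 1) ∪
    Set.range (fun P : Matrix ι ι R => Matrix.fromBlocks 1 0 P 1))

variable {R}

theorem upper_mem (P : Matrix ι ι R) : Matrix.fromBlocks 1 P 0 1 ∈ blockElementary R ι :=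
  Submonoid.subset_closure (Or.inl ⟨P, rfl⟩)

theorem lower_mem (P : Matrix ι ι R) : Matrix.fromBlocks 1 0 P 1 ∈ blockElementary R ι :=
  Submonoid.subset_closure (Or.inr ⟨P, rfl⟩)

theorem isUnit_of_mem_blockElementary {X : Matrix (ι ⊕ ι) (ι ⊕ ι) R}
    (hX : X ∈ blockElementary R ι) : IsUnit X := by
  have : blockElementary R ι ≤ IsUnit.submonoid _ := by
    refine Submonoid.closure_le.2 ?_
    rintro _ (⟨P, rfl⟩ | ⟨P, rfl⟩)
    · refine IsUnit.of_mul_eq_one (Matrix.fromBlocks 1 (-P) 0 1) ?_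
      simp [Matrix.fromBlocks_multiply]
    · refine IsUnit.of_mul_eq_one (Matrix.fromBlocks 1 0 (-P) 1) ?_
      simp [Matrix.fromBlocks_multiply]
  exact this hX

theorem matrixAct_upper (P : Matrix ι ι R) (u v : ι → V) :
    matrixAct (Matrix.fromBlocks 1 P 0 1) (Sum.elim u v) = Sum.elim (u + matrixAct P v) v := by
  ext (i | i) <;> simp [matrixAct, Matrix.one_apply]

theorem matrixAct_lower (P : Matrix ι ι R) (u v : ι → V) :
    matrixAct (Matrix.fromBlocks 1 0 P 1) (Sum.elim u v) = Sum.elim u (matrixAct P u + v) := by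
  ext (i | i) <;> simp [matrixAct, Matrix.one_apply]

omit [DecidableEq ι] in
theorem matrixAct_neg (P : Matrix ι ι R) (u : ι → V) : matrixAct (-P) u = - matrixAct P u := by
  ext i; simp [matrixAct]

/-- Whitehead's trick: with `g = A g'` and `g' = B g`, the moves `(0, g') ↦ (g, g') ↦ (g, 0) ↦ (g,
g) ↦ (0, g)` are unipotent. The zero block provides the room; the matrices `A` and `B` themselves
need not be invertible. -/
theorem exists_blockElementary {g g' : ι → V} (hg : Submodule.span R (Set.range g) = ⊤)
    (hg' : Submodule.span R (Set.range g') = ⊤) :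
    ∃ E ∈ blockElementary R ι, matrixAct E (Sum.elim (0 : ι → V) g') = Sum.elim (0 : ι → V) g := by
  choose A hA using fun i => exists_coeff_of_span_eq_top hg' (g i)
  choose B hB using fun i => exists_coeff_of_span_eq_top hg (g' i)
  have hA' : matrixAct (Matrix.of A) g' = g := funext fun i => (hA i).symm
  have hB' : matrixAct (Matrix.of B) g = g' := funext fun i => (hB i).symm
  refine ⟨Matrix.fromBlocks 1 (-1) 0 1 * (Matrix.fromBlocks 1 0 1 1 *
    (Matrix.fromBlocks 1 0 (-Matrix.of B) 1 * Matrix.fromBlocks 1 (Matrix.of A) 0 1)),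
    mul_mem (upper_mem _) (mul_mem (lower_mem _) (mul_mem (lower_mem _) (upper_mem _))), ?_⟩
  rw [matrixAct_mul, matrixAct_mul, matrixAct_mul, matrixAct_upper, matrixAct_lower,
    matrixAct_lower, matrixAct_upper, hA', zero_add]
  simp only [matrixAct_neg, hB', matrixAct_one]
  simp

/-- A unipotent block depends continuously on an arbitrary matrix `P`, so density of `ρ` gives
density among these blocks, and the closure of a submonoid is a submonoid. An approximation of a
general invertible matrix need not be invertible over `S`; this is why unipotent products are used.
-/
theorem blockElementary_le_closure {R S : Type*} [NormedCommRing R] [NormedCommRing S]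
    {ρ : S →+* R} (hd : DenseRange ρ) :
    (blockElementary R ι : Set (Matrix (ι ⊕ ι) (ι ⊕ ι) R)) ⊆
      closure ((blockElementary S ι).map (ρ.mapMatrix (m := ι ⊕ ι)) : Set (Matrix (ι ⊕ ι) (ι ⊕ ι) R)) := by
  have hP : DenseRange (fun P : Matrix ι ι S => P.map ρ) := by
    have h1 : DenseRange (fun (f : ι → S) => ρ ∘ f) := DenseRange.piMap fun _ => hd
    exact (DenseRange.piMap fun _ => h1 : DenseRange (Pi.map fun (_ : ι) (f : ι → S) => ρ ∘ f))
  change _ ⊆ (((blockElementary S ι).map (ρ.mapMatrix (m := ι ⊕ ι))).topologicalClosure : Set (Matrix (ι ⊕ ι) (ι ⊕ ι) R))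
  refine Submonoid.closure_le.2 ?_
  rintro _ (⟨P, rfl⟩ | ⟨P, rfl⟩)
  · have hc : Continuous fun P : Matrix ι ι R => (Matrix.fromBlocks 1 P 0 1 : Matrix (ι ⊕ ι) (ι ⊕ ι) R) :=
      by fun_prop
    refine map_mem_closure (f := fun P : Matrix ι ι R => (Matrix.fromBlocks 1 P 0 1 : Matrix (ι ⊕ ι) (ι ⊕ ι) R)) hc (hP P) ?_
    rintro _ ⟨Q, rfl⟩
    refine ⟨_, upper_mem Q, ?_⟩
    simp [Matrix.fromBlocks_map]
  · have hc : Continuous fun P : Matrix ι ι R => (Matrix.fromBlocks 1 0 P 1 : Matrix (ι ⊕ ι) (ι ⊕ ι) R) :=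
      by fun_prop
    refine map_mem_closure (f := fun P : Matrix ι ι R => (Matrix.fromBlocks 1 0 P 1 : Matrix (ι ⊕ ι) (ι ⊕ ι) R)) hc (hP P) ?_
    rintro _ ⟨Q, rfl⟩
    refine ⟨_, lower_mem Q, ?_⟩
    simp [Matrix.fromBlocks_map]

omit [DecidableEq ι] in
theorem matrixAct_map {R S : Type*} [CommRing R] [CommRing S] {ρ : S →+* R} {V W : Type*}
    [AddCommGroup V] [Module R V] [AddCommGroup W] [Module S W] (φ : W →ₛₗ[ρ] V)
    (X : Matrix ι ι S) (t : ι → W) : φ ∘ matrixAct X t = matrixAct (X.map ρ) (φ ∘ t) := by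
  ext i
  simp [matrixAct, map_smulₛₗ]

end Elementary

section UniformTower

variable {R : ℕ → Type*} [∀ k, NormedCommRing (R k)] [∀ k, CompleteSpace (R k)]
  {ρ : ∀ k, R (k + 1) →+* R k} {V : ℕ → Type*} [∀ k, AddCommGroup (V k)] [∀ k, Module (R k) (V k)]

/-- If all modules of a tower are generated by `N` elements, there is a compatible family of
`2N`-tuples of generators. -/
theorem exists_compatible_generators (hρ : ∀ k x, ‖ρ k x‖ ≤ ‖x‖) (hd : ∀ k, DenseRange (ρ k))
    (φ : ∀ k, V (k + 1) →ₛₗ[ρ k] V k) (hφ : ∀ k, Submodule.span (R k) (Set.range (φ k)) = ⊤)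
    {ι : Type*} [Fintype ι] [DecidableEq ι]
    (hg : ∀ k, ∃ g : ι → V k, Submodule.span (R k) (Set.range g) = ⊤) :
    ∃ h : ∀ k, ι ⊕ ι → V k, (∀ k i, φ k (h (k + 1) i) = h k i) ∧
      ∀ k, Submodule.span (R k) (Set.range (h k)) = ⊤ := by
  choose g hg using hg
  set N : ℝ := Fintype.card (ι ⊕ ι) + 1 with hN
  have hN1 : 1 ≤ N := by simp [hN]
  have hgφ : ∀ k, Submodule.span (R k) (Set.range (φ k ∘ g (k + 1))) = ⊤ := by
    intro k
    rw [eq_top_iff, ← hφ k, Submodule.span_le]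
    rintro _ ⟨x, rfl⟩
    obtain ⟨c, rfl⟩ := exists_coeff_of_span_eq_top (hg (k + 1)) x
    simp only [map_sum, map_smulₛₗ]
    exact Submodule.sum_mem _ fun j _ => Submodule.smul_mem _ _ (Submodule.subset_span ⟨j, rfl⟩)
  -- A matrix `E` carries the padded images of the next generators to the padded generators of this
  -- stage. Approximating `X * E` by a matrix `Y` from the next stage leaves the error `δ = (Y - X
  -- E) (X E)⁻¹`.
  have step : ∀ k (X : blockElementary (R k) ι), ∃ (Y : blockElementary (R (k + 1)) ι)
      (δ : Matrix (ι ⊕ ι) (ι ⊕ ι) (R k)), (∀ i j, ‖δ i j‖ ≤ 1 / (2 * N) * (1 / 4) ^ k) ∧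
      φ k ∘ matrixAct Y.1 (Sum.elim (0 : ι → V (k + 1)) (g (k + 1))) =
        matrixAct (1 + δ) (matrixAct X.1 (Sum.elim (0 : ι → V k) (g k))) := by
    rintro k ⟨X, hX⟩
    obtain ⟨E, hE, hEg⟩ := exists_blockElementary (hg k) (hgφ k)
    have hXE := mul_mem hX hE
    obtain ⟨Z, hZ⟩ := (isUnit_of_mem_blockElementary hXE).exists_left_inv
    have hmem := blockElementary_le_closure (hd k) hXE
    let f : Matrix (ι ⊕ ι) (ι ⊕ ι) (R k) → Matrix (ι ⊕ ι) (ι ⊕ ι) (R k) := fun Y => (Y - X * E) * Z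
    have hf : Continuous f := by fun_prop
    have hopen : IsOpen {Y | ∀ i j, ‖f Y i j‖ < 1 / (2 * N) * (1 / 4) ^ k} := by
      simp only [Set.ofPred_forall]
      refine isOpen_iInter_of_finite fun i => isOpen_iInter_of_finite fun j => ?_
      have : Continuous fun Y => ‖f Y i j‖ := (hf.matrix_elem i j).norm
      exact isOpen_lt this continuous_const
    obtain ⟨_, hY, Y, hYm, rfl⟩ := mem_closure_iff.1 hmem _ hopen (by
      intro i j
      simp only [f, sub_self, zero_mul, Matrix.zero_apply, norm_zero]
      positivity)
    refine ⟨⟨Y, hYm⟩, f (Y.map (ρ k)), fun i j => (hY i j).le, ?_⟩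
    have h0 : φ k ∘ (Sum.elim (0 : ι → V (k + 1)) (g (k + 1))) =
        Sum.elim (0 : ι → V k) (φ k ∘ g (k + 1)) := by
      ext (i | i) <;> simp
    rw [matrixAct_map, h0, ← hEg, ← matrixAct_mul, ← matrixAct_mul]
    congr 1
    have h1 : f (Y.map (ρ k)) * (X * E) = Y.map (ρ k) - X * E := by
      simp only [f]
      rw [mul_assoc, hZ, mul_one]
    rw [mul_assoc, add_mul, one_mul, h1]
    abel
  choose Y δ hδ hY using step
  let X : ∀ k, blockElementary (R k) ι := fun k =>
    Nat.rec (motive := fun k => blockElementary (R k) ι) 1 (fun k X => Y k X) k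
  have hX : ∀ k, X (k + 1) = Y k (X k) := fun _ => rfl
  let t : ∀ k, ι ⊕ ι → V k := fun k => matrixAct (X k).1 (Sum.elim (0 : ι → V k) (g k))
  have ht : ∀ k, φ k ∘ t (k + 1) = matrixAct (1 + δ k (X k)) (t k) := fun k => hY k (X k)
  have htspan : ∀ k, Submodule.span (R k) (Set.range (t k)) = ⊤ := by
    intro k
    refine span_matrixAct (isUnit_of_mem_blockElementary (X k).2) ?_
    rw [eq_top_iff, ← hg k, Submodule.span_le]
    rintro _ ⟨i, rfl⟩
    exact Submodule.subset_span ⟨Sum.inr i, rfl⟩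
  -- The tuples `t` are compatible up to `1 + δ`. The corrected tuples `(1 + s) t` are compatible
  -- once `s k = δ k + ρ (s (k + 1)) (1 + δ k)`, a summation along a tower whose transition maps are
  -- bounded by two.
  let φL : ∀ k, (ι ⊕ ι → ι ⊕ ι → R (k + 1)) →+ (ι ⊕ ι → ι ⊕ ι → R k) := fun k =>
    { toFun := fun a => ((Matrix.of a).map (ρ k) * (1 + δ k (X k)) : Matrix _ _ (R k))
      map_zero' := by
        ext i j
        simp [Matrix.mul_apply]
      map_add' := fun a b => by
        have : (Matrix.of (a + b)).map (ρ k) = (Matrix.of a).map (ρ k) + (Matrix.of b).map (ρ k) := by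
          ext i j
          simp
        rw [this, add_mul]
        rfl }
  have hφL : ∀ k a, ‖φL k a‖ ≤ 2 * ‖a‖ := by
    intro k a
    have ha : ∀ i j, ‖ρ k (a i j)‖ ≤ ‖a‖ := fun i j =>
      (hρ k _).trans ((norm_le_pi_norm (a i) j).trans (norm_le_pi_norm a i))
    rw [pi_norm_le_iff_of_nonneg (by positivity)]
    intro i
    rw [pi_norm_le_iff_of_nonneg (by positivity)]
    intro j
    have h1 : φL k a i j = ρ k (a i j) + ∑ l, ρ k (a i l) * δ k (X k) l j := by
      change ((Matrix.of a).map (ρ k) * (1 + δ k (X k)) : Matrix _ _ (R k)) i j = _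
      rw [mul_add, mul_one, Matrix.add_apply, Matrix.mul_apply]
      rfl
    rw [h1]
    refine (norm_add_le _ _).trans ?_
    have h2 : ‖∑ l, ρ k (a i l) * δ k (X k) l j‖ ≤ ‖a‖ := by
      refine (norm_sum_le _ _).trans ?_
      calc _ ≤ ∑ l : ι ⊕ ι, ‖a‖ * (1 / N) := by
            refine Finset.sum_le_sum fun l _ => (norm_mul_le _ _).trans ?_
            gcongr
            · exact ha i l
            · refine (hδ k (X k) l j).trans ?_
              calc _ ≤ 1 / (2 * N) * 1 := by
                    gcongr
                    exact pow_le_one₀ (by norm_num) (by norm_num)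
                _ ≤ 1 / N := by rw [mul_one]; gcongr; linarith
        _ = ‖a‖ * ((N - 1) / N) := by
            simp [hN]
            ring
        _ ≤ ‖a‖ * 1 := by
            gcongr
            rw [div_le_one (by linarith)]
            linarith
        _ = _ := mul_one _
    linarith [ha i j]
  -- The decay `(1 / 4) ^ k` of the errors against the growth `2 ^ k` leaves `(1 / 2) ^ k`; the
  -- resulting bound `1 / N` on `s` is exactly what the perturbation lemma tolerates.
  obtain ⟨s, hs, hsb⟩ := exists_tower_sum φL (fun _ => 2) (fun _ => one_le_two) hφL
    (fun k i j => δ k (X k) i j) (1 / (2 * N)) (by positivity) (fun k => by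
      have h1 : ‖(fun i j => δ k (X k) i j : ι ⊕ ι → ι ⊕ ι → R k)‖ ≤ 1 / (2 * N) * (1 / 4) ^ k := by
        rw [pi_norm_le_iff_of_nonneg (by positivity)]
        intro i
        rw [pi_norm_le_iff_of_nonneg (by positivity)]
        exact fun j => hδ k (X k) i j
      rw [Finset.prod_const, Finset.card_range]
      calc _ ≤ (2 : ℝ) ^ k * (1 / (2 * N) * (1 / 4) ^ k) := by gcongr
        _ = 1 / (2 * N) * (2 * (1 / 4)) ^ k := by rw [mul_pow]; ring
        _ = _ := by norm_num)
  have hs' : ∀ k, (1 + Matrix.of (s k)) = (1 + Matrix.of (s (k + 1))).map (ρ k) * (1 + δ k (X k)) := by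
    intro k
    rw [hs k]
    have : (1 + Matrix.of (s (k + 1))).map (ρ k) = 1 + (Matrix.of (s (k + 1))).map (ρ k) := by
      rw [Matrix.map_add _ (map_add _)]
      simp
    rw [this, add_mul, one_mul, add_assoc]
    rfl
  refine ⟨fun k => matrixAct (1 + Matrix.of (s k)) (t k), fun k i => ?_, fun k => ?_⟩
  · have := congr_fun (matrixAct_map (φ k) (1 + Matrix.of (s (k + 1))) (t (k + 1))) i
    rw [ht] at this
    change φ k (matrixAct (1 + Matrix.of (s (k + 1))) (t (k + 1)) i) =
      matrixAct (1 + Matrix.of (s k)) (t k) i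
    rw [hs' k, matrixAct_mul]
    exact this
  · refine span_eq_top_of_perturb (t k) _ (htspan k) (s k) (fun i j => ?_) fun i => ?_
    · have h1 : ‖s k i j‖ ≤ 2 * (1 / (2 * N)) :=
        (norm_le_pi_norm (s k i) j).trans ((norm_le_pi_norm (s k) i).trans (hsb k))
      calc _ ≤ 2 * (1 / (2 * N)) * N := by gcongr
        _ = 1 := by field_simp
    · change matrixAct (1 + Matrix.of (s k)) (t k) i = _
      rw [matrixAct_add, matrixAct_one]
      rfl

end UniformTower

/-! ### Noetherian Banach rings with bounded generation -/

section BoundedGeneration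

/-- Submodules of finite free modules are finitely generated, with bounded coefficients. -/
def HasBoundedGeneration (R : Type*) [NormedCommRing R] : Prop :=
  ∀ (n : ℕ) (J : Submodule R (Fin n → R)), ∃ (m : ℕ) (x : Fin m → Fin n → R) (C : ℝ), 0 ≤ C ∧
    (∀ i, x i ∈ J) ∧ ∀ y ∈ J, ∃ b : Fin m → R, ‖b‖ ≤ C * ‖y‖ ∧ y = ∑ i, b i • x i

variable {R : Type*} [NormedCommRing R]

theorem HasBoundedGeneration.isNoetherianRing (h : HasBoundedGeneration R) :
    IsNoetherianRing R := by
  have : IsNoetherian R (Fin 1 → R) := by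
    refine ⟨fun J => ?_⟩
    obtain ⟨m, x, C, _, hx, hJ⟩ := h 1 J
    refine Submodule.fg_def.2 ⟨Set.range x, Set.finite_range x, le_antisymm ?_ fun y hy => ?_⟩
    · rw [Submodule.span_le]
      rintro _ ⟨i, rfl⟩
      exact hx i
    · obtain ⟨b, _, rfl⟩ := hJ y hy
      exact Submodule.sum_mem _ fun i _ => Submodule.smul_mem _ _ (Submodule.subset_span ⟨i, rfl⟩)
  exact isNoetherian_of_linearEquiv (LinearEquiv.funUnique (Fin 1) R R)

/-- Rewriting the generators provided by `h` in terms of `x` costs only a constant, so any finite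
generating family admits bounded coefficients. -/
theorem HasBoundedGeneration.exists_bound (h : HasBoundedGeneration R) {n m : ℕ}
    (x : Fin m → Fin n → R) : ∃ C : ℝ, 0 ≤ C ∧ ∀ y ∈ Submodule.span R (Set.range x),
      ∃ b : Fin m → R, ‖b‖ ≤ C * ‖y‖ ∧ y = ∑ i, b i • x i := by
  obtain ⟨m', x', C, hC, hx', hJ⟩ := h n (Submodule.span R (Set.range x))
  choose c hc using fun i => (Submodule.mem_span_range_iff_exists_fun R).1 (hx' i)
  have hc0 : 0 ≤ ∑ i, ‖c i‖ := Finset.sum_nonneg fun i _ => norm_nonneg _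
  refine ⟨(∑ i, ‖c i‖) * C, by positivity, fun y hy => ?_⟩
  obtain ⟨b, hb, rfl⟩ := hJ y hy
  refine ⟨∑ i, b i • c i, ?_, ?_⟩
  · refine (norm_sum_le _ _).trans ?_
    rw [mul_assoc, Finset.sum_mul]
    refine Finset.sum_le_sum fun i _ => (norm_smul_le _ _).trans ?_
    rw [mul_comm]
    gcongr
    exact (norm_le_pi_norm b i).trans hb
  · simp_rw [Finset.sum_apply, Pi.smul_apply, Finset.sum_smul, smul_assoc]
    rw [Finset.sum_comm]
    simp_rw [← Finset.smul_sum, hc]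

variable {p : ℕ} [hp : Fact p.Prime]

theorem norm_zpow_mul {u : Rˣ} {c : ℝ} (hc : c ≠ 0) (hu : ∀ x, ‖(u : R) * x‖ = c * ‖x‖)
    (k : ℤ) (x : R) : ‖((u ^ k : Rˣ) : R) * x‖ = c ^ k * ‖x‖ := by
  induction k using Int.induction_on generalizing x with
  | zero => simp
  | succ k ih =>
    rw [zpow_add_one, Units.val_mul, mul_assoc, ih, hu, zpow_add_one₀ hc]
    ring
  | pred k ih =>
    have h1 : ‖((u⁻¹ : Rˣ) : R) * x‖ = c⁻¹ * ‖x‖ := by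
      have := hu (((u⁻¹ : Rˣ) : R) * x)
      rw [Units.mul_inv_cancel_left] at this
      rw [this]
      field_simp
    rw [zpow_sub_one, Units.val_mul, mul_assoc, ih, h1, zpow_sub_one₀ hc]
    ring

/-- A Banach algebra over `ℚ_p` with an open bounded subring that is of finite type modulo `p` has
bounded generation. -/
theorem hasBoundedGeneration_of_lattice [CompleteSpace R] (hu : IsUnit (p : R))
    (hnorm : ∀ x : R, ‖(p : R) * x‖ = (p : ℝ)⁻¹ * ‖x‖) (S : Subring R) (B : ℝ)
    (hB : ∀ x ∈ S, ‖x‖ ≤ B) (δ : ℝ) (hδ : 0 < δ) (hS : ∀ x : R, ‖x‖ ≤ δ → x ∈ S) (T : Set R)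
    (hT : T.Finite) (hTS : T ⊆ S)
    (hgen : ∀ x ∈ S, ∃ y ∈ Algebra.adjoin ℤ T, ∃ z ∈ S, x = y + p * z) :
    HasBoundedGeneration R := by
  intro n J
  have hp1 : (1 : ℝ) < p := by exact_mod_cast hp.out.one_lt
  have hp0 : (0 : ℝ) < p := zero_lt_one.trans hp1
  have hB0 : 0 ≤ B := (norm_nonneg _).trans (hB 0 S.zero_mem)
  -- Noetherianity comes from the Hilbert basis theorem over `ℤ`; nothing of the kind is assumed for
  -- the lattice `S`.
  have hnoeth : IsNoetherianRing (Algebra.adjoin ℤ T) := by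
    have : Algebra.FiniteType ℤ (Algebra.adjoin ℤ T) :=
      (Subalgebra.fg_iff_finiteType _).1 (Subalgebra.fg_def.2 ⟨T, hT, rfl⟩)
    exact Algebra.FiniteType.isNoetherianRing ℤ _
  have hAS : ∀ x ∈ Algebra.adjoin ℤ T, x ∈ S := by
    have : Algebra.adjoin ℤ T ≤ subalgebraOfSubring S := Algebra.adjoin_le hTS
    exact fun x hx => this hx
  -- the submodule of residues of lattice elements of `J`
  let JJ : Submodule (Algebra.adjoin ℤ T) (Fin n → Algebra.adjoin ℤ T) :=
    { carrier := {a | ∃ z : Fin n → R, (∀ i, z i ∈ S) ∧ (fun i => (a i : R) + p * z i) ∈ J}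
      zero_mem' := ⟨0, fun i => S.zero_mem, by
        convert J.zero_mem using 1
        ext i
        simp⟩
      add_mem' := by
        rintro a b ⟨z, hz, hJz⟩ ⟨w, hw, hJw⟩
        refine ⟨z + w, fun i => S.add_mem (hz i) (hw i), ?_⟩
        convert J.add_mem hJz hJw using 1
        ext i
        simp only [Pi.add_apply, Subalgebra.coe_add]
        ring
      smul_mem' := by
        rintro c a ⟨z, hz, hJz⟩
        refine ⟨fun i => c * z i, fun i => S.mul_mem (hAS _ c.2) (hz i), ?_⟩
        convert J.smul_mem (c : R) hJz using 1
        ext i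
        simp only [Pi.smul_apply, smul_eq_mul, Subalgebra.coe_mul]
        ring }
  obtain ⟨m, a, ha⟩ := Submodule.fg_iff_exists_fin_generating_family.1 (IsNoetherian.noetherian JJ)
  have haJ : ∀ i, a i ∈ JJ := fun i => ha ▸ Submodule.subset_span ⟨i, rfl⟩
  choose z hz hzJ using haJ
  let x : Fin m → Fin n → R := fun i j => (a i j : R) + p * z i j
  -- One step of `p`-adic division: the residue of `y` is a combination of residues of the `x i`,
  -- and the remainder is `p` times an integral vector. That vector stays in `J` because `p` is
  -- invertible in `R`.
  have step : ∀ y : Fin n → R, y ∈ J → (∀ i, y i ∈ S) → ∃ (c : Fin m → R) (y' : Fin n → R),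
      (∀ i, c i ∈ S) ∧ y' ∈ J ∧ (∀ i, y' i ∈ S) ∧ y = ∑ i, c i • x i + (p : R) • y' := by
    intro y hyJ hyS
    choose y1 hy1 y2 hy2 hy using fun i => hgen (y i) (hyS i)
    have hmem : (fun i => ⟨y1 i, hy1 i⟩ : Fin n → Algebra.adjoin ℤ T) ∈ JJ :=
      ⟨y2, hy2, by
        convert hyJ using 1
        ext i
        exact (hy i).symm⟩
    rw [← ha] at hmem
    obtain ⟨c, hc⟩ := (Submodule.mem_span_range_iff_exists_fun _).1 hmem
    have hc' : ∀ j, y1 j = ∑ i, (c i : R) * (a i j : R) := by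
      intro j
      have := congrArg (fun f : Fin n → Algebra.adjoin ℤ T => (f j : R)) hc
      simp only [Finset.sum_apply, Pi.smul_apply, smul_eq_mul] at this
      rw [← this]
      push_cast
      rfl
    have heq : y = ∑ i, (c i : R) • x i + (p : R) • (fun j => y2 j - ∑ i, (c i : R) * z i j) := by
      ext j
      rw [hy j, hc' j]
      simp only [x, Pi.add_apply, Finset.sum_apply, Pi.smul_apply, smul_eq_mul, mul_add,
        Finset.sum_add_distrib, mul_sub, Finset.mul_sum]
      have : ∀ i, (c i : R) * (p * z i j) = p * (c i * z i j) := fun i => by ring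
      simp_rw [this]
      ring
    refine ⟨fun i => c i, fun j => y2 j - ∑ i, (c i : R) * z i j, fun i => hAS _ (c i).2, ?_,
      fun j => S.sub_mem (hy2 j) (S.sum_mem fun i _ => S.mul_mem (hAS _ (c i).2) (hz i j)), heq⟩
    have h1 : (p : R) • (fun j => y2 j - ∑ i, (c i : R) * z i j) ∈ J := by
      rw [eq_sub_of_add_eq' heq.symm]
      exact J.sub_mem hyJ (J.sum_mem fun i _ => J.smul_mem _ (hzJ i))
    obtain ⟨u, hu⟩ := hu
    have h2 := J.smul_mem ((u⁻¹ : Rˣ) : R) h1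
    rwa [smul_smul, ← hu, Units.inv_mul, one_smul] at h2
  -- Iterating the division produces coefficients that are `p`-adic series with terms in `S`, hence
  -- bounded by a geometric series.
  have hlat : ∀ y : Fin n → R, y ∈ J → (∀ i, y i ∈ S) →
      ∃ b : Fin m → R, ‖b‖ ≤ B * (1 - (p : ℝ)⁻¹)⁻¹ ∧ y = ∑ i, b i • x i := by
    intro y hyJ hyS
    choose! c y' hc hyJ' hyS' heq using step
    let Y : ℕ → Fin n → R := fun k => y'^[k] y
    have hYs : ∀ k, Y (k + 1) = y' (Y k) := fun k => Function.iterate_succ_apply' _ _ _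
    have hY : ∀ k, Y k ∈ J ∧ ∀ i, Y k i ∈ S := by
      intro k
      induction k with
      | zero => exact ⟨hyJ, hyS⟩
      | succ k ih =>
        rw [hYs]
        exact ⟨hyJ' _ ih.1 ih.2, hyS' _ ih.1 ih.2⟩
    have hpow : ∀ (k : ℕ) (x : R), ‖(p : R) ^ k * x‖ = ((p : ℝ)⁻¹) ^ k * ‖x‖ := by
      intro k
      induction k with
      | zero => simp
      | succ k ih =>
        intro x
        rw [pow_succ, mul_assoc, ih, hnorm, pow_succ]
        ring
    have hpart : ∀ k, y = ∑ i, (∑ l ∈ Finset.range k, (p : R) ^ l * c (Y l) i) • x i +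
        (p : R) ^ k • Y k := by
      intro k
      induction k with
      | zero => simp [Y]
      | succ k ih =>
        conv_lhs => rw [ih, heq (Y k) (hY k).1 (hY k).2]
        rw [hYs]
        simp only [Finset.sum_range_succ, add_smul, Finset.sum_add_distrib, smul_add,
          Finset.smul_sum, smul_smul, pow_succ]
        abel
    have hpi1 : (p : ℝ)⁻¹ < 1 := inv_lt_one_of_one_lt₀ hp1
    have hpi0 : 0 ≤ (p : ℝ)⁻¹ := by positivity
    have hbd : ∀ i l, ‖(p : R) ^ l * c (Y l) i‖ ≤ B * ((p : ℝ)⁻¹) ^ l := by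
      intro i l
      rw [hpow, mul_comm]
      gcongr
      exact hB _ (hc _ (hY l).1 (hY l).2 i)
    have hgeo := (hasSum_geometric_of_lt_one hpi0 hpi1).mul_left B
    have hsum : ∀ i, Summable fun l => (p : R) ^ l * c (Y l) i := fun i =>
      Summable.of_norm_bounded hgeo.summable (hbd i)
    refine ⟨fun i => ∑' l, (p : R) ^ l * c (Y l) i, ?_, ?_⟩
    · rw [pi_norm_le_iff_of_nonneg (mul_nonneg hB0 (inv_nonneg.2 (by linarith)))]
      exact fun i => tsum_of_norm_bounded hgeo (hbd i)
    · have h1 : Tendsto (fun k => ∑ i, (∑ l ∈ Finset.range k, (p : R) ^ l * c (Y l) i) • x i +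
          (p : R) ^ k • Y k) atTop
          (𝓝 (∑ i, (∑' l, (p : R) ^ l * c (Y l) i) • x i + 0)) := by
        refine Tendsto.add (tendsto_finsetSum _ fun i _ => ?_) ?_
        · exact (hsum i).hasSum.tendsto_sum_nat.smul_const (x i)
        · rw [tendsto_pi_nhds]
          intro j
          refine squeeze_zero_norm (a := fun k => B * ((p : ℝ)⁻¹) ^ k) (fun k => ?_) ?_
          · rw [Pi.smul_apply, smul_eq_mul, hpow, mul_comm]
            gcongr
            exact hB _ ((hY k).2 j)
          · simpa using (tendsto_pow_atTop_nhds_zero_of_lt_one hpi0 hpi1).const_mul B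
      have h2 := tendsto_nhds_unique (h1.congr fun k => (hpart k).symm) tendsto_const_nhds
      rw [add_zero] at h2
      exact h2.symm
  refine ⟨m, x, B * (1 - (p : ℝ)⁻¹)⁻¹ * p / δ, ?_, fun i => hzJ i, fun y hy => ?_⟩
  · have : (p : ℝ)⁻¹ < 1 := inv_lt_one_of_one_lt₀ hp1
    have : 0 ≤ (1 - (p : ℝ)⁻¹)⁻¹ := inv_nonneg.2 (by linarith)
    positivity
  by_cases hy0 : y = 0
  · exact ⟨0, by simp [hy0], by simp [hy0]⟩
  have hyn : 0 < ‖y‖ := norm_pos_iff.2 hy0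
  -- The power of `p` that scales `y` into the ball of radius `δ` is chosen optimally, so that
  -- undoing it costs at most `p ‖y‖ / δ`.
  obtain ⟨k, hk1, hk2⟩ := exists_mem_Ioc_zpow (div_pos hyn hδ) hp1
  obtain ⟨u, hu⟩ := hu
  have hun : ∀ x, ‖(u : R) * x‖ = (p : ℝ)⁻¹ * ‖x‖ := by rw [hu]; exact hnorm
  have hun' := norm_zpow_mul (by positivity) hun
  obtain ⟨b, hb, hyb⟩ := hlat (((u ^ (k + 1) : Rˣ) : R) • y) (J.smul_mem _ hy) (fun i => by
    refine hS _ ?_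
    rw [Pi.smul_apply, smul_eq_mul, hun']
    rw [div_le_iff₀ hδ] at hk2
    calc _ ≤ ((p : ℝ)⁻¹) ^ (k + 1) * ((p : ℝ) ^ (k + 1) * δ) := by
          gcongr
          exact (norm_le_pi_norm y i).trans hk2
      _ = δ := by rw [← mul_assoc, ← mul_zpow, inv_mul_cancel₀ hp0.ne', one_zpow, one_mul])
  refine ⟨((u ^ (-(k + 1)) : Rˣ) : R) • b, ?_, ?_⟩
  · have hC : 0 ≤ B * (1 - (p : ℝ)⁻¹)⁻¹ := (norm_nonneg _).trans hb
    rw [pi_norm_le_iff_of_nonneg (by positivity)]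
    intro i
    rw [Pi.smul_apply, smul_eq_mul, hun', inv_zpow, ← zpow_neg, neg_neg, zpow_add_one₀ hp0.ne']
    rw [lt_div_iff₀ hδ] at hk1
    calc _ ≤ (p : ℝ) ^ k * p * (B * (1 - (p : ℝ)⁻¹)⁻¹) := by
          gcongr
          exact (norm_le_pi_norm b i).trans hb
      _ = ((p : ℝ) ^ k * δ) * ((B * (1 - (p : ℝ)⁻¹)⁻¹) * p / δ) := by field_simp
      _ ≤ ‖y‖ * ((B * (1 - (p : ℝ)⁻¹)⁻¹) * p / δ) := by gcongr
      _ = _ := by ring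
  · have h1 := congrArg (fun v => ((u ^ (-(k + 1)) : Rˣ) : R) • v) hyb
    simp only [smul_smul, Finset.smul_sum] at h1
    rw [← Units.val_mul, ← zpow_add, neg_add_cancel, zpow_zero, Units.val_one, one_smul] at h1
    simpa using h1

end BoundedGeneration

/-! ### Rings of convergent series in one element -/

section SeriesExtension

/-- `f : R → R'` exhibits `R'` as a ring of convergent series `∑ y_j Y^j` with `y_j ∈ R`, where
`a Y = b`: every element has such an expansion, and every expansion of zero is a multiple
of `b - a Y`. -/
structure IsSeriesExtension {R R' : Type*} [NormedCommRing R] [NormedCommRing R'] (f : R →+* R')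
    (a b : R) (Y : R') (σ : ℝ) : Prop where
  pos : 0 < σ
  rel : f b = f a * Y
  bound : ∃ C : ℝ, ∀ (x : R) (j : ℕ), ‖f x * Y ^ j‖ ≤ C * (‖x‖ * σ ^ j)
  expansion : ∀ y : R', ∃ c : ℕ → R, Tendsto (fun j => ‖c j‖ * σ ^ j) atTop (𝓝 0) ∧
    Tendsto (fun n => ∑ j ∈ Finset.range n, f (c j) * Y ^ j) atTop (𝓝 y)
  division : ∀ z : ℕ → R, Tendsto (fun j => ‖z j‖ * σ ^ j) atTop (𝓝 0) →
    Tendsto (fun n => ∑ j ∈ Finset.range n, f (z j) * Y ^ j) atTop (𝓝 0) →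
    ∃ q : ℕ → R, Tendsto (fun j => ‖q j‖ * σ ^ j) atTop (𝓝 0) ∧ z 0 = b * q 0 ∧
      ∀ j, z (j + 1) = b * q (j + 1) - a * q j

variable {R R' : Type*} [NormedCommRing R] [NormedCommRing R'] {f : R →+* R'} {a b : R} {Y : R'}
  {σ : ℝ}

theorem tendsto_weighted_of_le {E F : Type*} [SeminormedAddCommGroup E] [SeminormedAddCommGroup F]
    {σ : ℝ} (hσ : 0 < σ) {u : ℕ → E} {v : ℕ → F} (C : ℝ) (h : ∀ j, ‖v j‖ ≤ C * ‖u j‖)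
    (hu : Tendsto (fun j => ‖u j‖ * σ ^ j) atTop (𝓝 0)) :
    Tendsto (fun j => ‖v j‖ * σ ^ j) atTop (𝓝 0) := by
  refine squeeze_zero (fun j => by positivity) (g := fun j => C * (‖u j‖ * σ ^ j)) (fun j => ?_) ?_
  · rw [← mul_assoc]
    gcongr
    exact h j
  · simpa using hu.const_mul C

theorem tendsto_weighted_sum {E ι : Type*} [SeminormedAddCommGroup E] [Fintype ι]
    {σ : ℝ} (hσ : 0 < σ) {u : ι → ℕ → E}
    (hu : ∀ i, Tendsto (fun j => ‖u i j‖ * σ ^ j) atTop (𝓝 0)) :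
    Tendsto (fun j => ‖∑ i, u i j‖ * σ ^ j) atTop (𝓝 0) := by
  refine squeeze_zero (fun j => by positivity) (g := fun j => ∑ i, ‖u i j‖ * σ ^ j) (fun j => ?_) ?_
  · rw [← Finset.sum_mul]
    gcongr
    exact norm_sum_le _ _
  · simpa using tendsto_finsetSum Finset.univ fun i _ => hu i

theorem tendsto_weighted_pi {E ι : Type*} [SeminormedAddCommGroup E] [Fintype ι]
    {σ : ℝ} (hσ : 0 < σ) {u : ℕ → ι → E}
    (hu : ∀ i, Tendsto (fun j => ‖u j i‖ * σ ^ j) atTop (𝓝 0)) :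
    Tendsto (fun j => ‖u j‖ * σ ^ j) atTop (𝓝 0) := by
  refine squeeze_zero (fun j => by positivity) (g := fun j => ∑ i, ‖u j i‖ * σ ^ j) (fun j => ?_) ?_
  · rw [← Finset.sum_mul]
    gcongr
    rw [pi_norm_le_iff_of_nonneg (by positivity)]
    exact fun i => Finset.single_le_sum (f := fun i => ‖u j i‖) (fun i _ => norm_nonneg _)
      (Finset.mem_univ i)
  · simpa using tendsto_finsetSum Finset.univ fun i _ => hu i

theorem tendsto_weighted_add {E : Type*} [SeminormedAddCommGroup E]
    {σ : ℝ} (hσ : 0 < σ) {u v : ℕ → E}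
    (hu : Tendsto (fun j => ‖u j‖ * σ ^ j) atTop (𝓝 0))
    (hv : Tendsto (fun j => ‖v j‖ * σ ^ j) atTop (𝓝 0)) :
    Tendsto (fun j => ‖u j + v j‖ * σ ^ j) atTop (𝓝 0) := by
  refine squeeze_zero (fun j => by positivity) (g := fun j => ‖u j‖ * σ ^ j + ‖v j‖ * σ ^ j)
    (fun j => ?_) (by simpa using hu.add hv)
  rw [← add_mul]
  gcongr
  exact norm_add_le _ _

/-- Expansions of zero whose coefficients lie in a submodule modulo a vector. -/
theorem IsSeriesExtension.exists_division_of_mem_span (h : IsSeriesExtension f a b Y σ)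
    {ι : Type*} [Fintype ι] (P : Submodule R (ι → R)) (x : ι → R)
    (hx : f ∘ x ∈ Submodule.span R' ((fun y : ι → R => f ∘ y) '' P)) :
    ∃ q : ℕ → ι → R, Tendsto (fun j => ‖q j‖ * σ ^ j) atTop (𝓝 0) ∧ x - b • q 0 ∈ P ∧
      ∀ j, b • q (j + 1) - a • q j ∈ P := by
  obtain ⟨n, α, g, hg⟩ := Submodule.mem_span_set'.1 hx
  choose π hπ hgπ using fun l => (g l).2
  choose c hc hcα using fun l => h.expansion (α l)
  -- Expanding the coefficients `α l` in powers of `Y` gives an expansion of zero whose terms are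
  -- `x, 0, 0, …` modulo `P`. Its quotients by `b - a Y` are the desired `q`.
  let z : ℕ → ι → R := fun j => (if j = 0 then x else 0) - ∑ l, c l j • π l
  have hz : ∀ i, Tendsto (fun j => ‖z j i‖ * σ ^ j) atTop (𝓝 0) := by
    intro i
    have h1 : Tendsto (fun j => ‖∑ l, - (c l j • π l i)‖ * σ ^ j) atTop (𝓝 0) := by
      refine tendsto_weighted_sum h.pos fun l => ?_
      refine tendsto_weighted_of_le h.pos ‖π l i‖ (fun j => ?_) (hc l)
      rw [norm_neg, smul_eq_mul, mul_comm ‖π l i‖]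
      exact norm_mul_le _ _
    refine h1.congr' ?_
    filter_upwards [eventually_ne_atTop 0] with j hj
    congr 2
    simp [z, hj]
  have hz0 : ∀ i, Tendsto (fun n => ∑ j ∈ Finset.range n, f (z j i) * Y ^ j) atTop (𝓝 0) := by
    intro i
    have h1 : Tendsto (fun n => f (x i) - ∑ l, (∑ j ∈ Finset.range n, f (c l j) * Y ^ j) * f (π l i))
        atTop (𝓝 (f (x i) - ∑ l, α l * f (π l i))) :=
      tendsto_const_nhds.sub (tendsto_finsetSum _ fun l _ => (hcα l).mul_const _)
    have h2 : f (x i) - ∑ l, α l * f (π l i) = 0 := by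
      have := congr_fun hg i
      simp only [Finset.sum_apply, Pi.smul_apply, smul_eq_mul, ← hgπ, Function.comp_apply] at this
      rw [this, sub_self]
    rw [h2] at h1
    refine h1.congr' ?_
    filter_upwards [eventually_gt_atTop 0] with n hn
    obtain ⟨n, rfl⟩ := Nat.exists_eq_succ_of_ne_zero hn.ne'
    have h3 : ∀ j, f (z j i) * Y ^ j = (if j = 0 then f (x i) else 0) -
        ∑ l, f (c l j) * Y ^ j * f (π l i) := by
      intro j
      simp only [z, Pi.sub_apply, Finset.sum_apply, Pi.smul_apply, smul_eq_mul, map_sub, map_sum,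
        map_mul, sub_mul, Finset.sum_mul]
      congr 1
      · split_ifs with hj <;> simp [hj]
      · exact Finset.sum_congr rfl fun l _ => by ring
    simp_rw [h3]
    rw [Finset.sum_sub_distrib, Finset.sum_comm]
    simp [Finset.sum_mul]
  choose q hq hq0 hqs using fun i => h.division (fun j => z j i) (hz i) (hz0 i)
  refine ⟨fun j i => q i j, tendsto_weighted_pi h.pos hq, ?_, fun j => ?_⟩
  · have : x - b • (fun i => q i 0) = ∑ l, c l 0 • π l := by
      ext i
      have := hq0 i
      simp only [z, if_true, Pi.sub_apply] at this
      simp only [Pi.sub_apply, Pi.smul_apply, smul_eq_mul, ← this]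
      simp
    rw [this]
    exact P.sum_mem fun l _ => P.smul_mem _ (hπ l)
  · have : b • (fun i => q i (j + 1)) - a • (fun i => q i j) = -∑ l, c l (j + 1) • π l := by
      ext i
      have := hqs i j
      simp only [z, Nat.add_one_ne_zero, if_false, Pi.sub_apply] at this
      simp only [Pi.sub_apply, Pi.smul_apply, smul_eq_mul, ← this]
      simp
    rw [this]
    exact P.neg_mem (P.sum_mem fun l _ => P.smul_mem _ (hπ l))

/-- A submodule that becomes everything on `|T| ≥ ρ` and on `|T| ≤ ρ` is everything. -/
theorem eq_top_of_span_eq_top_of_cover [CompleteSpace R] {R₁ R₂ : Type*} [NormedCommRing R₁]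
    [NormedCommRing R₂] {f₁ : R →+* R₁} {f₂ : R →+* R₂} {T : R} {Y₁ : R₁} {Y₂ : R₂} {σ₁ σ₂ : ℝ}
    (h₁ : IsSeriesExtension f₁ T 1 Y₁ σ₁) (h₂ : IsSeriesExtension f₂ 1 T Y₂ σ₂)
    (hσ : σ₁ * σ₂ = 1) {ι : Type*} [Fintype ι] (P : Submodule R (ι → R))
    (hP₁ : Submodule.span R₁ ((fun y : ι → R => f₁ ∘ y) '' P) = ⊤)
    (hP₂ : Submodule.span R₂ ((fun y : ι → R => f₂ ∘ y) '' P) = ⊤) : P = ⊤ := by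
  classical
  let e : ι → ι → R := fun i => Pi.single i 1
  choose u hu hu0 hus using fun i => h₁.exists_division_of_mem_span P (e i) (hP₁ ▸ Submodule.mem_top)
  choose v hv hv0 hvs using fun i => h₂.exists_division_of_mem_span P (e i) (hP₂ ▸ Submodule.mem_top)
  -- Modulo `P`, the quotients on the first piece satisfy `u (d + 1) ≡ T u d`, and those on the
  -- second satisfy `T v (d + 1) ≡ v d`. So `T ^ d e i` is represented by `u i d`, while `e i` is
  -- represented by `T ^ (d + 1) v i d`.
  have hu' : ∀ i d, T ^ d • e i - u i d ∈ P := by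
    intro i d
    induction d with
    | zero => simpa using hu0 i
    | succ d ih =>
      have h3 : T ^ (d + 1) • e i - u i (d + 1) =
          T • (T ^ d • e i - u i d) - ((1 : R) • u i (d + 1) - T • u i d) := by
        rw [smul_sub, smul_smul, ← pow_succ', one_smul]
        abel
      rw [h3]
      exact P.sub_mem (P.smul_mem _ ih) (hus i d)
  have hv' : ∀ i d, e i - T ^ (d + 1) • v i d ∈ P := by
    intro i d
    induction d with
    | zero => simpa using hv0 i
    | succ d ih =>
      have h3 : e i - T ^ (d + 1 + 1) • v i (d + 1) =
          (e i - T ^ (d + 1) • v i d) - T ^ (d + 1) • (T • v i (d + 1) - (1 : R) • v i d) := by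
        rw [smul_sub, smul_smul, ← pow_succ, one_smul]
        abel
      rw [h3]
      exact P.sub_mem ih (P.smul_mem _ (hvs i d))
  set N : ℝ := Fintype.card ι + 1 with hN
  have hN0 : 1 ≤ N := by simp [hN]
  -- Together the two congruences give `e i ≡ ∑ j, v i d j • u j (d + 1)`. Since `σ₁ σ₂ = 1` the
  -- weights cancel and these coefficients become small; the factor `σ₁` accounts for the shift
  -- between `d` and `d + 1`.
  have hev : ∀ᶠ d in atTop, (∀ i, ‖u i (d + 1)‖ * σ₁ ^ (d + 1) < 1) ∧
      ∀ i, ‖v i d‖ * σ₂ ^ d < σ₁ / N ^ 2 := by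
    refine Eventually.and (eventually_all.2 fun i => ?_) (eventually_all.2 fun i => ?_)
    · exact ((tendsto_add_atTop_iff_nat 1).2 (hu i)).eventually_lt_const one_pos
    · exact (hv i).eventually_lt_const (by have := h₁.pos; positivity)
  obtain ⟨d, hd1, hd2⟩ := hev.exists
  have hprod : ∀ i j k, ‖v i d j * u j (d + 1) k‖ ≤ 1 / N ^ 2 := by
    intro i j k
    have h1 := h₁.pos
    have h2 := h₂.pos
    have h3 : ‖v i d j * u j (d + 1) k‖ ≤ ‖v i d‖ * ‖u j (d + 1)‖ :=
      (norm_mul_le _ _).trans (by gcongr <;> exact norm_le_pi_norm _ _)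
    refine h3.trans ?_
    have h4 : ‖v i d‖ * ‖u j (d + 1)‖ =
        (‖v i d‖ * σ₂ ^ d) * (‖u j (d + 1)‖ * σ₁ ^ (d + 1)) / σ₁ := by
      have : (σ₁ * σ₂) ^ d = 1 := by rw [hσ, one_pow]
      rw [mul_pow] at this
      rw [eq_div_iff h1.ne', pow_succ]
      linear_combination (-‖v i d‖ * ‖u j (d + 1)‖ * σ₁) * this
    rw [h4, div_le_iff₀ h1]
    calc _ ≤ (σ₁ / N ^ 2) * 1 := by
          gcongr
          · exact (hd2 i).le
          · exact (hd1 j).le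
      _ = _ := by ring
  have hmem : ∀ i, e i ∈ P := by
    refine mem_of_sub_small_mem e P (fun i k => ∑ j, v i d j * u j (d + 1) k) (fun i k => ?_)
      fun i => ?_
    · have : ‖∑ j, v i d j * u j (d + 1) k‖ ≤ 1 / N := by
        refine (norm_sum_le _ _).trans ((Finset.sum_le_sum fun j _ => hprod i j k).trans ?_)
        rw [Finset.sum_const, nsmul_eq_mul, Finset.card_univ]
        calc _ ≤ N * (1 / N ^ 2) := by gcongr; simp [hN]
          _ = 1 / N := by field_simp
      calc _ ≤ 1 / N * N := by gcongr
        _ = 1 := by field_simp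
    · have h5 : ∀ w : ι → R, w = ∑ j, w j • e j := fun w => by
        ext k
        simp [e, Pi.single_apply]
      have h6 : ∑ k, (∑ j, v i d j * u j (d + 1) k) • e k = ∑ j, v i d j • u j (d + 1) := by
        simp_rw [Finset.sum_smul, mul_smul]
        rw [Finset.sum_comm]
        simp_rw [← Finset.smul_sum, ← h5]
      have h7 : e i - ∑ j, v i d j • u j (d + 1) = (e i - T ^ (d + 1) • v i d) +
          ∑ j, v i d j • (T ^ (d + 1) • e j - u j (d + 1)) := by
        conv_rhs => rw [h5 (v i d)]
        simp only [smul_sub, Finset.sum_sub_distrib, Finset.smul_sum, smul_smul]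
        have : ∀ j, T ^ (d + 1) * v i d j = v i d j * T ^ (d + 1) := fun j => mul_comm _ _
        simp only [Finset.sum_apply, Pi.smul_apply, ← h5, this]
        simp [e, Pi.single_apply]
      rw [h6, h7]
      exact P.add_mem (hv' i d) (P.sum_mem fun j _ => P.smul_mem _ (hu' j (d + 1)))
  rw [eq_top_iff]
  intro w _
  have h5 : w = ∑ j, w j • e j := by
    ext k
    simp [e, Pi.single_apply]
  rw [h5]
  exact P.sum_mem fun j _ => P.smul_mem _ (hmem j)

end SeriesExtension

/-! ### Flatness of rings of convergent series -/

section SeriesExtension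

variable {R R' : Type*} [NormedCommRing R] [NormedCommRing R'] {f : R →+* R'} {a b : R} {Y : R'}
  {σ : ℝ}

theorem IsSeriesExtension.exists_hasSum [CompleteSpace R'] [IsUltrametricDist R']
    (h : IsSeriesExtension f a b Y σ) (c : ℕ → R)
    (hc : Tendsto (fun j => ‖c j‖ * σ ^ j) atTop (𝓝 0)) :
    ∃ y, Tendsto (fun n => ∑ j ∈ Finset.range n, f (c j) * Y ^ j) atTop (𝓝 y) := by
  obtain ⟨C, hC⟩ := h.bound
  have : Summable fun j => f (c j) * Y ^ j := by
    refine NonarchimedeanAddGroup.summable_of_tendsto_cofinite_zero ?_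
    rw [Nat.cofinite_eq_atTop]
    exact squeeze_zero_norm (fun j => hC (c j) j) (by simpa using hc.const_mul C)
  exact ⟨_, this.hasSum.tendsto_sum_nat⟩

/-- Quotients of an expansion of zero with coefficients in an ideal lie in the ideal, up to
noetherian induction. -/
theorem mem_ideal_of_recurrence [IsNoetherianRing R] (hab : a = 1 ∨ b = 1) (N : Ideal R)
    (q : ℕ → R) (h0 : b * q 0 ∈ N) (hs : ∀ j, b * q (j + 1) - a * q j ∈ N) (j : ℕ) : q j ∈ N := by
  rcases hab with rfl | rfl
  · have h1 : ∀ i j, q j - b ^ i * q (j + i) ∈ N := by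
      intro i
      induction i with
      | zero => intro j; simp
      | succ i ih =>
        intro j
        have h2 : q j - b ^ (i + 1) * q (j + (i + 1)) =
            (q j - b ^ i * q (j + i)) - b ^ i * (b * q (j + i + 1) - 1 * q (j + i)) := by
          rw [← add_assoc]; ring
        rw [h2]
        exact N.sub_mem (ih j) (N.mul_mem_left _ (hs _))
    have h2 : ∀ j, b ^ (j + 1) * q j ∈ N := by
      intro j
      have h3 := N.sub_mem h0 (N.mul_mem_left b (h1 j 0))
      rw [zero_add] at h3
      convert h3 using 1
      ring
    -- For `a = 1` the recurrence only shows `b ^ (j + 1) q j ∈ N`, with exponents growing in `j`.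
    -- The chain of ideals `(N : b ^ i)` stabilises at some `m`, and `q j ≡ b ^ m q (j + m)` modulo
    -- `N` then lies in `N`.
    let K : ℕ →o Ideal R :=
      { toFun := fun i => Submodule.comap (LinearMap.mulLeft R (b ^ i)) N
        monotone' := by
          refine monotone_nat_of_le_succ fun i x hx => ?_
          change b ^ (i + 1) * x ∈ N
          rw [pow_succ', mul_assoc]
          exact N.mul_mem_left _ hx }
    obtain ⟨m, hm⟩ := monotone_stabilizes_iff_noetherian.2 ‹IsNoetherianRing R› K
    have h4 : q (j + m) ∈ K (j + m + 1) := h2 (j + m)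
    rw [← hm (j + m + 1) (by omega)] at h4
    have h5 : b ^ m * q (j + m) ∈ N := h4
    simpa using N.add_mem (h1 m j) h5
  · induction j with
    | zero => simpa using h0
    | succ j ih => simpa using N.add_mem (hs j) (N.mul_mem_left a ih)

/-- Rings of convergent series are flat. -/
theorem IsSeriesExtension.flat [CompleteSpace R'] [IsUltrametricDist R']
    (h : IsSeriesExtension f a b Y σ) (hab : a = 1 ∨ b = 1) (hR : HasBoundedGeneration R) :
    f.Flat := by
  have hnoeth := hR.isNoetherianRing
  algebraize [f]
  -- By the equational criterion, a relation `∑ n i y i = 0` has to come from relations over `R`.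
  -- The expansions of the `y i` are altered by multiples of `b - a Y` until every coefficient
  -- vector is itself such a relation.
  refine Module.Flat.of_forall_isTrivialRelation fun {l n y} hny => ?_
  have hny' : ∑ i, f (n i) * y i = 0 := hny
  choose c hc hcy using fun i => h.expansion (y i)
  -- the expansion of the relation
  obtain ⟨q, hq, hq0, hqs⟩ := h.division (fun j => ∑ i, n i * c i j)
    (tendsto_weighted_sum h.pos fun i =>
      tendsto_weighted_of_le h.pos ‖n i‖ (fun j => norm_mul_le _ _) (hc i)) (by
    have h1 : Tendsto (fun N => ∑ i, f (n i) * ∑ j ∈ Finset.range N, f (c i j) * Y ^ j) atTop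
        (𝓝 (∑ i, f (n i) * y i)) := tendsto_finsetSum _ fun i _ => (hcy i).const_mul _
    rw [hny'] at h1
    refine h1.congr fun N => ?_
    simp_rw [Finset.mul_sum, map_sum, map_mul, Finset.sum_mul]
    rw [Finset.sum_comm]
    exact Finset.sum_congr rfl fun j _ => Finset.sum_congr rfl fun i _ => by ring)
  have hqN : ∀ j, q j ∈ Ideal.span (Set.range n) := by
    refine mem_ideal_of_recurrence hab _ q ?_ fun j => ?_
    · rw [← hq0]
      exact Ideal.sum_mem _ fun i _ => Ideal.mul_mem_right _ _ (Ideal.subset_span ⟨i, rfl⟩)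
    · rw [← hqs]
      exact Ideal.sum_mem _ fun i _ => Ideal.mul_mem_right _ _ (Ideal.subset_span ⟨i, rfl⟩)
  -- bounded coefficients for the quotients
  obtain ⟨C, hC0, hC⟩ := hR.exists_bound (n := 1) (fun i _ => n i)
  have hw : ∀ j, ∃ w : Fin l → R, ‖w‖ ≤ C * ‖q j‖ ∧ q j = ∑ i, w i * n i := by
    intro j
    obtain ⟨w, hw1, hw2⟩ := hC (fun _ => q j) (by
      obtain ⟨w, hw⟩ := (Submodule.mem_span_range_iff_exists_fun R).1 (hqN j)
      refine (Submodule.mem_span_range_iff_exists_fun R).2 ⟨w, ?_⟩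
      ext k
      simpa using hw)
    refine ⟨w, by simpa using hw1, ?_⟩
    simpa using congr_fun hw2 0
  choose w hwb hwq using hw
  -- The vectors `w j` lift the quotients `q j` through the pairing with `n`. Subtracting `(b - a Y)
  -- ∑ w j Y ^ j` therefore cancels that pairing in each degree without changing the sum.
  let ζ : ℕ → Fin l → R := fun j => Nat.casesOn j (fun i => c i 0 - b * w 0 i)
    (fun j i => c i (j + 1) - (b * w (j + 1) i - a * w j i))
  have hζ0 : ∀ i, ζ 0 i = c i 0 - b * w 0 i := fun _ => rfl
  have hζs : ∀ j i, ζ (j + 1) i = c i (j + 1) - (b * w (j + 1) i - a * w j i) := fun _ _ => rfl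
  have hwt : ∀ i, Tendsto (fun j => ‖w j i‖ * σ ^ j) atTop (𝓝 0) := fun i =>
    tendsto_weighted_of_le h.pos C (fun j => (norm_le_pi_norm (w j) i).trans (hwb j)) hq
  have hζt : Tendsto (fun j => ‖ζ j‖ * σ ^ j) atTop (𝓝 0) := by
    refine tendsto_weighted_pi h.pos fun i => ?_
    rw [← tendsto_add_atTop_iff_nat 1]
    have h1 : Tendsto (fun j => ‖c i (j + 1)‖ * σ ^ j) atTop (𝓝 0) := by
      have := ((tendsto_add_atTop_iff_nat 1).2 (hc i)).mul_const σ⁻¹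
      rw [zero_mul] at this
      refine this.congr fun j => ?_
      have := h.pos
      rw [pow_succ]
      field_simp
    have h2 : Tendsto (fun j => ‖b * w (j + 1) i‖ * σ ^ j) atTop (𝓝 0) := by
      have := ((tendsto_add_atTop_iff_nat 1).2 (tendsto_weighted_of_le h.pos ‖b‖
        (fun j => norm_mul_le b _) (hwt i))).mul_const σ⁻¹
      rw [zero_mul] at this
      refine this.congr fun j => ?_
      have := h.pos
      rw [pow_succ]
      field_simp
    have h3 : Tendsto (fun j => ‖a * w j i‖ * σ ^ j) atTop (𝓝 0) :=
      tendsto_weighted_of_le h.pos ‖a‖ (fun j => norm_mul_le a _) (hwt i)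
    have h4 := tendsto_weighted_add h.pos h1 (tendsto_weighted_add h.pos
      (u := fun j => -(b * w (j + 1) i)) (by simpa only [norm_neg] using h2) h3)
    have h5 := h4.mul_const σ
    rw [zero_mul] at h5
    refine h5.congr fun j => ?_
    rw [hζs, pow_succ, mul_assoc]
    congr 2
    ring
  -- the corrected expansions are relations over `R`
  let Z : Submodule R (Fin l → R) := LinearMap.ker (Fintype.linearCombination R n)
  have hZ : ∀ v, v ∈ Z ↔ ∑ i, v i * n i = 0 := fun v => by
    simp [Z, Fintype.linearCombination_apply]
  have hζZ : ∀ j, ζ j ∈ Z := by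
    intro j
    rw [hZ]
    cases j with
    | zero =>
      simp only [hζ0, sub_mul, Finset.sum_sub_distrib, mul_assoc, ← Finset.mul_sum, ← hwq]
      rw [← hq0, sub_eq_zero]
      exact Finset.sum_congr rfl fun i _ => mul_comm _ _
    | succ j =>
      simp only [hζs, sub_mul, Finset.sum_sub_distrib, mul_assoc, ← Finset.mul_sum, ← hwq]
      rw [← hqs, sub_eq_zero]
      exact Finset.sum_congr rfl fun i _ => mul_comm _ _
  obtain ⟨m, g, C', hC', hg, hgen⟩ := hR l Z
  choose d hdb hd using fun j => hgen (ζ j) (hζZ j)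
  have hdt : ∀ k, Tendsto (fun j => ‖d j k‖ * σ ^ j) atTop (𝓝 0) := fun k =>
    tendsto_weighted_of_le h.pos C' (fun j => (norm_le_pi_norm (d j) k).trans (hdb j)) hζt
  choose η hη using fun k => h.exists_hasSum (fun j => d j k) (hdt k)
  refine ⟨m, fun i k => g k i, η, fun i => ?_, fun k => ?_⟩
  · have h1 : Tendsto (fun N => ∑ k, f (g k i) * ∑ j ∈ Finset.range N, f (d j k) * Y ^ j) atTop
        (𝓝 (∑ k, f (g k i) * η k)) := tendsto_finsetSum _ fun k _ => (hη k).const_mul _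
    have h2 : ∀ N, ∑ k, f (g k i) * ∑ j ∈ Finset.range N, f (d j k) * Y ^ j =
        ∑ j ∈ Finset.range N, f (ζ j i) * Y ^ j := by
      intro N
      simp_rw [Finset.mul_sum]
      rw [Finset.sum_comm]
      refine Finset.sum_congr rfl fun j _ => ?_
      have : ζ j i = ∑ k, d j k * g k i := by
        conv_lhs => rw [hd j]
        simp
      rw [this, map_sum, Finset.sum_mul]
      exact Finset.sum_congr rfl fun k _ => by rw [map_mul]; ring
    -- Because `f b = f a * Y`, the correction telescopes to its last term, which tends to zero.
    have h3 : ∀ N, ∑ j ∈ Finset.range (N + 1), f (ζ j i) * Y ^ j =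
        ∑ j ∈ Finset.range (N + 1), f (c i j) * Y ^ j - f b * (f (w N i) * Y ^ N) := by
      intro N
      induction N with
      | zero => simp [hζ0]
      | succ N ih =>
        rw [Finset.sum_range_succ, ih, Finset.sum_range_succ _ (N + 1), hζs]
        simp only [map_sub, map_mul]
        have := h.rel
        rw [pow_succ]
        linear_combination (- f (w N i) * Y ^ N) * this
    obtain ⟨B, hB⟩ := h.bound
    have h4 : Tendsto (fun N => ∑ j ∈ Finset.range (N + 1), f (ζ j i) * Y ^ j) atTop
        (𝓝 (y i - f b * 0)) := by
      simp_rw [h3]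
      refine ((tendsto_add_atTop_iff_nat 1).2 (hcy i)).sub (Tendsto.const_mul _ ?_)
      exact squeeze_zero_norm (fun N => hB (w N i) N) (by simpa using (hwt i).const_mul B)
    have h5 := tendsto_nhds_unique ((tendsto_add_atTop_iff_nat 1).2 (h1.congr h2)) h4
    rw [mul_zero, sub_zero] at h5
    rw [← h5]
    exact Finset.sum_congr rfl fun k _ => (Algebra.smul_def _ _).symm
  · have := (hZ _).1 (hg k)
    rw [← this]
    exact Finset.sum_congr rfl fun i _ => mul_comm _ _

end SeriesExtension

/-! ### Monomials in the rings of analytic functions -/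

section Weights

variable {I : Type*}

theorem radialFactor_coe (p : ℕ) [Fact p.Prime] (q : ℚ) (n : ℤ) :
    radialFactor p q n = radialFactor p q 1 ^ n := by
  simp only [radialFactor]
  rw [← NNReal.rpow_intCast, ← NNReal.rpow_mul]
  congr 1
  push_cast
  ring

theorem radialFactor_pos (p : ℕ) [hp : Fact p.Prime] (q : ℚ) (n : ℤ) :
    0 < radialFactor p q n := by
  simp only [radialFactor]
  exact NNReal.rpow_pos (by exact_mod_cast hp.out.pos)

theorem radialFactor_lt (p : ℕ) [hp : Fact p.Prime] {q q' : ℚ} (h : q < q') :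
    radialFactor p q' 1 < radialFactor p q 1 := by
  have hp1 : (1 : ℝ≥0) < p := by exact_mod_cast hp.out.one_lt
  have hp2 : (0 : ℝ) < (p : ℝ) - 1 := by
    have : (1 : ℝ) < p := by exact_mod_cast hp.out.one_lt
    linarith
  have h' : (q : ℝ) < q' := by exact_mod_cast h
  simp only [radialFactor]
  apply NNReal.rpow_lt_rpow_of_exponent_lt hp1
  gcongr

theorem radialFactor_le_of_le (p : ℕ) [hp : Fact p.Prime] {q q' : ℚ} (h : q ≤ q') :
    radialFactor p q' 1 ≤ radialFactor p q 1 := by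
  rcases h.eq_or_lt with rfl | h
  · exact le_rfl
  · exact (radialFactor_lt p h).le

theorem radialFactor_lt_one (p : ℕ) [hp : Fact p.Prime] {q : ℚ} (h : 0 < q) :
    radialFactor p q 1 < 1 := by
  have := radialFactor_lt p h
  have h0 : radialFactor p ((0 : ℚ) : WithTop ℚ) 1 = 1 := by simp [radialFactor]
  rwa [h0] at this

/-- The weight of `n` in direction `α`. -/
def MultiInterval.dirWeight (p : ℕ) (b : MultiInterval I) (α : I) (n : ℤ) : ℝ≥0 :=
  max (radialFactor p (b.lo α) n) (radialFactor p (b.hi α) n)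

theorem MultiInterval.dirWeight_of_nonneg (p : ℕ) [Fact p.Prime] (b : MultiInterval I) (α : I)
    {n : ℤ} (hn : 0 ≤ n) : b.dirWeight p α n = radialFactor p (b.lo α) 1 ^ n := by
  rw [← radialFactor_coe]
  refine max_eq_left ?_
  have h := b.lo_le_hi α
  cases hb : b.hi α with
  | top =>
    rcases hn.eq_or_lt with rfl | hn
    · simp [radialFactor_zero]
    · simp [radialFactor, hn.ne']
  | coe r =>
    rw [hb] at h
    have h' : b.lo α ≤ r := by exact_mod_cast h
    rw [radialFactor_coe, radialFactor_coe p (b.lo α)]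
    lift n to ℕ using hn
    rw [zpow_natCast, zpow_natCast]
    exact pow_le_pow_left' (radialFactor_le_of_le p h') n

theorem MultiInterval.dirWeight_of_nonpos (p : ℕ) [Fact p.Prime] (b : MultiInterval I) (α : I)
    {n : ℤ} (hn : n ≤ 0) (hb : b.hi α = ⊤ → 0 ≤ n) :
    b.dirWeight p α n = radialFactor p (b.hi α) n := by
  refine max_eq_right ?_
  have h := b.lo_le_hi α
  cases hb' : b.hi α with
  | top =>
    have : n = 0 := le_antisymm hn (hb hb')
    simp [this, radialFactor_zero]
  | coe r =>
    rw [hb'] at h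
    have h' : b.lo α ≤ r := by exact_mod_cast h
    rw [radialFactor_coe, radialFactor_coe p r]
    obtain ⟨m, rfl⟩ : ∃ m : ℕ, n = -m := ⟨n.natAbs, by omega⟩
    rw [zpow_neg, zpow_neg, zpow_natCast, zpow_natCast]
    refine inv_anti₀ (pow_pos (radialFactor_pos p r 1) m) ?_
    exact pow_le_pow_left' (radialFactor_le_of_le p h') m

theorem MultiInterval.dirWeight_zero (p : ℕ) [Fact p.Prime] (b : MultiInterval I) (α : I) :
    b.dirWeight p α 0 = 1 := by
  simp [MultiInterval.dirWeight, radialFactor_zero]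

theorem MultiInterval.dirWeight_add_le (p : ℕ) [Fact p.Prime] (b : MultiInterval I) (α : I)
    {m n : ℤ} (hm : b.hi α = ⊤ → 0 ≤ m) (hn : b.hi α = ⊤ → 0 ≤ n) :
    b.dirWeight p α (m + n) ≤ b.dirWeight p α m * b.dirWeight p α n := by
  unfold MultiInterval.dirWeight
  rw [radialFactor_add p _ m n (by simp) (by simp), radialFactor_add p _ m n hm hn]
  refine max_le ?_ ?_
  · gcongr <;> exact le_max_left _ _
  · gcongr <;> exact le_max_right _ _

variable [Fintype I]

/-- The norm of the monomial `T^n` on a multi-interval. -/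
def MultiInterval.weight (p : ℕ) (b : MultiInterval I) (n : I → ℤ) : ℝ≥0 :=
  ∏ α, b.dirWeight p α (n α)

theorem MultiInterval.weight_zero (p : ℕ) [Fact p.Prime] (b : MultiInterval I) :
    b.weight p 0 = 1 := by
  simp [MultiInterval.weight, MultiInterval.dirWeight_zero]

theorem MultiInterval.weight_add_le (p : ℕ) [Fact p.Prime] (b : MultiInterval I)
    (m n : exponents b.hi) : b.weight p (m + n).1 ≤ b.weight p m.1 * b.weight p n.1 := by
  unfold MultiInterval.weight
  rw [← Finset.prod_mul_distrib]
  exact Finset.prod_le_prod' fun α _ => b.dirWeight_add_le p α (m.2 α) (n.2 α)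

theorem cornerWeight_le_weight (p : ℕ) [Fact p.Prime] (b : MultiInterval I) (c : I → Bool)
    (n : exponents b.hi) : cornerWeight p b c (Multiplicative.ofAdd n) ≤ b.weight p n.1 := by
  refine Finset.prod_le_prod' fun α _ => ?_
  unfold MultiInterval.corner
  split_ifs
  · exact le_max_right _ _
  · exact le_max_left _ _

/-- The coordinates of a corner are chosen independently, so the maximum over corners is the product
of the maxima in each direction. This replaces all corners by a single weight. -/
theorem exists_weight_eq_cornerWeight (p : ℕ) [Fact p.Prime] (b : MultiInterval I)
    (n : exponents b.hi) :
    ∃ c, b.weight p n.1 = cornerWeight p b c (Multiplicative.ofAdd n) := by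
  have : ∀ α, ∃ c : Bool, b.dirWeight p α (n.1 α) =
      radialFactor p (if c then b.hi α else (b.lo α : WithTop ℚ)) (n.1 α) := by
    intro α
    rcases max_choice (radialFactor p (b.lo α) (n.1 α)) (radialFactor p (b.hi α) (n.1 α)) with h | h
    · exact ⟨false, h⟩
    · exact ⟨true, h⟩
  choose c hc using this
  exact ⟨c, Finset.prod_congr rfl fun α _ => hc α⟩

end Weights

/-! ### Norms and monomials in the completed rings -/

section Basic

variable {I : Type*} [Fintype I] [DecidableEq I] {p : ℕ} [hp : Fact p.Prime] {A : Type*}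
  [NormedCommRing A] [IsUltrametricDist A] {b : MultiInterval I}

/-- The coefficients of a Laurent polynomial. -/
def LaurentPolynomials.coeff (f : LaurentPolynomials p A b) : exponents b.hi →₀ A :=
  AddMonoidAlgebra.coeff f

theorem LaurentPolynomials.norm_le_iff (f : LaurentPolynomials p A b) {c : ℝ} (hc : 0 ≤ c) :
    ‖f‖ ≤ c ↔ ∀ n, ‖LaurentPolynomials.coeff f n‖ * b.weight p n.1 ≤ c := by
  lift c to ℝ≥0 using hc
  have h1 : ‖f‖ ≤ c ↔ maxGaussNNNorm (cornerWeight p b) f ≤ c := NNReal.coe_le_coe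
  rw [h1]
  refine (maxGaussNNNorm_le_iff _ _ _).trans ?_
  have h2 : ∀ n, ‖LaurentPolynomials.coeff f n‖ * b.weight p n.1 ≤ (c : ℝ) ↔
      ‖LaurentPolynomials.coeff f n‖₊ * b.weight p n.1 ≤ c := fun n => by
    rw [← NNReal.coe_le_coe]
    push_cast
    rfl
  rw [forall_congr' h2]
  constructor
  · intro h n
    obtain ⟨c', hc'⟩ := exists_weight_eq_cornerWeight p b n
    rw [hc']
    exact h c' n
  · intro h c' n
    exact (mul_le_mul_right (cornerWeight_le_weight p b c' n) _).trans (h n)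

theorem LaurentPolynomials.le_norm (f : LaurentPolynomials p A b) (n : exponents b.hi) :
    ‖LaurentPolynomials.coeff f n‖ * b.weight p n.1 ≤ ‖f‖ :=
  (LaurentPolynomials.norm_le_iff f (norm_nonneg _)).1 le_rfl n

/-- The monomial `a T^n` as a Laurent polynomial. -/
def polyMono (p : ℕ) (b : MultiInterval I) (n : exponents b.hi) (a : A) : LaurentPolynomials p A b :=
  AddMonoidAlgebra.single n a

theorem LaurentPolynomials.eq_sum (f : LaurentPolynomials p A b) :
    f = ∑ n ∈ (LaurentPolynomials.coeff f).support, polyMono p b n (LaurentPolynomials.coeff f n) :=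
  (AddMonoidAlgebra.sum_coeff_single f).symm

theorem norm_polyMono (n : exponents b.hi) (a : A) :
    ‖polyMono p b n a‖ = ‖a‖ * b.weight p n.1 := by
  classical
  refine le_antisymm ((LaurentPolynomials.norm_le_iff _ (by positivity)).2 fun m => ?_) ?_
  · change ‖(AddMonoidAlgebra.single n a).coeff m‖ * _ ≤ _
    rw [AddMonoidAlgebra.coeff_single, Finsupp.single_apply]
    split_ifs with h
    · rw [h]
    · rw [norm_zero, zero_mul]
      positivity
  · have := LaurentPolynomials.le_norm (polyMono p b n a) n
    change ‖(AddMonoidAlgebra.single n a).coeff n‖ * _ ≤ _ at this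
    rwa [AddMonoidAlgebra.coeff_single, Finsupp.single_eq_same] at this

theorem LaurentPolynomials.induction {P : LaurentPolynomials p A b → Prop}
    (f : LaurentPolynomials p A b) (zero : P 0) (add : ∀ f g, P f → P g → P (f + g))
    (mono : ∀ n a, P (polyMono p b n a)) : P f :=
  AddMonoidAlgebra.induction_linear f zero add mono

instance : IsUltrametricDist (LaurentPolynomials p A b) := by
  refine IsUltrametricDist.isUltrametricDist_of_forall_norm_add_le_max_norm fun f g => ?_
  refine (LaurentPolynomials.norm_le_iff _ (by positivity)).2 fun n => ?_
  change ‖(LaurentPolynomials.coeff f + LaurentPolynomials.coeff g) n‖ * _ ≤ _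
  rw [Finsupp.add_apply]
  calc _ ≤ max ‖LaurentPolynomials.coeff f n‖ ‖LaurentPolynomials.coeff g n‖ * (b.weight p n.1 : ℝ) := by
        gcongr
        exact IsUltrametricDist.norm_add_le_max _ _
    _ = _ := max_mul_of_nonneg _ _ (by positivity)
    _ ≤ _ := max_le_max (f.le_norm n) (g.le_norm n)

instance : IsUltrametricDist (IntervalRing p A b) := by
  refine IsUltrametricDist.isUltrametricDist_of_forall_norm_add_le_max_norm fun f g => ?_
  induction f, g using UniformSpace.Completion.induction_on₂ with
  | hp => exact isClosed_le (by fun_prop) (by fun_prop)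
  | ih f g =>
    rw [← UniformSpace.Completion.coe_add, UniformSpace.Completion.norm_coe,
      UniformSpace.Completion.norm_coe, UniformSpace.Completion.norm_coe]
    exact IsUltrametricDist.norm_add_le_max _ _

/-- The monomial `a T^n` as an analytic function. -/
def mono (p : ℕ) [Fact p.Prime] (b : MultiInterval I) (n : exponents b.hi) (a : A) :
    IntervalRing p A b :=
  (polyMono p b n a : LaurentPolynomials p A b)

theorem norm_mono (n : exponents b.hi) (a : A) : ‖mono p b n a‖ = ‖a‖ * b.weight p n.1 := by
  rw [mono, UniformSpace.Completion.norm_coe, norm_polyMono]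

theorem coe_eq_sum_mono (f : LaurentPolynomials p A b) :
    (f : IntervalRing p A b) =
      ∑ n ∈ (LaurentPolynomials.coeff f).support, mono p b n (LaurentPolynomials.coeff f n) := by
  conv_lhs => rw [f.eq_sum]
  exact map_sum (UniformSpace.Completion.coeRingHom (α := LaurentPolynomials p A b)) _ _

theorem mono_add (n : exponents b.hi) (a a' : A) :
    mono p b n (a + a') = mono p b n a + mono p b n a' := by
  rw [mono, mono, mono, ← UniformSpace.Completion.coe_add]
  congr 1
  exact AddMonoidAlgebra.single_add _ _ _

theorem mono_mul (m n : exponents b.hi) (a a' : A) :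
    mono p b m a * mono p b n a' = mono p b (m + n) (a * a') := by
  rw [mono, mono, mono, ← UniformSpace.Completion.coe_mul]
  congr 1
  exact AddMonoidAlgebra.single_mul_single _ _ _ _

theorem mono_zero_one : mono p b 0 (1 : A) = 1 := by
  rw [mono, ← UniformSpace.Completion.coe_one]
  rfl

theorem mono_pow (n : exponents b.hi) (k : ℕ) :
    mono p b n (1 : A) ^ k = mono p b (k • n) (1 : A) := by
  induction k with
  | zero => rw [pow_zero, zero_smul, mono_zero_one]
  | succ k ih => rw [pow_succ, ih, mono_mul, succ_nsmul, mul_one]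

/-- Finite sums of monomials are dense, so closed additive statements are checked on monomials. -/
theorem IntervalRing.induction {P : IntervalRing p A b → Prop} (x : IntervalRing p A b)
    (closed : IsClosed {x | P x}) (add : ∀ x y, P x → P y → P (x + y))
    (mono : ∀ n a, P (mono p b n a)) : P x := by
  induction x using UniformSpace.Completion.induction_on with
  | hp => exact closed
  | ih f =>
    induction f using LaurentPolynomials.induction with
    | zero =>
      have h := mono 0 0
      have : polyMono p b 0 (0 : A) = 0 := AddMonoidAlgebra.single_zero 0
      rwa [MultiRobba.mono, this] at h
    | add f g hf hg =>
      rw [UniformSpace.Completion.coe_add]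
      exact add _ _ hf hg
    | mono n a => exact mono n a

theorem restrict_coe {a b : MultiInterval I} (h : a ≤ b) (f : LaurentPolynomials p A b) :
    restrict p A h (f : IntervalRing p A b) = (polyRestrict p A h f : IntervalRing p A a) :=
  UniformSpace.Completion.map_coe (uniformContinuous_addMonoidHom_of_continuous
    (continuous_polyRestrict p A h)) f

theorem continuous_restrict {a b : MultiInterval I} (h : a ≤ b) : Continuous (restrict p A h) :=
  UniformSpace.Completion.continuous_map

theorem polyRestrict_polyMono {a b : MultiInterval I} (h : a ≤ b) (n : exponents b.hi) (x : A) :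
    polyRestrict p A h (polyMono p b n x) =
      polyMono p a (AddSubmonoid.inclusion (exponents_mono h) n) x := by
  have : AddMonoidAlgebra.mapDomainRingHom A (AddSubmonoid.inclusion (exponents_mono h))
      (AddMonoidAlgebra.single n x) =
        AddMonoidAlgebra.single (AddSubmonoid.inclusion (exponents_mono h) n) x := by simp
  exact this

theorem restrict_mono {a b : MultiInterval I} (h : a ≤ b) (n : exponents b.hi) (x : A) :
    restrict p A h (mono p b n x) = mono p a (AddSubmonoid.inclusion (exponents_mono h) n) x := by
  rw [mono, restrict_coe, polyRestrict_polyMono, mono]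

theorem norm_restrict_le {a b : MultiInterval I} (h : a ≤ b) (x : IntervalRing p A b) :
    ‖restrict p A h x‖ ≤ ‖x‖ := by
  induction x using UniformSpace.Completion.induction_on with
  | hp => exact isClosed_le (continuous_restrict h).norm continuous_norm
  | ih f =>
    rw [restrict_coe, UniformSpace.Completion.norm_coe, UniformSpace.Completion.norm_coe]
    exact NNReal.coe_le_coe.2 (maxGaussNNNorm_mapDomain_le (cornerWeight p b) (cornerWeight p a)
      (AddSubmonoid.inclusion (exponents_mono h)) (cornerWeight_le p h) f)

theorem restrict_restrict {a b c : MultiInterval I} (h : a ≤ b) (h' : b ≤ c)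
    (x : IntervalRing p A c) :
    restrict p A h (restrict p A h' x) = restrict p A (h.trans h') x := by
  induction x using IntervalRing.induction with
  | closed =>
    exact isClosed_eq ((continuous_restrict h).comp (continuous_restrict h')) (continuous_restrict _)
  | add x y hx hy => simp only [map_add, hx, hy]
  | mono n x => simp only [restrict_mono]; rfl

theorem restrict_self (x : IntervalRing p A b) : restrict p A (le_refl b) x = x := by
  induction x using IntervalRing.induction with
  | closed => exact isClosed_eq (continuous_restrict _) continuous_id
  | add x y hx hy => simp only [map_add, hx, hy]
  | mono n x => simp only [restrict_mono]; rfl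

/-- Multiplication by `T^n` is bounded by the weight of `n`. -/
theorem norm_mono_one_mul_le (n : exponents b.hi) (x : IntervalRing p A b) :
    ‖mono p b n 1 * x‖ ≤ b.weight p n.1 * ‖x‖ := by
  induction x using UniformSpace.Completion.induction_on with
  | hp => exact isClosed_le (by fun_prop) (by fun_prop)
  | ih f =>
    rw [UniformSpace.Completion.norm_coe, coe_eq_sum_mono, Finset.mul_sum]
    refine IsUltrametricDist.norm_sum_le_of_forall_le_of_nonneg (by positivity) fun m _ => ?_
    rw [mono_mul, one_mul, norm_mono]
    calc _ ≤ ‖LaurentPolynomials.coeff f m‖ * (b.weight p n.1 * b.weight p m.1 : ℝ≥0) := by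
          gcongr
          exact b.weight_add_le p n m
      _ = b.weight p n.1 * (‖LaurentPolynomials.coeff f m‖ * b.weight p m.1) := by
          push_cast; ring
      _ ≤ _ := by gcongr; exact f.le_norm m

theorem norm_le_of_hasSum {E ι : Type*} [SeminormedAddCommGroup E] [IsUltrametricDist E]
    {f : ι → E} {y : E} (h : HasSum f y) {C : ℝ} (hC : 0 ≤ C) (hf : ∀ i, ‖f i‖ ≤ C) : ‖y‖ ≤ C :=
  le_of_tendsto h.norm (Eventually.of_forall fun _ =>
    IsUltrametricDist.norm_sum_le_of_forall_le_of_nonneg hC fun i _ => hf i)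

theorem exists_poly_near (x : IntervalRing p A b) {ε : ℝ} (hε : 0 < ε) :
    ∃ f : LaurentPolynomials p A b, ‖x - f‖ < ε := by
  obtain ⟨f, hf⟩ := (UniformSpace.Completion.denseRange_coe
    (α := LaurentPolynomials p A b)).exists_dist_lt x hε
  exact ⟨f, by rwa [dist_eq_norm] at hf⟩

/-- Every analytic function is an unconditional sum of monomials. -/
theorem exists_hasSum_mono {I : Type u} [Fintype I] [DecidableEq I] {b : MultiInterval I} (x : IntervalRing p A b) :
    ∃ (X : Type u) (n : X → exponents b.hi) (a : X → A),
      Tendsto (fun i => ‖a i‖ * b.weight p (n i).1) cofinite (𝓝 0) ∧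
      HasSum (fun i => mono p b (n i) (a i)) x := by
  let j : LaurentPolynomials p A b →+ IntervalRing p A b :=
    (UniformSpace.Completion.coeRingHom (α := LaurentPolynomials p A b)).toAddMonoidHom
  have hx : x ∈ closure (j.range : Set (IntervalRing p A b)) :=
    UniformSpace.Completion.denseRange_coe (α := LaurentPolynomials p A b) x
  -- The function becomes a series of polynomials with norms tending to zero; any null sequence
  -- would do as control. Indexing by pairs of a polynomial and an exponent makes the family of
  -- monomials tend to zero, hence summable by the ultrametric property. Exponents may repeat, since
  -- uniqueness of coefficients is not needed.
  obtain ⟨f, hf, -, hf'⟩ := controlled_sum_of_mem_closure_range hx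
    (f := fun n => 1 / ((n : ℝ) + 1)) (fun n => by positivity)
  let X := Σ k : ℕ, ((LaurentPolynomials.coeff (f k)).support : Set (exponents b.hi))
  let t : X → IntervalRing p A b := fun i => mono p b i.2.1 (LaurentPolynomials.coeff (f i.1) i.2.1)
  have hb : Tendsto (fun i : X => ‖LaurentPolynomials.coeff (f i.1) i.2.1‖ *
      (b.weight p i.2.1.1 : ℝ)) cofinite (𝓝 0) := by
    rw [Metric.tendsto_nhds]
    intro ε hε
    obtain ⟨N, hN⟩ := exists_nat_one_div_lt hε
    have hfin : (Set.range fun i : Σ k : Fin (N + 1),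
        ((LaurentPolynomials.coeff (f k)).support : Set (exponents b.hi)) =>
          (⟨i.1.1, i.2⟩ : X)).Finite := Set.finite_range _
    refine hfin.subset fun i hi => ?_
    by_contra hi'
    refine hi ?_
    change dist (‖LaurentPolynomials.coeff (f i.1) i.2.1‖ * (b.weight p i.2.1.1 : ℝ)) 0 < ε
    have hk : N < i.1 := by
      by_contra hk
      exact hi' ⟨⟨⟨i.1, by omega⟩, i.2⟩, rfl⟩
    rw [Real.dist_eq, sub_zero, abs_of_nonneg (by positivity)]
    refine (LaurentPolynomials.le_norm (f i.1) i.2.1).trans_lt ?_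
    have h1 := hf' i.1 (by omega)
    have h2 : ‖j (f i.1)‖ = ‖f i.1‖ := UniformSpace.Completion.norm_coe _
    rw [h2] at h1
    refine h1.trans ((one_div_le_one_div_of_le (by positivity) ?_).trans_lt hN)
    have : (N : ℝ) ≤ i.1 := by exact_mod_cast hk.le
    linarith
  have ht : Summable t := by
    refine NonarchimedeanAddGroup.summable_of_tendsto_cofinite_zero
      (squeeze_zero_norm (fun i => ?_) hb)
    exact (norm_mono _ _).le
  refine ⟨X, fun i => i.2.1, fun i => LaurentPolynomials.coeff (f i.1) i.2.1, hb, ?_⟩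
  have h1 := ht.hasSum.sigma (g := fun k => j (f k)) fun k => by
    have : j (f k) = ∑ n ∈ (LaurentPolynomials.coeff (f k)).support,
        mono p b n (LaurentPolynomials.coeff (f k) n) := coe_eq_sum_mono (f k)
    rw [this]
    exact Finset.hasSum _ _
  have h2 := h1.tendsto_sum_nat
  have h3 := tendsto_nhds_unique ((tendsto_add_atTop_iff_nat 1).2 h2) hf
  rw [← h3]
  exact ht.hasSum

end Basic

/-! ### Multiplication by `p` -/

section Scalars

variable {I : Type*} [Fintype I] [DecidableEq I] {p : ℕ} [hp : Fact p.Prime] {A : Type*}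
  [NormedCommRing A] [IsUltrametricDist A] [NormedAlgebra ℚ_[p] A] {b : MultiInterval I}

omit [IsUltrametricDist A] in
theorem norm_p_mul (a : A) : ‖(p : A) * a‖ = (p : ℝ)⁻¹ * ‖a‖ := by
  have : (p : A) * a = (p : ℚ_[p]) • a := by
    rw [Algebra.smul_def, map_natCast]
  rw [this, norm_smul, Padic.norm_p]

omit [IsUltrametricDist A] in
theorem isUnit_p : IsUnit (p : A) := by
  have h : IsUnit (p : ℚ_[p]) := by
    rw [isUnit_iff_ne_zero]
    exact_mod_cast hp.out.ne_zero
  simpa using h.map (algebraMap ℚ_[p] A)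

/-- The inclusion of the coefficients. -/
def constHom (b : MultiInterval I) : A →+* IntervalRing p A b :=
  (UniformSpace.Completion.coeRingHom (α := LaurentPolynomials p A b)).comp
    (AddMonoidAlgebra.singleZeroRingHom (R := A) (M := exponents b.hi))

omit [NormedAlgebra ℚ_[p] A] in
theorem constHom_apply (a : A) : constHom b a = mono p b 0 a := rfl

theorem IntervalRing.isUnit_p : IsUnit (p : IntervalRing p A b) := by
  simpa using (MultiRobba.isUnit_p (p := p) (A := A)).map (constHom (p := p) b)

/-- The norm of `A` is only submultiplicative, but `p` is a scalar from `ℚ_[p]` and so scales every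
coefficient exactly. -/
theorem IntervalRing.norm_p_mul (x : IntervalRing p A b) :
    ‖(p : IntervalRing p A b) * x‖ = (p : ℝ)⁻¹ * ‖x‖ := by
  induction x using UniformSpace.Completion.induction_on with
  | hp => exact isClosed_eq (by fun_prop) (by fun_prop)
  | ih f =>
    have hle : ∀ f : LaurentPolynomials p A b,
        ‖(p : IntervalRing p A b) * f‖ ≤ (p : ℝ)⁻¹ * ‖f‖ := by
      intro f
      have h1 : (p : IntervalRing p A b) = mono p b 0 (p : A) := by
        rw [← constHom_apply, map_natCast]
      rw [coe_eq_sum_mono, Finset.mul_sum, h1]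
      refine IsUltrametricDist.norm_sum_le_of_forall_le_of_nonneg (by positivity) fun m _ => ?_
      rw [mono_mul, zero_add, norm_mono, MultiRobba.norm_p_mul, mul_assoc]
      gcongr
      exact f.le_norm m
    refine le_antisymm ?_ ?_
    · rw [UniformSpace.Completion.norm_coe]
      exact hle f
    · rw [UniformSpace.Completion.norm_coe]
      have hp0 : (0 : ℝ) < p := by exact_mod_cast hp.out.pos
      refine (mul_le_mul_of_nonneg_left ((LaurentPolynomials.norm_le_iff f (c := p *
        ‖(p : IntervalRing p A b) * f‖) (by positivity)).2 fun n => ?_)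
        (by positivity)).trans_eq (by field_simp)
      have h2 : (p : IntervalRing p A b) * f = ((p * f : LaurentPolynomials p A b) :
          IntervalRing p A b) := by
        rw [UniformSpace.Completion.coe_mul]
        congr 1
        exact (map_natCast (UniformSpace.Completion.coeRingHom
          (α := LaurentPolynomials p A b)) p).symm
      rw [h2, UniformSpace.Completion.norm_coe]
      have h3 := LaurentPolynomials.le_norm ((p : LaurentPolynomials p A b) * f) n
      have h4 : LaurentPolynomials.coeff ((p : LaurentPolynomials p A b) * f) n =
          (p : A) * LaurentPolynomials.coeff f n := by
        have : (p : LaurentPolynomials p A b) * f = p • f := by rw [nsmul_eq_mul]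
        rw [this]
        change (p • LaurentPolynomials.coeff f) n = _
        rw [Finsupp.smul_apply, nsmul_eq_mul]
      rw [h4, MultiRobba.norm_p_mul] at h3
      calc _ = p * ((p : ℝ)⁻¹ * ‖LaurentPolynomials.coeff f n‖ * b.weight p n.1) := by field_simp
        _ ≤ _ := by gcongr

end Scalars

/-! ### Splitting a multi-interval in one direction -/

section Parts

variable {I : Type*}

/-- `a` is the part `t_α ≤ τ` of `K`. -/
structure IsOuterPart (α : I) (τ : ℚ) (a K : MultiInterval I) : Prop where
  lo : a.lo = K.lo
  hi_self : a.hi α = τ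
  hi_ne : ∀ β ≠ α, a.hi β = K.hi β
  le : (τ : WithTop ℚ) ≤ K.hi α

/-- `a` is the part `τ ≤ t_α` of `K`. -/
structure IsInnerPart (α : I) (τ : ℚ) (a K : MultiInterval I) : Prop where
  hi : a.hi = K.hi
  lo_self : a.lo α = τ
  lo_ne : ∀ β ≠ α, a.lo β = K.lo β
  le : K.lo α ≤ τ

theorem IsOuterPart.subset {α : I} {τ : ℚ} {a K : MultiInterval I} (h : IsOuterPart α τ a K) :
    a ≤ K := by
  refine ⟨fun β => by rw [h.lo], fun β => ?_⟩
  by_cases hβ : β = α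
  · subst hβ
    rw [h.hi_self]
    exact h.le
  · rw [h.hi_ne β hβ]

theorem IsInnerPart.subset {α : I} {τ : ℚ} {a K : MultiInterval I} (h : IsInnerPart α τ a K) :
    a ≤ K := by
  refine ⟨fun β => ?_, fun β => by rw [h.hi]⟩
  by_cases hβ : β = α
  · subst hβ
    rw [h.lo_self]
    exact h.le
  · rw [h.lo_ne β hβ]

theorem exists_isOuterPart [DecidableEq I] (K : MultiInterval I) (α : I) (τ : ℚ)
    (h : K.lo α ≤ τ) (h' : (τ : WithTop ℚ) ≤ K.hi α) : ∃ a, IsOuterPart α τ a K := by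
  refine ⟨⟨K.lo, Function.update K.hi α τ, K.lo_pos, fun β => ?_⟩, rfl, by simp, fun β hβ => ?_, h'⟩
  · by_cases hβ : β = α
    · subst hβ
      simpa using h
    · simpa [hβ] using K.lo_le_hi β
  · simp [hβ]

theorem exists_isInnerPart [DecidableEq I] (K : MultiInterval I) (α : I) (τ : ℚ)
    (h : K.lo α ≤ τ) (h' : (τ : WithTop ℚ) ≤ K.hi α) : ∃ a, IsInnerPart α τ a K := by
  refine ⟨⟨Function.update K.lo α τ, K.hi, fun β => ?_, fun β => ?_⟩, rfl, by simp,
    fun β hβ => ?_, h⟩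
  · by_cases hβ : β = α
    · subst hβ
      simpa using (K.lo_pos β).trans_le h
    · simpa [hβ] using K.lo_pos β
  · by_cases hβ : β = α
    · subst hβ
      simpa using h'
    · simpa [hβ] using K.lo_le_hi β
  · simp [hβ]

theorem IsOuterPart.dirWeight_ne (p : ℕ) {α : I} {τ : ℚ} {a K : MultiInterval I}
    (h : IsOuterPart α τ a K) {β : I} (hβ : β ≠ α) (n : ℤ) :
    a.dirWeight p β n = K.dirWeight p β n := by
  rw [MultiInterval.dirWeight, MultiInterval.dirWeight, h.lo, h.hi_ne β hβ]

theorem IsInnerPart.dirWeight_ne (p : ℕ) {α : I} {τ : ℚ} {a K : MultiInterval I}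
    (h : IsInnerPart α τ a K) {β : I} (hβ : β ≠ α) (n : ℤ) :
    a.dirWeight p β n = K.dirWeight p β n := by
  rw [MultiInterval.dirWeight, MultiInterval.dirWeight, h.hi, h.lo_ne β hβ]

/-- Weights are products over the directions, so cutting in direction `α` requires a genuine
comparison there only. -/
theorem weight_mul_le [Fintype I] (p : ℕ) (α : I) {a K : MultiInterval I} {m n : I → ℤ} {c : ℝ≥0}
    (hne : ∀ β ≠ α, K.dirWeight p β (m β) ≤ a.dirWeight p β (n β))
    (h : K.dirWeight p α (m α) * c ≤ a.dirWeight p α (n α)) :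
    K.weight p m * c ≤ a.weight p n := by
  classical
  unfold MultiInterval.weight
  rw [← Finset.mul_prod_erase _ _ (Finset.mem_univ α), ← Finset.mul_prod_erase _ (fun β =>
    a.dirWeight p β (n β)) (Finset.mem_univ α), mul_right_comm]
  gcongr with β hβ
  exact hne β (Finset.ne_of_mem_erase hβ)

variable [DecidableEq I]

/-- The exponent of `T_α^k`. -/
def expSingle (b : MultiInterval I) (α : I) (k : ℤ) (hk : b.hi α = ⊤ → 0 ≤ k) :
    exponents b.hi :=
  ⟨Pi.single α k, fun β hβ => by
    by_cases h : β = α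
    · subst h
      simpa using hk hβ
    · simp [h]⟩

theorem weight_expSingle [Fintype I] (p : ℕ) [Fact p.Prime] (b : MultiInterval I) (α : I) (k : ℤ)
    (hk : b.hi α = ⊤ → 0 ≤ k) : b.weight p (expSingle b α k hk).1 = b.dirWeight p α k := by
  unfold MultiInterval.weight expSingle
  rw [Fintype.prod_eq_single α]
  · simp
  · intro β hβ
    simp [hβ, MultiInterval.dirWeight_zero]

end Parts

/-! ### Expansions in one coordinate, the maximum principle and the outer part -/

section Analysis

/-- Once the forcing term is below `ε / 2 * (1 - r)`, the excess over `ε / 2` shrinks by the factor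
`r` at each step. This controls the quotients of series on the part where the recurrence contracts.
-/
theorem tendsto_zero_of_recurrence (g u : ℕ → ℝ) (hg : ∀ n, 0 ≤ g n) {r : ℝ} (hr0 : 0 ≤ r)
    (hr1 : r < 1) (hu : Tendsto u atTop (𝓝 0)) (h : ∀ n, g (n + 1) ≤ r * g n + u n) :
    Tendsto g atTop (𝓝 0) := by
  rw [Metric.tendsto_atTop]
  intro ε hε
  have h1r : 0 < 1 - r := by linarith
  obtain ⟨N, hN⟩ := eventually_atTop.1 (hu.eventually_le_const (u := ε / 2 * (1 - r)) (by positivity))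
  have key : ∀ m, g (N + m) ≤ r ^ m * g N + ε / 2 := by
    intro m
    induction m with
    | zero => simp; linarith
    | succ m ih =>
      have h1 := h (N + m)
      have h2 := hN (N + m) (by omega)
      have h3 := mul_le_mul_of_nonneg_left ih hr0
      rw [← add_assoc, pow_succ]
      nlinarith
  have h2 : Tendsto (fun m => r ^ m * g N) atTop (𝓝 0) := by
    simpa using (tendsto_pow_atTop_nhds_zero_of_lt_one hr0 hr1).mul_const (g N)
  obtain ⟨m, hm⟩ := eventually_atTop.1 (h2.eventually_lt_const (u := ε / 2) (by positivity))
  refine ⟨N + m, fun n hn => ?_⟩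
  obtain ⟨k, rfl⟩ : ∃ k, n = N + k := ⟨n - N, by omega⟩
  rw [Real.dist_eq, sub_zero, abs_of_nonneg (hg _)]
  have := hm k (by omega)
  linarith [key k]

variable {I : Type*} [Fintype I] [DecidableEq I] {p : ℕ} [hp : Fact p.Prime] {A : Type*}
  [NormedCommRing A] [IsUltrametricDist A]

theorem norm_mul_mono_pow_le {b : MultiInterval I} (n : exponents b.hi) (x : IntervalRing p A b)
    (j : ℕ) : ‖x * mono p b n 1 ^ j‖ ≤ ‖x‖ * (b.weight p n.1 : ℝ) ^ j := by
  induction j with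
  | zero => simp
  | succ j ih =>
    have h1 : x * mono p b n 1 ^ (j + 1) = mono p b n 1 * (x * mono p b n 1 ^ j) := by ring
    rw [h1]
    refine (norm_mono_one_mul_le n _).trans ?_
    calc _ ≤ b.weight p n.1 * (‖x‖ * (b.weight p n.1 : ℝ) ^ j) := by gcongr
      _ = _ := by ring

/-- Expansion into a series in one monomial. -/
theorem exists_series_expansion {a K : MultiInterval I} (h : a ≤ K) (Y : IntervalRing p A a)
    (σ : ℝ) (hσ : 0 < σ)
    (H : ∀ n : exponents a.hi, ∃ (j : ℕ) (m : exponents K.hi),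
      (∀ x : A, mono p a n x = restrict p A h (mono p K m x) * Y ^ j) ∧
      (K.weight p m.1 : ℝ) * σ ^ j ≤ a.weight p n.1) (y : IntervalRing p A a) :
    ∃ c : ℕ → IntervalRing p A K, Tendsto (fun j => ‖c j‖ * σ ^ j) atTop (𝓝 0) ∧
      Tendsto (fun n => ∑ j ∈ Finset.range n, restrict p A h (c j) * Y ^ j) atTop (𝓝 y) := by
  obtain ⟨X, n, x, hx, hy⟩ := exists_hasSum_mono y
  choose j m hm hw using fun i => H (n i)
  let t : X → IntervalRing p A K := fun i => mono p K (m i) (x i)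
  have ht : ∀ i, ‖t i‖ * σ ^ j i ≤ ‖x i‖ * a.weight p (n i).1 := by
    intro i
    rw [norm_mono, mul_assoc]
    gcongr
    exact hw i
  have htt : Tendsto (fun i => ‖t i‖ * σ ^ j i) cofinite (𝓝 0) :=
    squeeze_zero (fun i => by positivity) ht hx
  -- The monomials with the same power of `Y` are collected into one coefficient; the weight
  -- estimate in `H` makes each group summable over `K`.
  have hsum : ∀ k, Summable fun i : j ⁻¹' {k} => t i := by
    intro k
    refine NonarchimedeanAddGroup.summable_of_tendsto_cofinite_zero ?_
    have h1 := htt.comp (Subtype.val_injective (p := fun i => i ∈ j ⁻¹' {k})).tendsto_cofinite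
    refine squeeze_zero_norm (a := fun i : j ⁻¹' {k} => (‖t i‖ * σ ^ j i) * (σ ^ k)⁻¹) (fun i => ?_)
      (by simpa using h1.mul_const (σ ^ k)⁻¹)
    have h2 : j i = k := i.2
    rw [h2]
    field_simp
    exact le_rfl
  refine ⟨fun k => ∑' i : j ⁻¹' {k}, t i, ?_, ?_⟩
  · rw [Metric.tendsto_atTop]
    intro ε hε
    have hfin : {i | ¬ ‖t i‖ * σ ^ j i < ε / 2}.Finite :=
      htt.eventually_lt_const (u := ε / 2) (by positivity)
    obtain ⟨N, hN⟩ := (hfin.image j).bddAbove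
    refine ⟨N + 1, fun k hk => ?_⟩
    rw [Real.dist_eq, sub_zero, abs_of_nonneg (by positivity)]
    have h1 : ‖∑' i : j ⁻¹' {k}, t i‖ ≤ ε / 2 / σ ^ k := by
      refine norm_le_of_hasSum (hsum k).hasSum (by positivity) fun i => ?_
      have h2 : j i = k := i.2
      have h3 : ‖t i‖ * σ ^ j i < ε / 2 := by
        by_contra h3
        have := hN ⟨i, h3, rfl⟩
        omega
      rw [h2] at h3
      rw [le_div_iff₀ (by positivity)]
      exact h3.le
    rw [le_div_iff₀ (by positivity)] at h1
    linarith
  · have h1 := hy.tsum_fiberwise j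
    refine h1.tendsto_sum_nat.congr fun N => Finset.sum_congr rfl fun k _ => ?_
    rw [(hsum k).map_tsum (restrict p A h) (continuous_restrict h)]
    have h2 : Summable fun i : j ⁻¹' {k} => restrict p A h (t i) :=
      (hsum k).map (restrict p A h) (continuous_restrict h)
    rw [← h2.tsum_mul_right]
    refine tsum_congr fun i => ?_
    have h3 : j i = k := i.2
    rw [hm, h3]

theorem norm_le_max_of_weight_le {a₁ a₂ K : MultiInterval I} (h₁ : a₁ ≤ K) (h₂ : a₂ ≤ K)
    (H : ∀ n : exponents K.hi, K.weight p n.1 ≤ max (a₁.weight p n.1) (a₂.weight p n.1))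
    (x : IntervalRing p A K) : ‖x‖ ≤ max ‖restrict p A h₁ x‖ ‖restrict p A h₂ x‖ := by
  induction x using UniformSpace.Completion.induction_on with
  | hp =>
    exact isClosed_le continuous_norm ((continuous_restrict h₁).norm.max (continuous_restrict h₂).norm)
  | ih f =>
    rw [restrict_coe, restrict_coe, UniformSpace.Completion.norm_coe,
      UniformSpace.Completion.norm_coe, UniformSpace.Completion.norm_coe]
    refine (f.norm_le_iff (by positivity)).2 fun n => ?_
    have key : ∀ {a : MultiInterval I} (h : a ≤ K),
        ‖f.coeff n‖ * (a.weight p n.1 : ℝ) ≤ ‖polyRestrict p A h f‖ := by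
      intro a h
      have h1 : (polyRestrict p A h f).coeff (AddSubmonoid.inclusion (exponents_mono h) n) =
          f.coeff n := by
        have hinj : Function.Injective (AddSubmonoid.inclusion (exponents_mono h)) :=
          AddSubmonoid.inclusion_injective _
        change (AddMonoidAlgebra.coeff (AddMonoidAlgebra.mapDomain _ _)) _ = _
        exact Finsupp.mapDomain_apply hinj _ n
      have := LaurentPolynomials.le_norm (polyRestrict p A h f)
        (AddSubmonoid.inclusion (exponents_mono h) n)
      rwa [h1] at this
    have hH : (K.weight p n.1 : ℝ) ≤ max (a₁.weight p n.1 : ℝ) (a₂.weight p n.1) := by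
      exact_mod_cast H n
    calc _ ≤ ‖f.coeff n‖ * max (a₁.weight p n.1 : ℝ) (a₂.weight p n.1) := by gcongr
      _ = max (‖f.coeff n‖ * a₁.weight p n.1) (‖f.coeff n‖ * a₂.weight p n.1) :=
        mul_max_of_nonneg _ _ (norm_nonneg _)
      _ ≤ _ := max_le_max (key h₁) (key h₂)

/-- A maximum principle: a monomial with nonnegative exponent in direction `α` is largest at the
smallest radius parameter, which lies in the outer part, and one with nonpositive exponent at the
largest, which lies in the inner part. The two parts need not cover `K`. -/
theorem norm_le_max_outer_inner {a₁ a₂ K : MultiInterval I} {α : I} {τ₁ τ₂ : ℚ}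
    (h₁ : IsOuterPart α τ₁ a₁ K) (h₂ : IsInnerPart α τ₂ a₂ K) (x : IntervalRing p A K) :
    ‖x‖ ≤ max ‖restrict p A h₁.subset x‖ ‖restrict p A h₂.subset x‖ := by
  refine norm_le_max_of_weight_le _ _ (fun n => ?_) x
  rcases le_total 0 (n.1 α) with hn | hn
  · refine le_max_of_le_left ?_
    rw [← mul_one (K.weight p n.1)]
    refine weight_mul_le p α (fun β hβ => (h₁.dirWeight_ne p hβ _).ge) ?_
    rw [mul_one, K.dirWeight_of_nonneg p α hn, a₁.dirWeight_of_nonneg p α hn, h₁.lo]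
  · refine le_max_of_le_right ?_
    rw [← mul_one (K.weight p n.1)]
    refine weight_mul_le p α (fun β hβ => (h₂.dirWeight_ne p hβ _).ge) ?_
    rw [mul_one, K.dirWeight_of_nonpos p α hn (n.2 α),
      a₂.dirWeight_of_nonpos p α hn (by rw [h₂.hi]; exact n.2 α), h₂.hi]

/-- The coordinate `T_α`. -/
def coord (p : ℕ) [Fact p.Prime] (A : Type*) [NormedCommRing A] [IsUltrametricDist A]
    (b : MultiInterval I) (α : I) : IntervalRing p A b :=
  mono p b (expSingle b α 1 fun _ => zero_le_one) 1

theorem restrict_coord {a b : MultiInterval I} (h : a ≤ b) (α : I) :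
    restrict p A h (coord p A b α) = coord p A a α := restrict_mono h _ _

theorem norm_coord_mul_le {b : MultiInterval I} (α : I) (x : IntervalRing p A b) :
    ‖coord p A b α * x‖ ≤ radialFactor p (b.lo α) 1 * ‖x‖ := by
  have := norm_mono_one_mul_le (expSingle b α 1 fun _ => zero_le_one) x
  rwa [weight_expSingle, b.dirWeight_of_nonneg p α zero_le_one, zpow_one] at this

/-- The inverse coordinate `T_α⁻¹` on an annulus. -/
def coordInv (p : ℕ) [Fact p.Prime] (A : Type*) [NormedCommRing A] [IsUltrametricDist A]
    (b : MultiInterval I) (α : I) (h : b.hi α ≠ ⊤) : IntervalRing p A b :=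
  mono p b (expSingle b α (-1) fun h' => absurd h' h) 1

theorem coord_mul_coordInv {b : MultiInterval I} {α : I} (h : b.hi α ≠ ⊤) :
    coord p A b α * coordInv p A b α h = 1 := by
  rw [coord, coordInv, mono_mul, mul_one, ← mono_zero_one]
  congr 1
  ext β
  by_cases hβ : β = α
  · subst hβ
    simp [expSingle]
  · simp [expSingle, hβ]

theorem weight_coordInv {b : MultiInterval I} {α : I} (h : b.hi α ≠ ⊤) {τ : ℚ}
    (hτ : b.hi α = τ) : b.weight p (expSingle b α (-1) fun h' => absurd h' h).1 =
      (radialFactor p τ 1)⁻¹ := by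
  rw [weight_expSingle, b.dirWeight_of_nonpos p α (by norm_num) (fun h' => absurd h' h), hτ,
    radialFactor_coe, zpow_neg_one]

theorem norm_coordInv_mul_le {b : MultiInterval I} {α : I} (h : b.hi α ≠ ⊤) {τ : ℚ}
    (hτ : b.hi α = τ) (x : IntervalRing p A b) :
    ‖coordInv p A b α h * x‖ ≤ (radialFactor p τ 1 : ℝ)⁻¹ * ‖x‖ := by
  have := norm_mono_one_mul_le (expSingle b α (-1) fun h' => absurd h' h) x
  rw [weight_coordInv h hτ] at this
  exact_mod_cast this

theorem exists_lt_le_of_lt {τ : ℚ} {r : WithTop ℚ} (h : (τ : WithTop ℚ) < r) :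
    ∃ τ' : ℚ, τ < τ' ∧ (τ' : WithTop ℚ) ≤ r := by
  cases r with
  | top => exact ⟨τ + 1, by linarith, le_top⟩
  | coe r => exact ⟨r, by exact_mod_cast h, le_rfl⟩

/-- The ring of the outer part is a ring of convergent series in `T_α⁻¹`. -/
theorem IsOuterPart.isSeriesExtension {a K : MultiInterval I} {α : I} {τ : ℚ}
    (h : IsOuterPart α τ a K) (hτ : (τ : WithTop ℚ) < K.hi α) :
    IsSeriesExtension (restrict p A h.subset) (coord p A K α) 1
      (coordInv p A a α (by rw [h.hi_self]; exact WithTop.coe_ne_top))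
      (radialFactor p τ 1 : ℝ)⁻¹ := by
  have hne : a.hi α ≠ ⊤ := by rw [h.hi_self]; exact WithTop.coe_ne_top
  have hx0 : (0 : ℝ) < radialFactor p τ 1 := radialFactor_pos p τ 1
  set ρ : ℝ := ((radialFactor p (τ : WithTop ℚ) 1 : ℝ≥0) : ℝ) with hρ
  set f := restrict p A h.subset with hf
  set T := coord p A K α with hT
  set Y := coordInv p A a α hne with hY
  have hfT : f T = coord p A a α := restrict_coord _ _
  have hTY : f T * Y = 1 := by rw [hfT]; exact coord_mul_coordInv hne
  have hYpow : ∀ (x : IntervalRing p A a) (j : ℕ), ‖x * Y ^ j‖ ≤ ‖x‖ * ρ⁻¹ ^ j := by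
    intro x j
    have := norm_mul_mono_pow_le (expSingle a α (-1) fun h' => absurd h' hne) x j
    rw [weight_coordInv hne h.hi_self] at this
    exact_mod_cast this
  refine ⟨by positivity, by rw [map_one, hTY], ⟨1, fun x j => ?_⟩, ?_, fun z hz hz0 => ?_⟩
  · rw [one_mul]
    refine (hYpow _ j).trans ?_
    gcongr
    exact norm_restrict_le _ x
  -- A negative exponent of `T_α` is moved entirely into the power of `Y`; the rest of the monomial
  -- extends to `K`, and the weights match.
  · refine exists_series_expansion h.subset Y _ (by positivity) fun n => ?_
    refine ⟨(-n.1 α).toNat, ⟨fun β => if β = α then max (n.1 α) 0 else n.1 β, fun β hβ => ?_⟩,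
      fun x => ?_, ?_⟩
    · change 0 ≤ if β = α then max (n.1 α) 0 else n.1 β
      split_ifs with h1
      · exact le_max_right _ _
      · exact n.2 β (by rw [h.hi_ne β h1, hβ])
    · rw [restrict_mono, hY, coordInv, mono_pow, mono_mul, mul_one]
      congr 1
      ext β
      by_cases hβ : β = α
      · subst hβ
        simp [expSingle]
        omega
      · simp [expSingle, hβ]
    · have : K.weight p (fun β => if β = α then max (n.1 α) 0 else n.1 β) *
          (radialFactor p τ 1)⁻¹ ^ (-n.1 α).toNat ≤ a.weight p n.1 := by
        refine weight_mul_le p α (fun β hβ => ?_) ?_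
        · rw [if_neg hβ, h.dirWeight_ne p hβ]
        · rw [if_pos rfl]
          rcases le_total 0 (n.1 α) with hn | hn
          · have h0 : (-n.1 α).toNat = 0 := by omega
            rw [max_eq_left hn, h0, pow_zero, mul_one, K.dirWeight_of_nonneg p α hn,
              a.dirWeight_of_nonneg p α hn, h.lo]
          · obtain ⟨k, hk⟩ : ∃ k : ℕ, n.1 α = -k := ⟨(-n.1 α).toNat, by omega⟩
            have h0 : (-n.1 α).toNat = k := by omega
            rw [max_eq_right hn, h0, K.dirWeight_zero p α, one_mul,
              a.dirWeight_of_nonpos p α hn (fun h' => absurd h' hne), h.hi_self, radialFactor_coe p τ (n.1 α),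
              hk, zpow_neg, zpow_natCast, inv_pow]
      exact_mod_cast this
  -- By the maximum principle, the quotients need to be controlled only on the outer part and on an
  -- inner part. The cut `τ'` lies strictly beyond `τ` so that `T_α` contracts there relative to
  -- `ρ`.
  · obtain ⟨τ', hτ', hτ'2⟩ := exists_lt_le_of_lt hτ
    have hlo : K.lo α ≤ τ := by
      have := a.lo_le_hi α
      rw [h.hi_self, h.lo] at this
      exact_mod_cast this
    obtain ⟨a', h'⟩ := exists_isInnerPart K α τ' (hlo.trans hτ'.le) hτ'2
    let q : ℕ → IntervalRing p A K := fun n => ∑ l ∈ Finset.range (n + 1), T ^ (n - l) * z l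
    have hq0 : q 0 = z 0 := by simp [q]
    have hqs : ∀ n, q (n + 1) = T * q n + z (n + 1) := by
      intro n
      simp only [q]
      rw [Finset.sum_range_succ _ (n + 1), Finset.mul_sum, Nat.sub_self, pow_zero, one_mul]
      congr 1
      refine Finset.sum_congr rfl fun l hl => ?_
      have : n + 1 - l = (n - l) + 1 := by
        have := Finset.mem_range.1 hl
        omega
      rw [this, pow_succ']
      ring
    refine ⟨q, ?_, by rw [hq0, one_mul], fun n => by rw [hqs, one_mul]; ring⟩
    -- On the outer part `q n` is `T_α ^ n` times a partial sum of a series with sum zero, that is,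
    -- minus a tail, and tails inherit the decay of the terms.
    have hlim1 : Tendsto (fun n => ‖f (q n)‖ * ρ⁻¹ ^ n) atTop (𝓝 0) := by
      let S : ℕ → IntervalRing p A a := fun m => ∑ l ∈ Finset.range m, f (z l) * Y ^ l
      have hS : ∀ n, f (q n) = f T ^ n * S (n + 1) := by
        intro n
        simp only [q, S, map_sum, map_mul, map_pow, Finset.mul_sum]
        refine Finset.sum_congr rfl fun l hl => ?_
        have h3 : n = (n - l) + l := by
          have := Finset.mem_range.1 hl
          omega
        conv_rhs => rw [h3, pow_add]
        have : f T ^ l * Y ^ l = 1 := by rw [← mul_pow, hTY, one_pow]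
        linear_combination (- f T ^ (n - l) * f (z l)) * this
      rw [Metric.tendsto_atTop]
      intro ε hε
      obtain ⟨N, hN⟩ := eventually_atTop.1 (hz.eventually_le_const (u := ε / 2) (by positivity))
      refine ⟨N, fun n hn => ?_⟩
      rw [Real.dist_eq, sub_zero, abs_of_nonneg (by positivity)]
      have h4 : ∀ m, n + 1 ≤ m → ‖f T ^ n * (S (n + 1) - S m)‖ ≤ ε / 2 / ρ⁻¹ ^ n := by
        intro m hm
        have h5 : f T ^ n * (S (n + 1) - S m) =
            - ∑ l ∈ Finset.Ico (n + 1) m, f (z l) * Y ^ (l - n) := by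
          rw [Finset.sum_Ico_eq_sub _ hm]
          have : f T ^ n * (S (n + 1) - S m) = - (f T ^ n * (S m - S (n + 1))) := by ring
          rw [this, ← Finset.sum_Ico_eq_sub _ hm, ← Finset.sum_Ico_eq_sub _ hm, Finset.mul_sum]
          congr 1
          refine Finset.sum_congr rfl fun l hl => ?_
          have h3 : l = n + (l - n) := by
            have := (Finset.mem_Ico.1 hl).1
            omega
          conv_lhs => rw [h3, pow_add]
          have : f T ^ n * Y ^ n = 1 := by rw [← mul_pow, hTY, one_pow]
          rw [← h3]
          linear_combination (f (z l) * Y ^ (l - n)) * this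
        rw [h5, norm_neg]
        refine IsUltrametricDist.norm_sum_le_of_forall_le_of_nonneg (by positivity) fun l hl => ?_
        have hl1 := (Finset.mem_Ico.1 hl).1
        refine (hYpow _ _).trans ?_
        rw [le_div_iff₀ (by positivity), mul_assoc, ← pow_add]
        have h6 : l - n + n = l := by omega
        rw [h6]
        refine le_trans ?_ (hN l (by omega))
        gcongr
        exact norm_restrict_le _ _
      have h7 : Tendsto (fun m => ‖f T ^ n * (S (n + 1) - S m)‖) atTop
          (𝓝 ‖f T ^ n * (S (n + 1) - 0)‖) :=
        (Tendsto.const_mul _ (tendsto_const_nhds.sub hz0)).norm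
      have h8 := le_of_tendsto h7 (eventually_atTop.2 ⟨n + 1, h4⟩)
      rw [sub_zero, ← hS, le_div_iff₀ (by positivity)] at h8
      linarith
    have hlim2 : Tendsto (fun n => ‖restrict p A h'.subset (q n)‖ * ρ⁻¹ ^ n) atTop (𝓝 0) := by
      have hx1 : (radialFactor p τ' 1 : ℝ) < ρ := by exact_mod_cast radialFactor_lt p hτ'
      refine tendsto_zero_of_recurrence _ (fun n => ‖z (n + 1)‖ * ρ⁻¹ ^ (n + 1))
        (fun n => by positivity) (r := radialFactor p τ' 1 / ρ) (by positivity)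
        (by rw [div_lt_one hx0]; exact hx1) ((tendsto_add_atTop_iff_nat 1).2 hz) fun n => ?_
      rw [hqs, map_add, map_mul, restrict_coord]
      have h9 := norm_coord_mul_le (p := p) (A := A) α (restrict p A h'.subset (q n))
      rw [h'.lo_self] at h9
      have h10 := norm_restrict_le h'.subset (z (n + 1))
      calc _ ≤ (radialFactor p τ' 1 * ‖restrict p A h'.subset (q n)‖ + ‖z (n + 1)‖) *
            ρ⁻¹ ^ (n + 1) := by
            gcongr
            exact (norm_add_le _ _).trans (add_le_add h9 h10)
        _ = _ := by
            rw [pow_succ]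
            field_simp
    refine squeeze_zero (fun n => by positivity) (fun n => ?_) ((hlim1.max hlim2).trans_eq (by rw [max_self]))
    rw [← max_mul_of_nonneg _ _ (by positivity : (0 : ℝ) ≤ ρ⁻¹ ^ n)]
    gcongr
    exact norm_le_max_outer_inner h h' (q n)

end Analysis

/-! ### Division by a coordinate and the inner part -/

section InnerPart

variable {I : Type*} [Fintype I] [DecidableEq I] {p : ℕ} [hp : Fact p.Prime] {A : Type*}
  [NormedCommRing A] [IsUltrametricDist A]

/-- A partial map on exponents that is bounded with respect to the weights induces a bounded
additive map. -/
theorem exists_exponent_operator {a b : MultiInterval I}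
    (φ : exponents a.hi → Option (exponents b.hi)) (C : ℝ) (hC0 : 0 ≤ C)
    (hC : ∀ n m, φ n = some m → (b.weight p m.1 : ℝ) ≤ C * a.weight p n.1) :
    ∃ Φ : IntervalRing p A a →+ IntervalRing p A b, Continuous Φ ∧
      ∀ n x, Φ (mono p a n x) = (φ n).elim 0 fun m => mono p b m x := by
  let g : exponents a.hi → A →+ IntervalRing p A b := fun n =>
    { toFun := fun x => (φ n).elim 0 fun m => mono p b m x
      map_zero' := by
        cases φ n with
        | none => rfl
        | some m =>
          have := mono_add (p := p) m (0 : A) 0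
          simpa using this
      map_add' := fun x y => by
        cases φ n with
        | none => simp
        | some m => exact mono_add m x y }
  let Φ₀ : LaurentPolynomials p A a →+ IntervalRing p A b :=
    { toFun := fun f => (LaurentPolynomials.coeff f).sum fun n => g n
      map_zero' := Finsupp.sum_zero_index
      map_add' := fun f f' => Finsupp.sum_add_index' (fun n => map_zero (g n))
        (fun n => map_add (g n)) }
  have hΦ₀ : ∀ f, ‖Φ₀ f‖ ≤ C * ‖f‖ := by
    intro f
    refine IsUltrametricDist.norm_sum_le_of_forall_le_of_nonneg (by positivity) fun n _ => ?_
    change ‖(φ n).elim 0 fun m => mono p b m (LaurentPolynomials.coeff f n)‖ ≤ _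
    cases hn : φ n with
    | none => simpa using by positivity
    | some m =>
      change ‖mono p b m _‖ ≤ _
      rw [norm_mono]
      calc _ ≤ ‖LaurentPolynomials.coeff f n‖ * (C * a.weight p n.1) := by
            gcongr
            exact hC n m hn
        _ = C * (‖LaurentPolynomials.coeff f n‖ * a.weight p n.1) := by ring
        _ ≤ _ := by
            gcongr
            exact f.le_norm n
  have hc : Continuous Φ₀ := AddMonoidHomClass.continuous_of_bound Φ₀ C hΦ₀
  refine ⟨Φ₀.extension hc, UniformSpace.Completion.continuous_extension, fun n x => ?_⟩
  rw [mono, AddMonoidHom.extension_coe]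
  change (Finsupp.single n x).sum (fun n => g n) = _
  exact Finsupp.sum_single_index (h := fun n x => g n x) (map_zero (g n))

/-- Subtracting one from the exponent of `T_α`, when this exponent is nonzero. -/
def exponentPred (r : I → WithTop ℚ) (α : I) (n : exponents r) : Option (exponents r) :=
  if h : n.1 α = 0 then none else some ⟨n.1 - Pi.single α 1, fun β hβ => by
    have h0 := n.2 β hβ
    by_cases h1 : β = α
    · subst h1
      rw [Pi.sub_apply, Pi.single_eq_same]
      omega
    · simpa [h1] using h0⟩

/-- On a disc, discarding the monomials free of `T_α` and dividing the others by `T_α` is bounded by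
the inverse of the norm of `T_α`. -/
theorem exists_coord_quotient (b : MultiInterval I) (α : I) (hb : b.hi α = ⊤) :
    ∃ D : IntervalRing p A b →+ IntervalRing p A b, Continuous D ∧
      ∀ n x, D (mono p b n x) = (exponentPred b.hi α n).elim 0 fun m => mono p b m x := by
  have hρ := radialFactor_pos p (b.lo α) 1
  refine exists_exponent_operator _ ((radialFactor p (b.lo α) 1 : ℝ≥0) : ℝ)⁻¹ (by positivity)
    fun n m hm => ?_
  unfold exponentPred at hm
  split_ifs at hm with h
  simp only [Option.some.injEq] at hm
  have h0 := n.2 α hb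
  rw [inv_mul_eq_div, le_div_iff₀ (by exact_mod_cast hρ)]
  have : b.weight p m.1 * radialFactor p (b.lo α) 1 ≤ b.weight p n.1 := by
    refine weight_mul_le p α (fun β hβ => ?_) ?_
    · rw [← hm]
      simp [hβ]
    · have h1 : m.1 α = n.1 α - 1 := by rw [← hm]; simp
      rw [h1, b.dirWeight_of_nonneg p α h0, b.dirWeight_of_nonneg p α (by omega),
        zpow_sub_one₀ hρ.ne', mul_assoc, inv_mul_cancel₀ hρ.ne', mul_one]
  exact_mod_cast this

theorem coord_mul_mono (b : MultiInterval I) (α : I) (n : exponents b.hi) (x : A) :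
    coord p A b α * mono p b n x = mono p b (expSingle b α 1 (fun _ => zero_le_one) + n) x := by
  rw [coord, mono_mul, one_mul]

omit [Fintype I] in
theorem exponentPred_add {b : MultiInterval I} {α : I} (hb : b.hi α = ⊤) (n : exponents b.hi) :
    exponentPred b.hi α (expSingle b α 1 (fun _ => zero_le_one) + n) = some n := by
  have h0 := n.2 α hb
  have h1 : (expSingle b α 1 (fun _ => zero_le_one) + n).1 α = 1 + n.1 α := by simp [expSingle]
  unfold exponentPred
  rw [dif_neg (by omega)]
  congr 1
  ext β
  simp [expSingle]

/-- Divisibility by the coordinate `T_α` can be tested on an inner part. -/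
theorem IsInnerPart.exists_division {a K : MultiInterval I} {α : I} {τ : ℚ}
    (h : IsInnerPart α τ a K) (x : IntervalRing p A K) (w : IntervalRing p A a)
    (hxw : restrict p A h.subset x = coord p A a α * w) :
    ∃ y, coord p A K α * y = x ∧ restrict p A h.subset y = w := by
  by_cases hK : K.hi α = ⊤
  · have ha : a.hi α = ⊤ := by rw [h.hi, hK]
    obtain ⟨D, hD, hD'⟩ := exists_coord_quotient (p := p) (A := A) K α hK
    obtain ⟨D₁, hD₁, hD₁'⟩ := exists_coord_quotient (p := p) (A := A) a α ha
    -- The operator attached to `φ` extracts the part free of `T_α`. Such monomials have equal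
    -- weight on `a` and on `K`, so the `T_α`-free part of `x` can be read off its restriction,
    -- where it vanishes by divisibility.
    let φ : exponents a.hi → Option (exponents K.hi) := fun n =>
      if n.1 α = 0 then some ⟨n.1, fun β hβ => n.2 β (by rw [h.hi, hβ])⟩ else none
    obtain ⟨E, hE, hE'⟩ := exists_exponent_operator (p := p) (A := A) φ 1 zero_le_one (by
      intro n m hm
      simp only [φ] at hm
      split_ifs at hm with h0
      simp only [Option.some.injEq] at hm
      have : K.weight p m.1 * 1 ≤ a.weight p n.1 := by
        rw [← hm]
        refine weight_mul_le p α (fun β hβ => (h.dirWeight_ne p hβ _).ge) ?_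
        rw [mul_one, h0, K.dirWeight_zero p, a.dirWeight_zero p]
      rw [mul_one] at this
      rw [one_mul]
      exact_mod_cast this)
    have h1 : ∀ x, x = coord p A K α * D x + E (restrict p A h.subset x) := by
      intro x
      induction x using IntervalRing.induction with
      | closed =>
        exact isClosed_eq continuous_id ((continuous_const.mul hD).add
          (hE.comp (continuous_restrict h.subset)))
      | add x y hx hy =>
        conv_lhs => rw [hx, hy]
        simp only [map_add]
        ring
      | mono n x =>
        rw [restrict_mono, hD', hE']
        by_cases h0 : n.1 α = 0
        · have e1 : exponentPred K.hi α n = none := by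
            unfold exponentPred
            rw [dif_pos h0]
          have e2 : φ (AddSubmonoid.inclusion (exponents_mono h.subset) n) = some n := by
            simp only [φ]
            rw [if_pos (by simpa using h0)]
            rfl
          rw [e1, e2]
          simp
        · have e2 : φ (AddSubmonoid.inclusion (exponents_mono h.subset) n) = none := by
            simp only [φ]
            rw [if_neg (by simpa using h0)]
          unfold exponentPred
          rw [e2, dif_neg h0]
          simp only [Option.elim]
          rw [coord_mul_mono, add_zero]
          congr 1
          ext β
          simp [expSingle]
    have h2 : ∀ w, E (coord p A a α * w) = 0 := by
      intro w
      induction w using IntervalRing.induction with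
      | closed => exact isClosed_eq (hE.comp (continuous_const.mul continuous_id)) continuous_const
      | add x y hx hy => rw [mul_add, map_add, hx, hy, add_zero]
      | mono n x =>
        have h0 := n.2 α ha
        have h1 : (expSingle a α 1 (fun _ => zero_le_one) + n).1 α = 1 + n.1 α := by
          simp [expSingle]
        rw [coord_mul_mono, hE']
        simp only [φ]
        rw [if_neg (by omega)]
        rfl
    have h3 : ∀ w, D₁ (coord p A a α * w) = w := by
      intro w
      induction w using IntervalRing.induction with
      | closed => exact isClosed_eq (hD₁.comp (continuous_const.mul continuous_id)) continuous_id
      | add x y hx hy => rw [mul_add, map_add, hx, hy]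
      | mono n x => rw [coord_mul_mono, hD₁', exponentPred_add ha]; rfl
    have h4 : coord p A K α * D x = x := by
      conv_rhs => rw [h1 x, hxw, h2, add_zero]
    refine ⟨D x, h4, ?_⟩
    rw [← h3 (restrict p A h.subset (D x)), ← restrict_coord h.subset α, ← map_mul, h4, hxw, h3]
  · have ha : a.hi α ≠ ⊤ := by rwa [h.hi]
    refine ⟨coordInv p A K α hK * x, by rw [← mul_assoc, coord_mul_coordInv, one_mul], ?_⟩
    have h1 : restrict p A h.subset (coordInv p A K α hK) = coordInv p A a α ha :=
      restrict_mono _ _ _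
    rw [map_mul, hxw, h1, ← mul_assoc, mul_comm (coordInv p A a α ha), coord_mul_coordInv, one_mul]

/-- The ring of the inner part is a ring of convergent series in `T_α`. -/
theorem IsInnerPart.isSeriesExtension {a K : MultiInterval I} {α : I} {τ : ℚ}
    (h : IsInnerPart α τ a K) (hτ : K.lo α < τ) :
    IsSeriesExtension (restrict p A h.subset) 1 (coord p A K α) (coord p A a α)
      (radialFactor p τ 1 : ℝ) := by
  have hx0 : (0 : ℝ) < ((radialFactor p (τ : WithTop ℚ) 1 : ℝ≥0) : ℝ) := radialFactor_pos p τ 1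
  set ρ : ℝ := ((radialFactor p (τ : WithTop ℚ) 1 : ℝ≥0) : ℝ) with hρ
  set f := restrict p A h.subset with hf
  set T := coord p A K α with hT
  set Y := coord p A a α with hY
  have hfT : f T = Y := restrict_coord _ _
  have hYpow : ∀ (x : IntervalRing p A a) (j : ℕ), ‖x * Y ^ j‖ ≤ ‖x‖ * ρ ^ j := by
    intro x j
    have := norm_mul_mono_pow_le (expSingle a α 1 fun _ => zero_le_one) x j
    rw [weight_expSingle, a.dirWeight_of_nonneg p α zero_le_one, h.lo_self, zpow_one] at this
    exact this
  have hbd : ∀ (x : IntervalRing p A K) (j : ℕ), ‖f x * Y ^ j‖ ≤ ‖x‖ * ρ ^ j := by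
    intro x j
    refine (hYpow _ j).trans ?_
    gcongr
    exact norm_restrict_le _ x
  refine ⟨hx0, by rw [map_one, one_mul, hfT], ⟨1, fun x j => by rw [one_mul]; exact hbd x j⟩, ?_,
    fun z hz hz0 => ?_⟩
  · refine exists_series_expansion h.subset Y _ (by positivity) fun n => ?_
    refine ⟨(n.1 α).toNat, ⟨fun β => if β = α then min (n.1 α) 0 else n.1 β, fun β hβ => ?_⟩,
      fun x => ?_, ?_⟩
    · have h0 := n.2 β (by rw [h.hi, hβ])
      change 0 ≤ if β = α then min (n.1 α) 0 else n.1 β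
      split_ifs with h1
      · subst h1
        exact le_min h0 le_rfl
      · exact h0
    · rw [restrict_mono, hY, coord, mono_pow, mono_mul, mul_one]
      congr 1
      ext β
      by_cases hβ : β = α
      · subst hβ
        simp [expSingle]
      · simp [expSingle, hβ]
    · have : K.weight p (fun β => if β = α then min (n.1 α) 0 else n.1 β) *
          (radialFactor p τ 1) ^ (n.1 α).toNat ≤ a.weight p n.1 := by
        refine weight_mul_le p α (fun β hβ => ?_) ?_
        · rw [if_neg hβ, h.dirWeight_ne p hβ]
        · rw [if_pos rfl]
          rcases le_total (n.1 α) 0 with hn | hn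
          · have h0 : (n.1 α).toNat = 0 := by omega
            rw [min_eq_left hn, h0, pow_zero, mul_one,
              K.dirWeight_of_nonpos p α hn (by rw [← h.hi]; exact n.2 α),
              a.dirWeight_of_nonpos p α hn (n.2 α)]
            exact le_of_eq (congrArg (fun r => radialFactor p (r α) (n.1 α)) h.hi.symm)
          · obtain ⟨k, hk⟩ : ∃ k : ℕ, n.1 α = k := ⟨(n.1 α).toNat, by omega⟩
            have h0 : (n.1 α).toNat = k := by omega
            rw [min_eq_right hn, h0, K.dirWeight_zero p α, one_mul,
              a.dirWeight_of_nonneg p α hn, h.lo_self, hk, zpow_natCast]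
      exact_mod_cast this
  -- The second test region is the degenerate outer part `t_α = K.lo α`. There `T_α` is invertible,
  -- and its inverse beats the weight `ρ`.
  · have hτ' : (K.lo α : WithTop ℚ) ≤ K.hi α := K.lo_le_hi α
    obtain ⟨a', h'⟩ := exists_isOuterPart K α (K.lo α) le_rfl hτ'
    have hne' : a'.hi α ≠ ⊤ := by rw [h'.hi_self]; exact WithTop.coe_ne_top
    have hsum : ∀ n, Summable fun l => f (z (l + n)) * Y ^ l := by
      intro n
      refine NonarchimedeanAddGroup.summable_of_tendsto_cofinite_zero ?_
      rw [Nat.cofinite_eq_atTop]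
      have h1 := ((tendsto_add_atTop_iff_nat n).2 hz).mul_const (ρ ^ n)⁻¹
      rw [zero_mul] at h1
      refine squeeze_zero_norm (fun l => (hbd _ _).trans_eq ?_) h1
      rw [pow_add]
      field_simp
    -- The tails of the series, stripped of the factor `Y ^ n`. Since the total sum is zero, `f (z
    -- 0)` is `Y` times `-v 1`, which starts the division.
    set v : ℕ → IntervalRing p A a := fun n => ∑' l, f (z (l + n)) * Y ^ l with hv
    have hv0 : v 0 = 0 := tendsto_nhds_unique (hsum 0).hasSum.tendsto_sum_nat hz0
    have hvs : ∀ n, v n = f (z n) + Y * v (n + 1) := by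
      intro n
      simp only [hv]
      rw [(hsum n).tsum_eq_zero_add, ← (hsum (n + 1)).tsum_mul_left]
      simp only [pow_zero, mul_one, zero_add]
      congr 1
      refine tsum_congr fun l => ?_
      rw [show l + 1 + n = l + (n + 1) by ring]
      ring
    have hvlim : Tendsto (fun n => ‖v n‖ * ρ ^ n) atTop (𝓝 0) := by
      rw [Metric.tendsto_atTop]
      intro ε hε
      obtain ⟨N, hN⟩ := eventually_atTop.1 (hz.eventually_le_const (u := ε / 2) (by positivity))
      refine ⟨N, fun n hn => ?_⟩
      rw [Real.dist_eq, sub_zero, abs_of_nonneg (by positivity)]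
      have h1 : ‖v n‖ ≤ ε / 2 / ρ ^ n := by
        refine norm_le_of_hasSum (hsum n).hasSum (by positivity) fun l => (hbd _ _).trans ?_
        rw [le_div_iff₀ (by positivity), mul_assoc, ← pow_add]
        exact hN (l + n) (by omega)
      rw [le_div_iff₀ (by positivity)] at h1
      linarith
    -- The recursion `T q (n + 1) = q n + z (n + 1)` requires divisibility over `K`. It is tested on
    -- `a`, where the right-hand side equals `-Y v (n + 2)`.
    choose! G hG1 hG2 using h.exists_division (p := p) (A := A)
    let q : ℕ → IntervalRing p A K := fun n =>
      Nat.rec (G (z 0) (-v 1)) (fun n qn => G (qn + z (n + 1)) (-v (n + 2))) n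
    have hq0 : q 0 = G (z 0) (-v 1) := rfl
    have hqs : ∀ n, q (n + 1) = G (q n + z (n + 1)) (-v (n + 2)) := fun n => rfl
    have e0 : f (z 0) = Y * -v 1 := by
      have := hvs 0
      rw [hv0] at this
      linear_combination -this
    have hfq : ∀ n, f (q n) = -v (n + 1) := by
      intro n
      induction n with
      | zero => exact hG2 _ _ e0
      | succ n ih =>
        rw [hqs]
        refine hG2 _ _ ?_
        rw [map_add]
        linear_combination ih - hvs (n + 1)
    have hTq : ∀ n, T * q (n + 1) = q n + z (n + 1) := by
      intro n
      rw [hqs]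
      refine hG1 _ _ ?_
      rw [map_add]
      linear_combination hfq n - hvs (n + 1)
    refine ⟨q, ?_, (hG1 _ _ e0).symm, fun n => by rw [hTq]; ring⟩
    have hlim1 : Tendsto (fun n => ‖f (q n)‖ * ρ ^ n) atTop (𝓝 0) := by
      have h1 := ((tendsto_add_atTop_iff_nat 1).2 hvlim).mul_const ρ⁻¹
      rw [zero_mul] at h1
      refine h1.congr fun n => ?_
      rw [hfq, norm_neg, pow_succ]
      field_simp
    have hlim2 : Tendsto (fun n => ‖restrict p A h'.subset (q n)‖ * ρ ^ n) atTop (𝓝 0) := by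
      have hx1 : ρ < ((radialFactor p (K.lo α : WithTop ℚ) 1 : ℝ≥0) : ℝ) := by
        exact_mod_cast radialFactor_lt p hτ
      set ρ' : ℝ := ((radialFactor p (K.lo α : WithTop ℚ) 1 : ℝ≥0) : ℝ)
      have hρ' : 0 < ρ' := hx0.trans hx1
      have h2 := ((tendsto_add_atTop_iff_nat 1).2 hz).const_mul ρ'⁻¹
      rw [mul_zero] at h2
      refine tendsto_zero_of_recurrence _ _
        (fun n => by positivity) (r := ρ / ρ') (by positivity)
        (by rw [div_lt_one hρ']; exact hx1) h2 fun n => ?_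
      have h9 := norm_coordInv_mul_le (p := p) (A := A) hne' h'.hi_self
        (restrict p A h'.subset (T * q (n + 1)))
      rw [map_mul, restrict_coord, ← mul_assoc, mul_comm (coordInv p A a' α hne'),
        coord_mul_coordInv, one_mul, ← restrict_coord h'.subset, ← map_mul, hTq, map_add] at h9
      have h10 := norm_restrict_le h'.subset (z (n + 1))
      calc _ ≤ (ρ'⁻¹ * (‖restrict p A h'.subset (q n)‖ + ‖z (n + 1)‖)) * ρ ^ (n + 1) := by
            gcongr
            refine h9.trans ?_
            gcongr
            exact (norm_add_le _ _).trans (add_le_add le_rfl h10)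
        _ = _ := by
            rw [pow_succ]
            field_simp
    refine squeeze_zero (fun n => by positivity) (fun n => ?_)
      ((hlim1.max hlim2).trans (by rw [max_self]))
    rw [← max_mul_of_nonneg _ _ (by positivity : (0 : ℝ) ≤ ρ ^ n)]
    gcongr
    rw [max_comm]
    exact norm_le_max_outer_inner h' h (q n)

end InnerPart

/-! ### Lattices of finite type modulo `p` -/

section Lattice

variable {p : ℕ} [hp : Fact p.Prime]

/-- An open bounded subring of finite type modulo `p`. -/
structure IsLattice (p : ℕ) {R : Type*} [NormedCommRing R] (S : Subring R) (B δ : ℝ) (T : Set R) :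
    Prop where
  bounded : ∀ x ∈ S, ‖x‖ ≤ B
  pos : 0 < δ
  ball : ∀ x : R, ‖x‖ ≤ δ → x ∈ S
  finite : T.Finite
  subset : T ⊆ S
  gen : ∀ x ∈ S, ∃ y ∈ Subring.closure T, ∃ z ∈ S, x = y + p * z

/-- An element of the closure is within `δ / p` of `S`, and the difference is `p` times an element
of the ball of radius `δ`. Nothing new therefore appears modulo `p`. -/
theorem isLattice_topologicalClosure {R : Type*} [NormedCommRing R] (hu : IsUnit (p : R))
    (hnorm : ∀ x : R, ‖(p : R) * x‖ = (p : ℝ)⁻¹ * ‖x‖) (S : Subring R) (B : ℝ)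
    (hB : ∀ x ∈ S, ‖x‖ ≤ B) (δ : ℝ) (hδ : 0 < δ)
    (hS : ∀ x : R, ‖x‖ ≤ δ → x ∈ S.topologicalClosure) (T : Set R)
    (hT : T.Finite) (hTS : T ⊆ S)
    (hgen : ∀ x ∈ S, ∃ y ∈ Subring.closure T, ∃ z ∈ S, x = y + p * z) :
    IsLattice p S.topologicalClosure B δ T := by
  have hp0 : (0 : ℝ) < p := by exact_mod_cast hp.out.pos
  refine ⟨fun x hx => ?_, hδ, hS, hT, hTS.trans S.le_topologicalClosure, fun x hx => ?_⟩
  · have hc : IsClosed {x : R | ‖x‖ ≤ B} := isClosed_le continuous_norm continuous_const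
    exact closure_minimal (s := (S : Set R)) hB hc hx
  · obtain ⟨x₀, hx₀, hd⟩ := Metric.mem_closure_iff.1 (show x ∈ closure (S : Set R) from hx)
      (δ / p) (by positivity)
    obtain ⟨u, hu'⟩ := hu
    obtain ⟨y, hy, z, hz, rfl⟩ := hgen x₀ hx₀
    set z' : R := ((u⁻¹ : Rˣ) : R) * (x - (y + p * z)) with hz'
    have h1 : (p : R) * z' = x - (y + p * z) := by rw [hz', ← hu', Units.mul_inv_cancel_left]
    have h2 : ‖z'‖ ≤ δ := by
      have := hnorm z'
      rw [h1] at this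
      rw [dist_eq_norm, this, inv_mul_eq_div, div_lt_div_iff_of_pos_right hp0] at hd
      exact hd.le
    refine ⟨y, hy, z + z', Subring.add_mem _ (S.le_topologicalClosure hz) (hS _ h2), ?_⟩
    linear_combination -h1

theorem IsLattice.hasBoundedGeneration {R : Type*} [NormedCommRing R] [CompleteSpace R]
    (hu : IsUnit (p : R)) (hnorm : ∀ x : R, ‖(p : R) * x‖ = (p : ℝ)⁻¹ * ‖x‖) {S : Subring R}
    {B δ : ℝ} {T : Set R} (h : IsLattice p S B δ T) : HasBoundedGeneration R :=
  hasBoundedGeneration_of_lattice hu hnorm S B h.bounded δ h.pos h.ball T h.finite h.subset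
    fun x hx => by
      obtain ⟨y, hy, z, hz, h'⟩ := h.gen x hx
      have h1 : Subring.closure T ≤ (Algebra.adjoin ℤ T).toSubring :=
        Subring.closure_le.2 Algebra.subset_adjoin
      exact ⟨y, h1 hy, z, hz, h'⟩

/-- The power series with integral coefficients in the Tate algebra. -/
def integralTate (p : ℕ) [Fact p.Prime] (n : ℕ) : Subring (TateAlgebra p n) where
  carrier := {f | ∀ t, ‖MvPowerSeries.coeff t f.1‖ ≤ 1}
  zero_mem' := fun t => by simp
  one_mem' := fun t => by
    classical
    change ‖MvPowerSeries.coeff t (1 : MvPowerSeries (Fin n) ℚ_[p])‖ ≤ 1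
    rw [MvPowerSeries.coeff_one]
    split_ifs <;> simp
  add_mem' := fun {f g} hf hg t => by
    change ‖MvPowerSeries.coeff t (f.1 + g.1)‖ ≤ 1
    rw [map_add]
    exact (IsUltrametricDist.norm_add_le_max _ _).trans (max_le (hf t) (hg t))
  neg_mem' := fun {f} hf t => by
    change ‖MvPowerSeries.coeff t (-f.1)‖ ≤ 1
    rw [map_neg, norm_neg]
    exact hf t
  mul_mem' := fun {f g} hf hg t => by
    classical
    change ‖MvPowerSeries.coeff t (f.1 * g.1)‖ ≤ 1
    rw [MvPowerSeries.coeff_mul]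
    refine IsUltrametricDist.norm_sum_le_of_forall_le_of_nonneg zero_le_one fun x _ => ?_
    rw [norm_mul]
    exact mul_le_one₀ (hf _) (norm_nonneg _) (hg _)

/-- The variables of the Tate algebra. -/
def tateVar (p : ℕ) [Fact p.Prime] {n : ℕ} (i : Fin n) : TateAlgebra p n :=
  ⟨MvPowerSeries.X i, MvPowerSeries.isRestricted_monomial _ _ _⟩

/-- The constants of the Tate algebra. -/
def tateConst (p : ℕ) [Fact p.Prime] (n : ℕ) (c : ℚ_[p]) : TateAlgebra p n :=
  ⟨MvPowerSeries.C c, MvPowerSeries.isRestricted_C _ c⟩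

theorem TateAlgebra.finite_setOf_lt_norm {n : ℕ} (f : TateAlgebra p n) {ε : ℝ} (hε : 0 < ε) :
    {t | ε ≤ ‖MvPowerSeries.coeff t f.1‖}.Finite := by
  have h : Tendsto (fun t => ‖MvPowerSeries.coeff t f.1‖ * t.prod ((fun _ => (1 : ℝ)) · ^ ·))
    cofinite (𝓝 0) := f.2
  have h1 : ∀ᶠ t in cofinite, ¬ ε ≤ ‖MvPowerSeries.coeff t f.1‖ := by
    filter_upwards [h.eventually_lt_const hε] with t ht
    simpa [Finsupp.prod] using ht
  simpa [Filter.eventually_cofinite] using h1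

theorem exists_int_norm_sub_le (c : ℚ_[p]) (hc : ‖c‖ ≤ 1) : ∃ m : ℤ, ‖c - m‖ ≤ (p : ℝ)⁻¹ := by
  obtain ⟨k, _, hk⟩ := PadicInt.exists_mem_range (p := p) ⟨c, hc⟩
  refine ⟨k, ?_⟩
  rw [PadicInt.maximalIdeal_eq_span_p, ← pow_one (p : ℤ_[p]), 
    ← PadicInt.norm_le_pow_iff_mem_span_pow] at hk
  have h1 : ‖c - (k : ℚ_[p])‖ ≤ (p : ℝ) ^ (-((1 : ℕ) : ℤ)) := hk
  simpa using h1

/-- Integral restricted power series are polynomials modulo `p`. -/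
theorem exists_tate_decomposition {n : ℕ} (f : TateAlgebra p n) (hf : f ∈ integralTate p n) :
    ∃ y ∈ Subring.closure (Set.range (tateVar p (n := n))), ∃ z ∈ integralTate p n,
      f = y + p * z := by
  classical
  have hp0 : (0 : ℝ) < p := by exact_mod_cast hp.out.pos
  have hpQ : (p : ℚ_[p]) ≠ 0 := by exact_mod_cast hp.out.ne_zero
  have hfin := f.finite_setOf_lt_norm (ε := (p : ℝ)⁻¹) (by positivity)
  choose m hm using fun t => exists_int_norm_sub_le _ (hf t)
  let mono : (Fin n →₀ ℕ) → TateAlgebra p n := fun t =>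
    ⟨MvPowerSeries.monomial t 1, MvPowerSeries.isRestricted_monomial _ _ _⟩
  have hmono : ∀ t, mono t = ∏ i, tateVar p i ^ t i := by
    intro t
    apply Subtype.ext
    rw [SubmonoidClass.coe_finsetProd]
    change MvPowerSeries.monomial t 1 = ∏ i, (MvPowerSeries.X i : MvPowerSeries (Fin n) ℚ_[p]) ^ t i
    rw [MvPowerSeries.monomial_one_eq, Finsupp.prod_fintype _ _ fun i => pow_zero _]
  -- Only finitely many coefficients have norm at least `p⁻¹`; these are replaced by integers with
  -- the same residue.
  set y : TateAlgebra p n := ∑ t ∈ hfin.toFinset, m t • mono t with hy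
  have hcoeff : ∀ t, ‖MvPowerSeries.coeff t (f - y).1‖ ≤ (p : ℝ)⁻¹ := by
    intro t
    have h1 : (f - y).1 = f.1 - ∑ s ∈ hfin.toFinset, m s • MvPowerSeries.monomial s (1 : ℚ_[p]) := by
      rw [hy, AddSubgroupClass.coe_sub, AddSubmonoidClass.coe_finsetSum]
      rfl
    rw [h1, map_sub, map_sum]
    simp only [map_zsmul, MvPowerSeries.coeff_monomial, smul_ite, smul_zero, Finset.sum_ite_eq]
    split_ifs with h
    · simpa using hm t
    · rw [sub_zero]
      simp only [Set.Finite.mem_toFinset, Set.mem_ofPred_eq, not_le] at h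
      exact h.le
  have hpz : (p : TateAlgebra p n) * tateConst p n (p : ℚ_[p])⁻¹ = 1 := by
    apply Subtype.ext
    change ((p : TateAlgebra p n) : MvPowerSeries (Fin n) ℚ_[p]) * MvPowerSeries.C (p : ℚ_[p])⁻¹ = 1
    rw [SubringClass.coe_natCast, ← map_natCast (MvPowerSeries.C (σ := Fin n) (R := ℚ_[p])), ← map_mul,
      mul_inv_cancel₀ hpQ, map_one]
  refine ⟨y, ?_, tateConst p n (p : ℚ_[p])⁻¹ * (f - y), fun t => ?_, ?_⟩
  · refine sum_mem fun t _ => zsmul_mem ?_ _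
    rw [hmono]
    exact prod_mem fun i _ => pow_mem (Subring.subset_closure (Set.mem_range_self i)) _
  · change ‖MvPowerSeries.coeff t (MvPowerSeries.C (p : ℚ_[p])⁻¹ * (f - y).1)‖ ≤ 1
    rw [MvPowerSeries.coeff_C_mul, norm_mul, norm_inv, Padic.norm_p, inv_inv]
    calc _ ≤ (p : ℝ) * (p : ℝ)⁻¹ := by gcongr; exact hcoeff t
      _ = 1 := mul_inv_cancel₀ hp0.ne'
  · linear_combination (-(f - y)) * hpz

theorem gaussNorm_le_of_mem_integralTate {n : ℕ} {f : TateAlgebra p n}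
    (hf : f ∈ integralTate p n) :
    MvPowerSeries.gaussNorm (fun a : ℚ_[p] => ‖a‖) (fun _ => (1 : ℝ)) f.1 ≤ 1 := by
  refine ciSup_le fun t => ?_
  simpa [Finsupp.prod] using hf t

/-- Every element of the Tate algebra is integral up to a power of `p`. -/
theorem exists_pow_mul_mem_integralTate {n : ℕ} (f : TateAlgebra p n) :
    ∃ k : ℕ, (p : TateAlgebra p n) ^ k * f ∈ integralTate p n := by
  have hp1 : (1 : ℝ) < p := by exact_mod_cast hp.out.one_lt
  have hp0 : (0 : ℝ) < p := zero_lt_one.trans hp1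
  have hfin := f.finite_setOf_lt_norm (ε := 1) zero_lt_one
  obtain ⟨C, hC⟩ := (hfin.image fun t => ‖MvPowerSeries.coeff t f.1‖).bddAbove
  obtain ⟨k, hk⟩ := pow_unbounded_of_one_lt (max C 1) hp1
  refine ⟨k, fun t => ?_⟩
  have h1 : ((p : TateAlgebra p n) ^ k * f).1 = MvPowerSeries.C ((p : ℚ_[p]) ^ k) * f.1 := by
    rw [map_pow, map_natCast]
    rfl
  rw [h1, MvPowerSeries.coeff_C_mul, norm_mul, norm_pow, Padic.norm_p, inv_pow, inv_mul_eq_div,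
    div_le_one (by positivity)]
  refine le_trans ?_ hk.le
  by_cases ht : 1 ≤ ‖MvPowerSeries.coeff t f.1‖
  · exact (hC ⟨t, ht, rfl⟩).trans (le_max_left _ _)
  · exact (not_le.1 ht).le.trans (le_max_right _ _)

/-- Affinoid algebras contain lattices. -/
theorem IsAffinoidAlgebra.exists_isLattice {A : Type*} [NormedCommRing A] [NormedAlgebra ℚ_[p] A]
    (hA : IsAffinoidAlgebra p A) :
    ∃ (S : Subring A) (B δ : ℝ) (T : Set A), IsLattice p S B δ T := by
  obtain ⟨hcomplete, n, φ, hφ, -, C, hC⟩ := hA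
  have hp0 : (0 : ℝ) < p := by exact_mod_cast hp.out.pos
  obtain ⟨u, hu⟩ := isUnit_p (p := p) (A := A)
  set S := (integralTate p n).map φ with hS
  -- Baire category: the sets where `p ^ k x` lies in the closure of `S` cover `A`, so one has
  -- interior. Multiplication by `p ^ k` is a homeomorphism, and an additive subgroup with interior
  -- is open.
  have hint : (interior (S.topologicalClosure : Set A)).Nonempty := by
    have hcont : ∀ k : ℕ, Continuous fun x : A => (p : A) ^ k * x := fun k => by fun_prop
    obtain ⟨k, hk⟩ := nonempty_interior_of_iUnion_of_closed
      (f := fun k : ℕ => (fun x : A => (p : A) ^ k * x) ⁻¹' (S.topologicalClosure : Set A))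
      (fun k => S.isClosed_topologicalClosure.preimage (hcont k)) (by
        refine Set.eq_univ_of_forall fun x => ?_
        obtain ⟨f, rfl⟩ := hφ x
        obtain ⟨k, hk⟩ := exists_pow_mul_mem_integralTate f
        refine Set.mem_iUnion.2 ⟨k, S.le_topologicalClosure ⟨_, hk, ?_⟩⟩
        simp)
    let e : A ≃ₜ A := 
      { toFun := fun x => (p : A) ^ k * x
        invFun := fun x => ((u⁻¹ ^ k : Aˣ) : A) * x
        left_inv := fun x => by
          change ((u⁻¹ ^ k : Aˣ) : A) * ((p : A) ^ k * x) = x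
          rw [← hu, ← Units.val_pow_eq_pow_val, inv_pow, Units.inv_mul_cancel_left]
        right_inv := fun x => by
          change (p : A) ^ k * (((u⁻¹ ^ k : Aˣ) : A) * x) = x
          rw [← hu, ← Units.val_pow_eq_pow_val, inv_pow, Units.mul_inv_cancel_left]
        continuous_toFun := hcont k
        continuous_invFun := by fun_prop }
    have h1 := e.preimage_interior (S.topologicalClosure : Set A)
    obtain ⟨x, hx⟩ := hk
    exact ⟨e x, by
      have : x ∈ e ⁻¹' interior (S.topologicalClosure : Set A) := by rw [h1]; exact hx
      exact this⟩
  have hopen : IsOpen (S.topologicalClosure : Set A) := by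
    obtain ⟨x, hx⟩ := hint
    exact AddSubgroup.isOpen_of_mem_nhds S.topologicalClosure.toAddSubgroup
      (mem_interior_iff_mem_nhds.1 hx)
  obtain ⟨δ, hδ, hball⟩ := Metric.isOpen_iff.1 hopen 0 S.topologicalClosure.zero_mem
  refine ⟨S.topologicalClosure, |C|, δ / 2, φ '' Set.range (tateVar p), ?_⟩
  refine isLattice_topologicalClosure ⟨u, hu⟩ norm_p_mul S _ ?_ _ (by positivity) (fun x hx => ?_) _
    ((Set.finite_range _).image _) ?_ ?_
  · rintro _ ⟨f, hf, rfl⟩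
    refine (hC f).trans ((le_abs_self _).trans ?_)
    rw [abs_mul]
    refine mul_le_of_le_one_right (abs_nonneg _) ?_
    rw [abs_of_nonneg (MvPowerSeries.gaussNorm_nonneg _ _ _ fun a => norm_nonneg a)]
    exact gaussNorm_le_of_mem_integralTate hf
  · refine hball ?_
    rw [mem_ball_zero_iff]
    linarith
  · rintro _ ⟨_, ⟨i, rfl⟩, rfl⟩
    refine ⟨tateVar p i, fun t => ?_, rfl⟩
    classical
    change ‖MvPowerSeries.coeff t (MvPowerSeries.X i)‖ ≤ 1
    rw [MvPowerSeries.coeff_X]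
    split_ifs <;> simp
  · rintro _ ⟨f, hf, rfl⟩
    obtain ⟨y, hy, z, hz, rfl⟩ := exists_tate_decomposition f hf
    refine ⟨φ y, ?_, φ z, ⟨z, hz, rfl⟩, by rw [map_add, map_mul, map_natCast]⟩
    rw [← RingHom.map_closure]
    exact ⟨y, hy, rfl⟩

end Lattice

/-! ### Lattices in the rings of analytic functions -/

section IntervalLattice

/-- Here the rationality of the end points enters: a fixed power of the radius is the norm of a
scalar, so a power of the coordinate can be normalised to norm one. -/
theorem radialFactor_denominator (p : ℕ) [hp : Fact p.Prime] (q : ℚ) :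
    radialFactor p q 1 ^ ((p - 1) * q.den) = (p : ℝ≥0) ^ (-q.num) := by
  have hp2 : (p : ℝ) - 1 ≠ 0 := by
    have : (1 : ℝ) < p := by exact_mod_cast hp.out.one_lt
    linarith
  simp only [radialFactor]
  rw [← NNReal.rpow_natCast, ← NNReal.rpow_mul, ← NNReal.rpow_intCast]
  congr 1
  have h1 : (q : ℝ) * q.den = q.num := by exact_mod_cast q.mul_den_eq_num
  have h2 : ((p - 1 : ℕ) : ℝ) = p - 1 := by
    rw [Nat.cast_sub hp.out.one_lt.le, Nat.cast_one]
  push_cast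
  rw [h2, ← h1]
  field_simp

variable {I : Type*} [Fintype I] [DecidableEq I] {p : ℕ} [hp : Fact p.Prime] {A : Type*}
  [NormedCommRing A] [IsUltrametricDist A] [NormedAlgebra ℚ_[p] A]

/-- The prime `p` as a unit. -/
def unitP (p : ℕ) [Fact p.Prime] (A : Type*) [NormedCommRing A] [NormedAlgebra ℚ_[p] A] : Aˣ :=
  (isUnit_p (p := p) (A := A)).unit

omit [IsUltrametricDist A] in
theorem norm_unitP_zpow_mul (c : ℤ) (a : A) : ‖((unitP p A ^ c : Aˣ) : A) * a‖ = (p : ℝ) ^ (-c) * ‖a‖ := by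
  have hp0 : (p : ℝ)⁻¹ ≠ 0 := inv_ne_zero (by exact_mod_cast hp.out.ne_zero)
  rw [norm_zpow_mul hp0 norm_p_mul, inv_zpow, zpow_neg]

theorem norm_constHom_unitP_zpow_mul {b : MultiInterval I} (c : ℤ) (x : IntervalRing p A b) :
    ‖constHom b ((unitP p A ^ c : Aˣ) : A) * x‖ = (p : ℝ) ^ (-c) * ‖x‖ := by
  have hp0 : (p : ℝ)⁻¹ ≠ 0 := inv_ne_zero (by exact_mod_cast hp.out.ne_zero)
  have h1 : constHom (p := p) b ((unitP p A ^ c : Aˣ) : A) =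
      ((Units.map (constHom (p := p) (A := A) b : A →* _) (unitP p A) ^ c : (IntervalRing p A b)ˣ) :
        IntervalRing p A b) := by
    rw [← map_zpow]
    rfl
  have h2 : ((Units.map (constHom (p := p) (A := A) b : A →* _) (unitP p A) : (IntervalRing p A b)ˣ) :
        IntervalRing p A b) = (p : IntervalRing p A b) :=
    map_natCast (constHom (p := p) (A := A) b) p
  rw [h1, norm_zpow_mul hp0 (fun x => by rw [h2, IntervalRing.norm_p_mul]), inv_zpow, zpow_neg]

/-- The constant `p^c` as an analytic function. -/
def constPow (p : ℕ) [Fact p.Prime] (A : Type*) [NormedCommRing A] [IsUltrametricDist A]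
    [NormedAlgebra ℚ_[p] A] (b : MultiInterval I) (c : ℤ) : IntervalRing p A b :=
  constHom b ((unitP p A ^ c : Aˣ) : A)

theorem constPow_add (b : MultiInterval I) (c d : ℤ) :
    constPow p A b (c + d) = constPow p A b c * constPow p A b d := by
  rw [constPow, zpow_add, Units.val_mul, map_mul]
  rfl

theorem constPow_zero (b : MultiInterval I) : constPow p A b 0 = 1 := by
  rw [constPow, zpow_zero, Units.val_one, map_one]

theorem constPow_mul_nat (b : MultiInterval I) (c : ℤ) (j : ℕ) :
    constPow p A b (c * j) = constPow p A b c ^ j := by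
  rw [constPow, zpow_mul, zpow_natCast, Units.val_pow_eq_pow_val, map_pow]
  rfl

theorem norm_constPow_mul {b : MultiInterval I} (c : ℤ) (x : IntervalRing p A b) :
    ‖constPow p A b c * x‖ = (p : ℝ) ^ (-c) * ‖x‖ := norm_constHom_unitP_zpow_mul c x

theorem constPow_mul_neg (b : MultiInterval I) (c : ℤ) :
    constPow p A b c * constPow p A b (-c) = 1 := by
  rw [← constPow_add, add_neg_cancel, constPow_zero]

omit [NormedAlgebra ℚ_[p] A] in
theorem norm_coord_pow_mul_le {b : MultiInterval I} (α : I) (j : ℕ) (x : IntervalRing p A b) :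
    ‖coord p A b α ^ j * x‖ ≤ (radialFactor p (b.lo α) 1 : ℝ) ^ j * ‖x‖ := by
  have := norm_mul_mono_pow_le (expSingle b α 1 fun _ => zero_le_one) x j
  rw [weight_expSingle, b.dirWeight_of_nonneg p α zero_le_one, zpow_one] at this
  rw [mul_comm, mul_comm (_ ^ j)]
  exact this

omit [NormedAlgebra ℚ_[p] A] in
theorem norm_coordInv_pow_mul_le {b : MultiInterval I} {α : I} (h : b.hi α ≠ ⊤) {τ : ℚ}
    (hτ : b.hi α = τ) (j : ℕ) (x : IntervalRing p A b) :
    ‖coordInv p A b α h ^ j * x‖ ≤ ((radialFactor p τ 1 : ℝ)⁻¹) ^ j * ‖x‖ := by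
  have := norm_mul_mono_pow_le (expSingle b α (-1) fun h' => absurd h' h) x j
  rw [weight_coordInv h hτ] at this
  rw [mul_comm, mul_comm (_ ^ j)]
  exact_mod_cast this

omit [NormedAlgebra ℚ_[p] A] in
theorem mono_expSingle_natCast (b : MultiInterval I) (α : I) (k : ℕ) (hk) :
    mono p b (expSingle b α k hk) (1 : A) = coord p A b α ^ k := by
  rw [coord, mono_pow]
  congr 1
  ext β
  by_cases hβ : β = α
  · subst hβ
    simp [expSingle]
  · simp [expSingle, hβ]

omit [NormedAlgebra ℚ_[p] A] in
theorem mono_expSingle_neg_natCast (b : MultiInterval I) (α : I) (h : b.hi α ≠ ⊤) (k : ℕ) (hk) :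
    mono p b (expSingle b α (-k) hk) (1 : A) = coordInv p A b α h ^ k := by
  rw [coordInv, mono_pow]
  congr 1
  ext β
  by_cases hβ : β = α
  · subst hβ
    simp [expSingle]
  · simp [expSingle, hβ]

/-- The powers of the coordinate in one direction, normalised by powers of `p`, lie in a finitely
generated monoid of contractions. -/
theorem exists_direction_generators (b : MultiInterval I) (α : I) :
    ∃ G : Set (IntervalRing p A b), G.Finite ∧ (∀ g ∈ G, ∀ y, ‖g * y‖ ≤ ‖y‖) ∧ ∃ C : ℝ, 0 < C ∧
      ∀ (k : ℤ) (hk : b.hi α = ⊤ → 0 ≤ k), ∃ c : ℤ, ∃ u ∈ Submonoid.closure G,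
        mono p b (expSingle b α k hk) 1 = constPow p A b c * u ∧
        (p : ℝ) ^ (-c) ≤ C * b.dirWeight p α k := by
  have hp1 : (1 : ℝ) < p := by exact_mod_cast hp.out.one_lt
  have hp0 : (0 : ℝ) < p := zero_lt_one.trans hp1
  have hpp : 0 < p - 1 := by have := hp.out.one_lt; omega
  have hden : ∀ q : ℚ, 0 < (p - 1) * q.den := fun q => Nat.mul_pos hpp q.den_pos
  have hrad : ∀ q : ℚ, (radialFactor p q 1 : ℝ) ^ ((p - 1) * q.den) = (p : ℝ) ^ (-q.num) := by
    intro q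
    have := congrArg ((↑) : ℝ≥0 → ℝ) (radialFactor_denominator p q)
    push_cast at this
    exact this
  set T := coord p A b α with hT
  set ρ : ℝ := ((radialFactor p (b.lo α : WithTop ℚ) 1 : ℝ≥0) : ℝ) with hρ
  have hρ0 : 0 < ρ := by exact_mod_cast radialFactor_pos p (b.lo α) 1
  have hρ1 : ρ < 1 := by exact_mod_cast radialFactor_lt_one p (b.lo_pos α)
  set d := (p - 1) * (b.lo α).den with hd
  set e := (b.lo α).num with he
  -- A contraction because `T` has norm `ρ` and `ρ ^ d = p ^ (-e)`. Euclidean division of the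
  -- exponent by `d` writes powers of `T` through `X`, a power of `p` and fewer than `d` factors
  -- `T`.
  set X := constPow p A b (-e) * T ^ d with hX
  have hXn : ∀ y, ‖X * y‖ ≤ ‖y‖ := by
    intro y
    rw [hX, mul_assoc, norm_constPow_mul, neg_neg]
    calc _ ≤ (p : ℝ) ^ e * (ρ ^ d * ‖y‖) := by
          gcongr
          exact norm_coord_pow_mul_le α d y
      _ = ‖y‖ := by
          rw [hρ, hd, hrad, ← mul_assoc, ← zpow_add₀ hp0.ne', add_neg_cancel, zpow_zero, one_mul]
  have hTn : ∀ y, ‖T * y‖ ≤ ‖y‖ := fun y =>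
    (norm_coord_mul_le α y).trans (mul_le_of_le_one_left (norm_nonneg _) hρ1.le)
  have hpos : ∀ k : ℕ, ∃ j r : ℕ, T ^ k = constPow p A b (e * j) * (X ^ j * T ^ r) ∧
      (p : ℝ) ^ (-(e * j)) ≤ (p : ℝ) ^ e * ρ ^ k := by
    intro k
    refine ⟨k / d, k % d, ?_, ?_⟩
    · rw [hX, mul_pow, ← constPow_mul_nat, ← mul_assoc, ← mul_assoc, ← constPow_add, neg_mul,
        add_neg_cancel, constPow_zero, one_mul, ← pow_mul, ← pow_add, Nat.div_add_mod]
    · conv_rhs => rw [← Nat.div_add_mod k d, pow_add, pow_mul, hρ, hd, hrad, ← hρ, ← hd, ← he]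
      have h1 : ρ ^ d ≤ ρ ^ (k % d) :=
        pow_le_pow_of_le_one hρ0.le hρ1.le (Nat.mod_lt _ (hden _)).le
      rw [hρ, hd, hrad, ← hρ, ← hd, ← he] at h1
      calc (p : ℝ) ^ (-(e * (k / d : ℕ))) = p ^ e * (((p : ℝ) ^ (-e)) ^ (k / d) * (p : ℝ) ^ (-e)) := by
            rw [← zpow_natCast, ← zpow_mul, ← zpow_add₀ hp0.ne', ← zpow_add₀ hp0.ne']
            congr 1
            ring
        _ ≤ _ := by gcongr
  by_cases hb : b.hi α = ⊤
  · refine ⟨{T, X}, by simp, by simp [hXn, hTn], (p : ℝ) ^ e, by positivity, fun k hk => ?_⟩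
    lift k to ℕ using hk hb
    obtain ⟨j, r, h1, h2⟩ := hpos k
    refine ⟨e * j, X ^ j * T ^ r, mul_mem (pow_mem (Submonoid.subset_closure (by simp)) _)
      (pow_mem (Submonoid.subset_closure (by simp)) _), ?_, ?_⟩
    · rw [mono_expSingle_natCast, ← h1]
    · rw [b.dirWeight_of_nonneg p α (by positivity), zpow_natCast]
      exact_mod_cast h2
  · obtain ⟨q, hb⟩ : ∃ q : ℚ, b.hi α = q := (WithTop.ne_top_iff_exists.1 hb).imp fun _ h => h.symm
    have hne : b.hi α ≠ ⊤ := by rw [hb]; exact WithTop.coe_ne_top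
    set V := coordInv p A b α hne with hV
    have hTV : T * V = 1 := coord_mul_coordInv hne
    have hq0 : 0 < q := by
      have := b.lo_le_hi α
      rw [hb] at this
      exact (b.lo_pos α).trans_le (by exact_mod_cast this)
    set σ : ℝ := ((radialFactor p (q : WithTop ℚ) 1 : ℝ≥0) : ℝ) with hσ
    have hσ0 : 0 < σ := by exact_mod_cast radialFactor_pos p q 1
    have hσ1 : σ < 1 := by exact_mod_cast radialFactor_lt_one p hq0
    set d' := (p - 1) * q.den with hd'
    set e' := q.num with he'
    set Y := constPow p A b e' * V ^ d' with hY
    have hYn : ∀ y, ‖Y * y‖ ≤ ‖y‖ := by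
      intro y
      rw [hY, mul_assoc, norm_constPow_mul]
      calc _ ≤ (p : ℝ) ^ (-e') * (σ⁻¹ ^ d' * ‖y‖) := by
            gcongr
            exact norm_coordInv_pow_mul_le hne hb d' y
        _ = ‖y‖ := by
            rw [inv_pow, hσ, hd', hrad, ← mul_assoc, mul_inv_cancel₀ (by positivity), one_mul]
    refine ⟨{T, X, Y}, by simp, by simp [hXn, hTn, hYn], (p : ℝ) ^ e + (p : ℝ) ^ e', by positivity,
      fun k hk => ?_⟩
    rcases le_total 0 k with h0 | h0
    · lift k to ℕ using h0
      obtain ⟨j, r, h1, h2⟩ := hpos k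
      refine ⟨e * j, X ^ j * T ^ r, mul_mem (pow_mem (Submonoid.subset_closure (by simp)) _)
        (pow_mem (Submonoid.subset_closure (by simp)) _), ?_, ?_⟩
      · rw [mono_expSingle_natCast, ← h1]
      · rw [b.dirWeight_of_nonneg p α (by positivity), zpow_natCast]
        refine h2.trans ?_
        push_cast
        gcongr
        have : (0 : ℝ) < (p : ℝ) ^ e' := by positivity
        linarith
    · obtain ⟨m, rfl⟩ : ∃ m : ℕ, k = -m := ⟨k.natAbs, by omega⟩
      -- The negative exponent is rounded away from zero, so the remainder is a nonnegative power of
      -- `T`, again a contraction.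
      obtain ⟨j, r, hr, hm⟩ : ∃ j r : ℕ, r ≤ d' ∧ d' * j = m + r := by
        refine ⟨m / d' + 1, d' - m % d', Nat.sub_le _ _, ?_⟩
        have h1 := Nat.div_add_mod m d'
        have h2 : m % d' < d' := Nat.mod_lt m (hden q)
        rw [mul_add, mul_one]
        omega
      refine ⟨-(e' * j), Y ^ j * T ^ r, mul_mem (pow_mem (Submonoid.subset_closure (by simp)) _)
        (pow_mem (Submonoid.subset_closure (by simp)) _), ?_, ?_⟩
      · rw [mono_expSingle_neg_natCast b α hne, hY, mul_pow, ← constPow_mul_nat, ← mul_assoc,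
          ← mul_assoc, ← constPow_add, neg_add_cancel, constPow_zero, one_mul, ← pow_mul, hm,
          pow_add, mul_assoc, ← mul_pow, mul_comm V T, hTV, one_pow, mul_one]
      · rw [b.dirWeight_of_nonpos p α h0 hk, hb, radialFactor_coe p q, neg_neg, zpow_neg,
          zpow_natCast]
        push_cast
        have h1 : σ ^ d' ≤ σ ^ r := pow_le_pow_of_le_one hσ0.le hσ1.le hr
        have h2 : (σ ^ m)⁻¹ = (p : ℝ) ^ (e' * j) * σ ^ r := by
          have h3 : σ ^ m * σ ^ r = (p : ℝ) ^ (-(e' * j)) := by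
            rw [← pow_add, ← hm, pow_mul, hσ, hd', hrad, ← zpow_natCast, ← zpow_mul, neg_mul]
          rw [zpow_neg] at h3
          have : (p : ℝ) ^ (e' * j) ≠ 0 := by positivity
          field_simp at h3 ⊢
          linarith
        rw [h2]
        rw [hσ, hd', hrad, ← hσ, ← he'] at h1
        calc (p : ℝ) ^ (e' * j) = (p : ℝ) ^ e' * ((p : ℝ) ^ (e' * j) * (p : ℝ) ^ (-e')) := by
              rw [← zpow_add₀ hp0.ne', ← zpow_add₀ hp0.ne']
              congr 1
              ring
          _ ≤ _ := by
              gcongr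
              have : (0 : ℝ) < (p : ℝ) ^ e := by positivity
              linarith

omit [NormedAlgebra ℚ_[p] A] in
theorem prod_mono {ι : Type*} (b : MultiInterval I) (s : Finset ι) (n : ι → exponents b.hi) :
    ∏ i ∈ s, mono p b (n i) (1 : A) = mono p b (∑ i ∈ s, n i) 1 := by
  classical
  induction s using Finset.induction_on with
  | empty => rw [Finset.prod_empty, Finset.sum_empty, mono_zero_one]
  | insert i s hi ih => rw [Finset.prod_insert hi, Finset.sum_insert hi, ih, mono_mul, mul_one]

omit [NormedAlgebra ℚ_[p] A] in
theorem mono_eq_prod (b : MultiInterval I) (n : exponents b.hi) (a : A) :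
    mono p b n a = constHom b a * ∏ α, mono p b (expSingle b α (n.1 α) (n.2 α)) 1 := by
  rw [prod_mono, constHom_apply, mono_mul, mul_one, zero_add]
  congr 1
  ext β
  rw [AddSubmonoid.coe_finsetSum, Finset.sum_apply]
  simp only [expSingle, Pi.single_apply]
  simp

/-- The rings of analytic functions over an affinoid algebra have bounded generation. -/
theorem IsAffinoidAlgebra.hasBoundedGeneration (hA : IsAffinoidAlgebra p A) (b : MultiInterval I) :
    HasBoundedGeneration (IntervalRing p A b) := by
  obtain ⟨S, B, δ, T, h⟩ := hA.exists_isLattice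
  have hp0 : (0 : ℝ) < p := by exact_mod_cast hp.out.pos
  have hδ := h.pos
  choose G hGfin hG C hC hgen using fun α => exists_direction_generators (p := p) (A := A) b α
  -- Products of generators are an element of the lattice of `A` times a contraction, so the
  -- ultrametric inequality keeps the bound `B` on the whole subring.
  set S₀ : Subring (IntervalRing p A b) := Subring.closure (constHom b '' S ∪ ⋃ α, G α) with hS₀
  have hconst : ∀ a ∈ S, constHom b a ∈ S₀ := fun a ha =>
    Subring.subset_closure (Or.inl ⟨a, ha, rfl⟩)
  have hGS : ∀ α, ∀ u ∈ Submonoid.closure (G α), u ∈ S₀ := by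
    intro α u hu
    have : Submonoid.closure (G α) ≤ S₀.toSubmonoid := (Submonoid.closure_le).2 fun g hg =>
      Subring.subset_closure (Or.inr (Set.mem_iUnion.2 ⟨α, hg⟩))
    exact this hu
  have hB0 : 0 ≤ B := (norm_nonneg _).trans (h.bounded 0 S.zero_mem)
  have hprod : ∀ x ∈ Submonoid.closure (constHom (p := p) b '' S ∪ ⋃ α, G α),
      ∃ s ∈ S, ∃ u, (∀ y, ‖u * y‖ ≤ ‖y‖) ∧ x = constHom b s * u := by
    intro x hx
    induction hx using Submonoid.closure_induction with
    | mem x hx =>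
      rcases hx with ⟨s, hs, rfl⟩ | hx
      · exact ⟨s, hs, 1, fun y => by rw [one_mul], by rw [mul_one]⟩
      · obtain ⟨α, hα⟩ := Set.mem_iUnion.1 hx
        exact ⟨1, S.one_mem, x, hG α x hα, by rw [map_one, one_mul]⟩
    | one => exact ⟨1, S.one_mem, 1, fun y => by rw [one_mul], by rw [map_one, one_mul]⟩
    | mul x y _ _ hx hy =>
      obtain ⟨s, hs, u, hu, rfl⟩ := hx
      obtain ⟨t, ht, v, hv, rfl⟩ := hy
      refine ⟨s * t, S.mul_mem hs ht, u * v, fun y => ?_, by rw [map_mul]; ring⟩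
      rw [mul_assoc]
      exact (hu _).trans (hv _)
  have hbound : ∀ x ∈ S₀, ‖x‖ ≤ B := by
    intro x hx
    rw [hS₀, Subring.mem_closure_iff] at hx
    induction hx using AddSubgroup.closure_induction with
    | mem x hx =>
      obtain ⟨s, hs, u, hu, rfl⟩ := hprod x hx
      rw [mul_comm]
      refine (hu _).trans ?_
      rw [constHom_apply, norm_mono]
      have : (b.weight p ((0 : exponents b.hi) : I → ℤ) : ℝ) = 1 := by
        exact_mod_cast b.weight_zero p
      rw [this, mul_one]
      exact h.bounded s hs
    | zero => rwa [norm_zero]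
    | add x y _ _ hx hy => exact (IsUltrametricDist.norm_add_le_max _ _).trans (max_le hx hy)
    | neg x _ hx => rwa [norm_neg]
  have hC' : 0 < ∏ α, C α := Finset.prod_pos fun α _ => hC α
  -- The monomial is a contraction times the scalar `p ^ (∑ c α) a`. The constants `C α` measure the
  -- loss in normalising each direction, and after paying for them the scalar lies in the ball of
  -- radius `δ`.
  have hmono : ∀ (n : exponents b.hi) (a : A), ‖a‖ * b.weight p n.1 ≤ δ / ∏ α, C α →
      mono p b n a ∈ S₀ := by
    intro n a ha
    choose c u hu hcu hc using fun α => hgen α (n.1 α) (n.2 α)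
    have h1 : mono p b n a = constHom b (((unitP p A ^ ∑ α, c α : Aˣ) : A) * a) * ∏ α, u α := by
      have h2 : ∏ α, constPow p A b (c α) = constPow p A b (∑ α, c α) := by
        have : ∀ s : Finset I, ∏ α ∈ s, constPow p A b (c α) = constPow p A b (∑ α ∈ s, c α) := by
          intro s
          induction s using Finset.induction_on with
          | empty => rw [Finset.prod_empty, Finset.sum_empty, constPow_zero]
          | insert i s hi ih => rw [Finset.prod_insert hi, Finset.sum_insert hi, ih, constPow_add]
        exact this _
      rw [mono_eq_prod]
      simp only [hcu]
      rw [Finset.prod_mul_distrib, h2, map_mul, ← constPow]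
      ring
    rw [h1]
    refine S₀.mul_mem (hconst _ (h.ball _ ?_)) (S₀.prod_mem fun α _ => hGS α _ (hu α))
    have h3 : (p : ℝ) ^ (-∑ α, c α) ≤ (∏ α, C α) * b.weight p n.1 := by
      have h4 : (p : ℝ) ^ (-∑ α, c α) = ∏ α, (p : ℝ) ^ (-c α) := by
        rw [← Finset.sum_neg_distrib]
        have : ∀ s : Finset I, (p : ℝ) ^ (∑ α ∈ s, -c α) = ∏ α ∈ s, (p : ℝ) ^ (-c α) := by
          intro s
          induction s using Finset.induction_on with
          | empty => simp
          | insert i s hi ih => rw [Finset.prod_insert hi, Finset.sum_insert hi, zpow_add₀ hp0.ne', ih]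
        exact this _
      rw [h4, MultiInterval.weight]
      push_cast
      rw [← Finset.prod_mul_distrib]
      exact Finset.prod_le_prod (fun α _ => by positivity) fun α _ => hc α
    rw [norm_unitP_zpow_mul]
    calc _ ≤ ((∏ α, C α) * b.weight p n.1) * ‖a‖ := by gcongr
      _ = (∏ α, C α) * (‖a‖ * b.weight p n.1) := by ring
      _ ≤ (∏ α, C α) * (δ / ∏ α, C α) := by gcongr
      _ = δ := by field_simp
  have hδ' : 0 < δ / ∏ α, C α := by positivity
  have hball : ∀ x : IntervalRing p A b, ‖x‖ ≤ δ / ∏ α, C α → x ∈ S₀.topologicalClosure := by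
    intro x hx
    refine Metric.mem_closure_iff.2 fun ε hε => ?_
    obtain ⟨f, hf⟩ := exists_poly_near x (lt_min hε hδ')
    refine ⟨f, ?_, by rw [dist_eq_norm]; exact hf.trans_le (min_le_left _ _)⟩
    have hfn : ‖f‖ ≤ δ / ∏ α, C α := by
      have h1 : (f : IntervalRing p A b) = x - (x - f) := by ring
      rw [← UniformSpace.Completion.norm_coe (E := LaurentPolynomials p A b), h1]
      rw [sub_eq_add_neg]
      exact (IsUltrametricDist.norm_add_le_max _ _).trans
        (max_le hx (by rw [norm_neg]; exact hf.le.trans (min_le_right _ _)))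
    rw [coe_eq_sum_mono]
    exact S₀.sum_mem fun n _ => hmono n _ ((f.le_norm n).trans hfn)
  have hT : (constHom (p := p) b '' T ∪ ⋃ α, G α).Finite :=
    (h.finite.image _).union (Set.finite_iUnion hGfin)
  have hTS : constHom (p := p) b '' T ∪ ⋃ α, G α ⊆ S₀ := by
    rintro x (⟨t, ht, rfl⟩ | hx)
    · exact hconst t (h.subset ht)
    · exact Subring.subset_closure (Or.inr hx)
  have hAS : ∀ x ∈ Subring.closure (constHom (p := p) b '' T ∪ ⋃ α, G α), x ∈ S₀ :=
    fun x hx => Subring.closure_le.2 hTS hx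
  refine (isLattice_topologicalClosure IntervalRing.isUnit_p IntervalRing.norm_p_mul S₀ B hbound _
    hδ' hball _ hT hTS fun x hx => ?_).hasBoundedGeneration IntervalRing.isUnit_p
      IntervalRing.norm_p_mul
  have hpS : (p : IntervalRing p A b) ∈ S₀ := natCast_mem S₀ p
  induction hx using Subring.closure_induction with
  | mem x hx =>
    rcases hx with ⟨s, hs, rfl⟩ | hx
    · obtain ⟨y, hy, z, hz, rfl⟩ := h.gen s hs
      refine ⟨constHom b y, ?_, constHom b z, hconst z hz, by rw [map_add, map_mul, map_natCast]⟩
      refine Subring.closure_mono Set.subset_union_left ?_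
      rw [← RingHom.map_closure]
      exact ⟨y, hy, rfl⟩
    · exact ⟨x, Subring.subset_closure (Or.inr hx), 0, S₀.zero_mem, by rw [mul_zero, add_zero]⟩
  | zero => exact ⟨0, zero_mem _, 0, S₀.zero_mem, by rw [mul_zero, add_zero]⟩
  | one => exact ⟨1, one_mem _, 0, S₀.zero_mem, by rw [mul_zero, add_zero]⟩
  | add x y _ _ hx hy =>
    obtain ⟨y', hy', z', hz', rfl⟩ := hy
    obtain ⟨y, hy, z, hz, rfl⟩ := hx
    exact ⟨y + y', add_mem hy hy', z + z', S₀.add_mem hz hz', by ring⟩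
  | neg x _ hx =>
    obtain ⟨y, hy, z, hz, rfl⟩ := hx
    exact ⟨-y, neg_mem hy, -z, S₀.neg_mem hz, by ring⟩
  | mul x y _ _ hx hy =>
    obtain ⟨y', hy', z', hz', rfl⟩ := hy
    obtain ⟨y, hy, z, hz, rfl⟩ := hx
    refine ⟨y * y', mul_mem hy hy', y * z' + z * y' + p * (z * z'), ?_, by ring⟩
    exact S₀.add_mem (S₀.add_mem (S₀.mul_mem (hAS y hy) hz') (S₀.mul_mem hz (hAS y' hy')))
      (S₀.mul_mem hpS (S₀.mul_mem hz hz'))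

end IntervalLattice

/-! ### Density, dominating units and flatness of the restriction maps -/

section Restriction

variable {I : Type*} [Fintype I] [DecidableEq I] {p : ℕ} [hp : Fact p.Prime] {A : Type*}
  [NormedCommRing A] [IsUltrametricDist A]

/-- Equal outer end points allow the same exponents, so all Laurent polynomials lift. Shrinking a
disc to an annulus would introduce negative powers and destroy density. -/
theorem denseRange_restrict {a b : MultiInterval I} (h : a ≤ b) (hhi : a.hi = b.hi) :
    DenseRange (restrict p A h) := by
  intro x
  change x ∈ (restrict p A h).range.topologicalClosure
  induction x using IntervalRing.induction with
  | closed => exact Subring.isClosed_topologicalClosure _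
  | add x y hx hy => exact add_mem hx hy
  | mono n x =>
    refine Subring.le_topologicalClosure _ ⟨mono p b ⟨n.1, fun β hβ => n.2 β (by rw [hhi, hβ])⟩ x, ?_⟩
    rw [restrict_mono]
    rfl

/-- Up to a unit, finitely many functions can be approximated by functions on a larger
multi-interval. -/
theorem exists_unit_approx {κ : Type*} [Finite κ] {a b : MultiInterval I} (h : a ≤ b)
    (y : κ → IntervalRing p A a) {ε : ℝ} (hε : 0 < ε) :
    ∃ (u v : IntervalRing p A a) (x : κ → IntervalRing p A b), u * v = 1 ∧
      ∀ i, ‖v * restrict p A h (x i) - y i‖ < ε := by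
  classical
  have := Fintype.ofFinite κ
  choose f hf using fun i => exists_poly_near (y i) hε
  obtain ⟨N, hN⟩ : ∃ N : ℕ, ∀ i, ∀ n ∈ (LaurentPolynomials.coeff (f i)).support, ∀ α,
      0 ≤ n.1 α + N := by
    have hfin : (⋃ i, ⋃ α, (fun n : exponents a.hi => n.1 α) ''
        ((LaurentPolynomials.coeff (f i)).support : Set (exponents a.hi))).Finite :=
      Set.finite_iUnion fun i => Set.finite_iUnion fun α => (Finset.finite_toSet _).image _
    obtain ⟨M, hM⟩ := hfin.bddBelow
    refine ⟨M.natAbs, fun i n hn α => ?_⟩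
    have := hM (Set.mem_iUnion.2 ⟨i, Set.mem_iUnion.2 ⟨α, n, hn, rfl⟩⟩)
    simp only at this
    omega
  -- Negative exponents obstruct the lift only where `b` is a disc and `a` an annulus. In these
  -- directions `T_α` is a unit on `a`, and a power of it clears the denominators.
  let w : I → ℤ := fun α => if b.hi α = ⊤ ∧ a.hi α ≠ ⊤ then N else 0
  have hw : ∀ α, a.hi α = ⊤ → w α = 0 := fun α hα => if_neg fun h => h.2 hα
  let e : exponents a.hi := ⟨w, fun α hα => (hw α hα).ge⟩
  let e' : exponents a.hi := ⟨-w, fun α hα => by simp [hw α hα]⟩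
  have hmem : ∀ i, mono p a e 1 * (f i : IntervalRing p A a) ∈ (restrict p A h).range := by
    intro i
    rw [coe_eq_sum_mono, Finset.mul_sum]
    refine sum_mem fun n hn => ?_
    refine ⟨mono p b ⟨w + n.1, fun α hα => ?_⟩ (LaurentPolynomials.coeff (f i) n), ?_⟩
    · by_cases ha : a.hi α = ⊤
      · simpa [hw α ha] using n.2 α ha
      · have h1 : w α = N := if_pos ⟨hα, ha⟩
        have h2 := hN i n hn α
        rw [Pi.add_apply, h1]
        omega
    · rw [restrict_mono, mono_mul, one_mul]
      rfl
  choose x hx using hmem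
  have hu : mono p a e (1 : A) * mono p a e' 1 = 1 := by
    rw [mono_mul, mul_one, ← mono_zero_one]
    congr 1
    ext β
    simp [e, e']
  refine ⟨mono p a e 1, mono p a e' 1, x, hu, fun i => ?_⟩
  rw [hx, ← mul_assoc, mul_comm (mono p a e' 1), hu, one_mul, norm_sub_rev]
  exact hf i

section Unit

variable [NormedAlgebra ℚ_[p] A]

/-- A function of the form `p^c T_α^d` whose absolute value is one on `t_α = τ`. -/
def separatingUnit (p : ℕ) [Fact p.Prime] (A : Type*) [NormedCommRing A] [IsUltrametricDist A]
    [NormedAlgebra ℚ_[p] A] (b : MultiInterval I) (α : I) (τ : ℚ) : IntervalRing p A b :=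
  constPow p A b (-τ.num) * coord p A b α ^ ((p - 1) * τ.den)

theorem restrict_separatingUnit {a b : MultiInterval I} (h : a ≤ b) (α : I) (τ : ℚ) :
    restrict p A h (separatingUnit p A b α τ) = separatingUnit p A a α τ := by
  rw [separatingUnit, map_mul, map_pow, restrict_coord, constPow, constHom_apply, restrict_mono]
  rfl

theorem radialFactor_pow_coe (τ : ℚ) :
    (radialFactor p τ 1 : ℝ) ^ ((p - 1) * τ.den) = (p : ℝ) ^ (-τ.num) := by
  have := congrArg ((↑) : ℝ≥0 → ℝ) (radialFactor_denominator p τ)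
  push_cast at this
  exact this

theorem separatingUnit_contracting {b : MultiInterval I} {α : I} {τ : ℚ} (h : τ < b.lo α) :
    ∃ r : ℝ, 0 ≤ r ∧ r < 1 ∧ ∀ x : IntervalRing p A b, ‖separatingUnit p A b α τ * x‖ ≤ r * ‖x‖ := by
  have hp0 : (0 : ℝ) < p := by exact_mod_cast hp.out.pos
  have hd : (p - 1) * τ.den ≠ 0 := by
    have := hp.out.one_lt
    exact Nat.mul_ne_zero (by omega) τ.den_ne_zero
  refine ⟨(p : ℝ) ^ τ.num * (radialFactor p (b.lo α) 1 : ℝ) ^ ((p - 1) * τ.den), by positivity, ?_,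
    fun x => ?_⟩
  · have h1 : (radialFactor p (b.lo α) 1 : ℝ) < radialFactor p τ 1 := by
      exact_mod_cast radialFactor_lt p h
    calc _ < (p : ℝ) ^ τ.num * (radialFactor p τ 1 : ℝ) ^ ((p - 1) * τ.den) := by
          gcongr
      _ = 1 := by
          rw [radialFactor_pow_coe, ← zpow_add₀ hp0.ne', add_neg_cancel, zpow_zero]
  · rw [separatingUnit, mul_assoc, norm_constPow_mul, neg_neg, mul_assoc]
    gcongr
    exact norm_coord_pow_mul_le α _ x

theorem separatingUnit_expanding {b : MultiInterval I} {α : I} {τ τ' : ℚ} (hb : b.hi α = τ')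
    (h : τ' < τ) :
    ∃ v, separatingUnit p A b α τ * v = 1 ∧
      ∃ r : ℝ, 0 ≤ r ∧ r < 1 ∧ ∀ x : IntervalRing p A b, ‖v * x‖ ≤ r * ‖x‖ := by
  have hp0 : (0 : ℝ) < p := by exact_mod_cast hp.out.pos
  have hd : (p - 1) * τ.den ≠ 0 := by
    have := hp.out.one_lt
    exact Nat.mul_ne_zero (by omega) τ.den_ne_zero
  have hne : b.hi α ≠ ⊤ := by rw [hb]; exact WithTop.coe_ne_top
  have h0 : (0 : ℝ) < radialFactor p τ 1 := by exact_mod_cast radialFactor_pos p τ 1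
  have h0' : (0 : ℝ) < radialFactor p τ' 1 := by exact_mod_cast radialFactor_pos p τ' 1
  refine ⟨constPow p A b τ.num * coordInv p A b α hne ^ ((p - 1) * τ.den), ?_,
    (p : ℝ) ^ (-τ.num) * ((radialFactor p τ' 1 : ℝ)⁻¹) ^ ((p - 1) * τ.den), by positivity, ?_,
    fun x => ?_⟩
  · have h1 := constPow_mul_neg (p := p) (A := A) b τ.num
    have h2 : coord p A b α ^ ((p - 1) * τ.den) * coordInv p A b α hne ^ ((p - 1) * τ.den) = 1 := by
      rw [← mul_pow, coord_mul_coordInv, one_pow]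
    rw [separatingUnit]
    linear_combination (coord p A b α ^ ((p - 1) * τ.den) *
      coordInv p A b α hne ^ ((p - 1) * τ.den)) * h1 + h2
  · have h1 : (radialFactor p τ 1 : ℝ) < radialFactor p τ' 1 := by
      exact_mod_cast radialFactor_lt p h
    calc _ < (p : ℝ) ^ (-τ.num) * ((radialFactor p τ 1 : ℝ)⁻¹) ^ ((p - 1) * τ.den) := by
          gcongr
      _ = 1 := by
          rw [inv_pow, radialFactor_pow_coe]
          exact mul_inv_cancel₀ (by positivity)
  · rw [mul_assoc, norm_constPow_mul, mul_assoc]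
    gcongr
    exact norm_coordInv_pow_mul_le hne hb _ x

end Unit

theorem restrict_comp {a b c : MultiInterval I} (h : a ≤ b) (h' : b ≤ c) :
    restrict p A (h.trans h') = (restrict p A h).comp (restrict p A h') :=
  RingHom.ext fun x => (restrict_restrict h h' x).symm

/-- The restriction maps are flat. -/
theorem flat_restrict (hR : ∀ b : MultiInterval I, HasBoundedGeneration (IntervalRing p A b))
    {a b : MultiInterval I} (h : a ≤ b) : (restrict p A h).Flat := by
  -- Induction on the number of end points that differ: moving one of them is a series extension,
  -- hence flat, and flat maps compose.
  obtain ⟨k, hk⟩ : ∃ k, (Finset.univ.filter fun α => a.lo α ≠ b.lo α).card +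
      (Finset.univ.filter fun α => a.hi α ≠ b.hi α).card = k := ⟨_, rfl⟩
  induction k using Nat.strong_induction_on generalizing b with
  | h k ih =>
    by_cases h1 : ∃ α, a.hi α ≠ b.hi α
    · obtain ⟨α, hα⟩ := h1
      have hlt : a.hi α < b.hi α := (h.2 α).lt_of_ne hα
      obtain ⟨τ, hτ⟩ := WithTop.ne_top_iff_exists.1 hlt.ne_top
      have hlo : b.lo α ≤ τ := by
        have := a.lo_le_hi α
        rw [← hτ] at this
        exact (h.1 α).trans (by exact_mod_cast this)
      obtain ⟨c, hc⟩ := exists_isOuterPart b α τ hlo (by rw [hτ]; exact h.2 α)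
      have hac : a ≤ c := by
        refine ⟨fun β => by rw [hc.lo]; exact h.1 β, fun β => ?_⟩
        by_cases hβ : β = α
        · subst hβ
          rw [hc.hi_self, hτ]
        · rw [hc.hi_ne β hβ]
          exact h.2 β
      rw [restrict_comp hac hc.subset]
      refine RingHom.Flat.comp ?_ (ih _ ?_ hac rfl)
      · exact (hc.isSeriesExtension (by rw [hτ]; exact hlt)).flat (Or.inr rfl) (hR b)
      · rw [← hk, hc.lo]
        refine Nat.add_lt_add_left (Finset.card_lt_card (Finset.ssubset_iff_of_subset ?_ |>.2
          ⟨α, by simpa using hα, by simp [hc.hi_self, hτ]⟩)) _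
        intro β hβ
        simp only [Finset.mem_filter, Finset.mem_univ, true_and] at hβ ⊢
        rcases eq_or_ne β α with rfl | hne
        · exact hα
        · rwa [← hc.hi_ne β hne]
    · by_cases h2 : ∃ α, a.lo α ≠ b.lo α
      · obtain ⟨α, hα⟩ := h2
        have hlt : b.lo α < a.lo α := (h.1 α).lt_of_ne hα.symm
        obtain ⟨c, hc⟩ := exists_isInnerPart b α (a.lo α) hlt.le ((a.lo_le_hi α).trans (h.2 α))
        have hac : a ≤ c := by
          refine ⟨fun β => ?_, fun β => by rw [hc.hi]; exact h.2 β⟩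
          by_cases hβ : β = α
          · subst hβ
            rw [hc.lo_self]
          · rw [hc.lo_ne β hβ]
            exact h.1 β
        rw [restrict_comp hac hc.subset]
        refine RingHom.Flat.comp ?_ (ih _ ?_ hac rfl)
        · exact (hc.isSeriesExtension hlt).flat (Or.inl rfl) (hR b)
        · rw [← hk, hc.hi]
          refine Nat.add_lt_add_right (Finset.card_lt_card (Finset.ssubset_iff_of_subset ?_ |>.2
            ⟨α, by simpa using hα, by simp [hc.lo_self]⟩)) _
          intro β hβ
          simp only [Finset.mem_filter, Finset.mem_univ, true_and] at hβ ⊢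
          rcases eq_or_ne β α with rfl | hne
          · exact hα
          · rwa [← hc.lo_ne β hne]
      · push Not at h1 h2
        obtain rfl : a = b := MultiInterval.ext (funext h2) (funext h1)
        have : restrict p A h = RingHom.id _ := RingHom.ext fun x => restrict_self x
        rw [this]
        exact RingHom.Flat.id _

end Restriction

/-! ### Base change along ring homomorphisms -/

section BaseChange

variable {R S : Type*} [CommRing R] [CommRing S] {f : R →+* S} {M N : Type*}
    [AddCommGroup M] [Module R M] [AddCommGroup N] [Module S N] {ρ : M →ₛₗ[f] N}

theorem InducesBaseChangeIso.span_range_eq_top (h : InducesBaseChangeIso ρ) :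
    Submodule.span S (Set.range ρ) = ⊤ := by
  let _ : Algebra R S := f.toAlgebra
  let _ : Module R N := Module.compHom N f
  have _ : IsScalarTower R S N := ⟨fun r s n => mul_smul (f r) s n⟩
  refine eq_top_iff.2 fun x _ => ?_
  exact IsBaseChange.inductionOn h x (fun x => x ∈ Submodule.span S (Set.range ρ)) (zero_mem _)
    (fun m => Submodule.subset_span ⟨m, rfl⟩) (fun s n hn => Submodule.smul_mem _ s hn)
    (fun _ _ => add_mem)

theorem InducesBaseChangeIso.exists_lift (h : InducesBaseChangeIso ρ) {Q : Type*} [AddCommGroup Q]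
    [Module S Q] (g : M →ₛₗ[f] Q) : ∃ g' : N →ₗ[S] Q, ∀ m, g' (ρ m) = g m := by
  let _ : Algebra R S := f.toAlgebra
  let _ : Module R N := Module.compHom N f
  have _ : IsScalarTower R S N := ⟨fun r s n => mul_smul (f r) s n⟩
  let _ : Module R Q := Module.compHom Q f
  have _ : IsScalarTower R S Q := ⟨fun r s n => mul_smul (f r) s n⟩
  exact ⟨IsBaseChange.lift h
    ({ toFun := g, map_add' := g.map_add, map_smul' := g.map_smulₛₗ } : M →ₗ[R] Q),
    fun m => IsBaseChange.lift_eq h _ m⟩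

theorem span_range_comp_eq_top (hρ : Submodule.span S (Set.range ρ) = ⊤) {ι : Type*} {e : ι → M}
    (he : Submodule.span R (Set.range e) = ⊤) : Submodule.span S (Set.range (ρ ∘ e)) = ⊤ := by
  rw [eq_top_iff, ← hρ, Submodule.span_le]
  rintro _ ⟨x, rfl⟩
  have hx : x ∈ Submodule.span R (Set.range e) := he ▸ Submodule.mem_top
  induction hx using Submodule.span_induction with
  | mem x hx =>
    obtain ⟨i, rfl⟩ := hx
    exact Submodule.subset_span ⟨i, rfl⟩
  | zero => rw [map_zero]; exact zero_mem _
  | add x y _ _ hx hy => rw [map_add]; exact add_mem hx hy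
  | smul r x _ hx => rw [map_smulₛₗ]; exact Submodule.smul_mem _ _ hx

/-- The relations after base change are spanned by the relations before. -/
theorem InducesBaseChangeIso.mem_span_relations (h : InducesBaseChangeIso ρ) {ι : Type*}
    [Fintype ι] {e : ι → M} (he : Submodule.span R (Set.range e) = ⊤) {y : ι → S}
    (hy : ∑ i, y i • ρ (e i) = 0) :
    y ∈ Submodule.span S ((fun c : ι → R => f ∘ c) '' {c | ∑ i, c i • e i = 0}) := by
  classical
  set W := Submodule.span S ((fun c : ι → R => f ∘ c) '' {c | ∑ i, c i • e i = 0}) with hW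
  choose c hc using fun x => exists_coeff_of_span_eq_top he x
  have hwd : ∀ a b : ι → R, ∑ i, a i • e i = ∑ i, b i • e i → W.mkQ (f ∘ a) = W.mkQ (f ∘ b) := by
    intro a b hab
    rw [← sub_eq_zero, ← map_sub]
    refine (Submodule.Quotient.mk_eq_zero _).2 (Submodule.subset_span ⟨a - b, ?_, ?_⟩)
    · change ∑ i, (a - b) i • e i = 0
      simp only [Pi.sub_apply, sub_smul, Finset.sum_sub_distrib, hab, sub_self]
    · ext i
      simp
  -- The class of a coefficient vector modulo `W` depends only on the element of `M` it represents.
  -- Extending this map to `N` by base change and applying it to the given relation shows that `y`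
  -- vanishes modulo `W`.
  let g : M →ₛₗ[f] ((ι → S) ⧸ W) :=
    { toFun := fun x => W.mkQ (f ∘ c x)
      map_add' := fun x y => by
        have h1 : f ∘ c x + f ∘ c y = f ∘ (c x + c y) := by ext; simp
        rw [← map_add, h1]
        refine hwd _ _ ?_
        rw [← hc]
        simp only [Pi.add_apply, add_smul, Finset.sum_add_distrib, ← hc]
      map_smul' := fun r x => by
        have h1 : f r • (f ∘ c x) = f ∘ (r • c x) := by ext; simp
        rw [← map_smul, h1]
        refine hwd _ _ ?_
        rw [← hc]
        simp only [Pi.smul_apply, smul_eq_mul, mul_smul, ← Finset.smul_sum, ← hc] }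
  obtain ⟨g', hg'⟩ := h.exists_lift g
  have h1 : ∀ i, g' (ρ (e i)) = W.mkQ (Pi.single i 1) := by
    intro i
    rw [hg']
    have h2 : (Pi.single i (1 : S) : ι → S) = f ∘ (Pi.single i (1 : R)) := by
      ext j
      by_cases hj : j = i
      · subst hj; simp
      · simp [hj]
    rw [h2]
    refine hwd _ _ ?_
    rw [← hc]
    simp [Pi.single_apply]
  have h2 := congrArg g' hy
  rw [map_sum, map_zero] at h2
  simp only [map_smul, h1] at h2
  simp only [← map_smul, ← map_sum] at h2
  have h3 : ∑ i, y i • (Pi.single i (1 : S) : ι → S) = y := by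
    ext j
    simp [Finset.sum_apply, Pi.single_apply]
  rw [h3] at h2
  exact (Submodule.Quotient.mk_eq_zero _).1 h2

/-- Kernels of presentations commute with flat base change. -/
theorem InducesBaseChangeIso.ker (h : InducesBaseChangeIso ρ) (hf : f.Flat) {ι : Type*} [Finite ι]
    (g : (ι → R) →ₗ[R] M) (g' : (ι → S) →ₗ[S] N) (hg : ∀ c, ρ (g c) = g' (f ∘ c))
    (τ : LinearMap.ker g →ₛₗ[f] LinearMap.ker g') (hτ : ∀ x, (τ x : ι → S) = f ∘ (x : ι → R)) :
    InducesBaseChangeIso τ := by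
  let _ : Algebra R S := f.toAlgebra
  let _ : Module R N := Module.compHom N f
  have _ : IsScalarTower R S N := ⟨fun r s n => mul_smul (f r) s n⟩
  have hfl : Module.Flat R S := hf
  let _ : Module R (LinearMap.ker g') := Module.compHom _ f
  have _ : IsScalarTower R S (LinearMap.ker g') := ⟨fun r s n => mul_smul (f r) s n⟩
  refine IsBaseChange.of_left_exact S _ ((Algebra.linearMap R S).compLeft ι) _
    (f := (LinearMap.ker g).subtype) (g := g) (f' := (LinearMap.ker g').subtype) (g' := g')
    ?_ ?_ (IsBaseChange.finitePow ι (IsBaseChange.linearMap R S)) h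
    (LinearMap.exact_subtype_ker_map g) (Submodule.subtype_injective _)
    (LinearMap.exact_subtype_ker_map g') (Submodule.subtype_injective _)
  · ext x
    exact (congrFun (hτ x) _).symm
  · exact LinearMap.ext fun c => hg c

end BaseChange

/-! ### Generators of coherent sheaves -/

section Generators

variable {I : Type*} [Fintype I] [DecidableEq I] {p : ℕ} [hp : Fact p.Prime]
  {A : Type*} [NormedCommRing A] [IsUltrametricDist A] {r₀ : I → WithTop ℚ}

namespace CoherentSheaf

variable (F : CoherentSheaf p A r₀)

theorem span_range_res {a b : Below r₀} (h : a ≤ b) :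
    Submodule.span (IntervalRing p A a.1) (Set.range (F.res h)) = ⊤ :=
  (F.baseChange h).span_range_eq_top

/-- The restrictions of the sections in `X` generate the sections over `b`. -/
def Generates {K : Below r₀} (X : Set (F.sec K)) (b : Below r₀) : Prop :=
  ∃ h : b ≤ K, Submodule.span (IntervalRing p A b.1) (F.res h '' X) = ⊤

variable {F}

theorem Generates.mono {K b c : Below r₀} {X : Set (F.sec K)} (h : F.Generates X b) (hcb : c ≤ b) :
    F.Generates X c := by
  obtain ⟨hb, h⟩ := h
  refine ⟨hcb.trans hb, ?_⟩
  have h1 := span_range_comp_eq_top (F.span_range_res hcb) (e := fun x : X => F.res hb x) (by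
    rwa [← Set.image_eq_range])
  rw [← h1]
  congr 1
  ext y
  constructor
  · rintro ⟨x, hx, rfl⟩
    exact ⟨⟨x, hx⟩, F.res_res _ _ _⟩
  · rintro ⟨x, rfl⟩
    exact ⟨x, x.2, (F.res_res _ _ _).symm⟩

theorem Generates.superset {K b : Below r₀} {X Y : Set (F.sec K)} (h : F.Generates X b)
    (hXY : X ⊆ Y) : F.Generates Y b := by
  obtain ⟨hb, h⟩ := h
  exact ⟨hb, eq_top_iff.2 (h ▸ Submodule.span_mono (Set.image_mono hXY))⟩

theorem generates_self_iff {K : Below r₀} {X : Set (F.sec K)} :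
    F.Generates X K ↔ Submodule.span (IntervalRing p A K.1) X = ⊤ := by
  have : F.res (le_refl K) '' X = X := by
    ext x
    simp [F.res_self]
  constructor
  · rintro ⟨_, h⟩
    rwa [this] at h
  · intro h
    exact ⟨le_rfl, by rwa [this]⟩

theorem Generates.of_restrict {K b c : Below r₀} {X : Set (F.sec K)} (hb : b ≤ K)
    (h : F.Generates (F.res hb '' X) c) : F.Generates X c := by
  obtain ⟨hc, h⟩ := h
  refine ⟨hc.trans hb, ?_⟩
  rw [← h, Set.image_image]
  simp only [F.res_res]

theorem Generates.restrict {K b c : Below r₀} {X : Set (F.sec K)} (hb : b ≤ K) (hc : c ≤ b)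
    (h : F.Generates X c) : F.Generates (F.res hb '' X) c := by
  obtain ⟨_, h⟩ := h
  refine ⟨hc, ?_⟩
  rw [← h, Set.image_image]
  simp only [F.res_res]

theorem Generates.exists_coeff {K b : Below r₀} {ι : Type*} [Fintype ι] {g : ι → F.sec K}
    (h : F.Generates (Set.range g) b) (hb : b ≤ K) (x : F.sec b) :
    ∃ c : ι → IntervalRing p A b.1, x = ∑ i, c i • F.res hb (g i) := by
  obtain ⟨_, h⟩ := h
  refine exists_coeff_of_span_eq_top (e := fun i => F.res hb (g i)) ?_ x
  rw [← h, ← Set.range_comp]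
  rfl

theorem generates_range {K b : Below r₀} {ι : Type*} {g : ι → F.sec K} (hb : b ≤ K)
    (h : Submodule.span (IntervalRing p A b.1) (Set.range fun i => F.res hb (g i)) = ⊤) :
    F.Generates (Set.range g) b :=
  ⟨hb, by rw [← h, ← Set.range_comp]; rfl⟩

/-- Generation can be checked on the two parts of a multi-interval. -/
theorem span_eq_top_of_parts {K a₁ a₂ : Below r₀} {α : I} {τ : ℚ} (h₁ : IsOuterPart α τ a₁.1 K.1)
    (h₂ : IsInnerPart α τ a₂.1 K.1) (hlo : K.1.lo α < τ) (hhi : (τ : WithTop ℚ) < K.1.hi α)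
    {X : Set (F.sec K)} (hX₁ : F.Generates X a₁) (hX₂ : F.Generates X a₂) :
    Submodule.span (IntervalRing p A K.1) X = ⊤ := by
  have := F.finite K
  obtain ⟨N, e, he⟩ := Module.Finite.exists_fin (R := IntervalRing p A K.1) (M := F.sec K)
  let π : (Fin N → IntervalRing p A K.1) →ₗ[IntervalRing p A K.1] F.sec K :=
    Fintype.linearCombination _ e
  have hπ : ∀ c, π c = ∑ i, c i • e i := fun c => rfl
  -- Pulled back to a free module, the claim falls under the covering lemma for submodules of `R ^
  -- N`. On each part, `P` spans everything because it contains all relations over `K`, and these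
  -- span the relations after base change.
  set P := (Submodule.span (IntervalRing p A K.1) X).comap π with hP
  have key : ∀ a : Below r₀, ∀ ha : a.1 ≤ K.1, F.Generates X a →
      Submodule.span (IntervalRing p A a.1)
        ((fun y : Fin N → IntervalRing p A K.1 => restrict p A ha ∘ y) '' P) = ⊤ := by
    intro a ha ⟨_, hXa⟩
    have haK : a ≤ K := ha
    refine eq_top_iff.2 fun y _ => ?_
    set W := Submodule.span (IntervalRing p A a.1)
        ((fun y : Fin N → IntervalRing p A K.1 => restrict p A ha ∘ y) '' P) with hW
    have h1 : ∀ x ∈ Submodule.span (IntervalRing p A a.1) (F.res haK '' X), ∃ w ∈ W,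
        ∑ i, w i • F.res haK (e i) = x := by
      intro x hx
      induction hx using Submodule.span_induction with
      | mem x hx =>
        obtain ⟨x, hx, rfl⟩ := hx
        obtain ⟨c, hc⟩ := exists_coeff_of_span_eq_top he x
        refine ⟨restrict p A ha ∘ c, Submodule.subset_span ⟨c, ?_, rfl⟩, ?_⟩
        · change π c ∈ Submodule.span (IntervalRing p A K.1) X
          rw [hπ, ← hc]
          exact Submodule.subset_span hx
        · rw [hc, map_sum]
          simp only [map_smulₛₗ]
          rfl
      | zero => exact ⟨0, zero_mem _, by simp⟩
      | add x y _ _ hx hy =>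
        obtain ⟨w, hw, rfl⟩ := hx
        obtain ⟨w', hw', rfl⟩ := hy
        exact ⟨w + w', add_mem hw hw', by simp [add_smul, Finset.sum_add_distrib]⟩
      | smul r x _ hx =>
        obtain ⟨w, hw, rfl⟩ := hx
        exact ⟨r • w, Submodule.smul_mem _ r hw, by simp [mul_smul, Finset.smul_sum]⟩
    obtain ⟨w, hw, hwy⟩ := h1 (∑ i, y i • F.res haK (e i)) (hXa ▸ Submodule.mem_top)
    have h2 : ∑ i, (y - w) i • F.res haK (e i) = 0 := by
      simp [sub_smul, Finset.sum_sub_distrib, hwy]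
    have h3 := (F.baseChange haK).mem_span_relations he h2
    have h4 : y - w ∈ W := by
      refine Submodule.span_mono (Set.image_mono fun c hc => ?_) h3
      change π c ∈ Submodule.span (IntervalRing p A K.1) X
      have : π c = 0 := hc
      rw [this]
      exact zero_mem _
    have h5 := add_mem h4 hw
    rwa [sub_add_cancel] at h5
  have hρ : (radialFactor p τ 1 : ℝ)⁻¹ * radialFactor p τ 1 = 1 :=
    inv_mul_cancel₀ (by exact_mod_cast (radialFactor_pos p τ 1).ne')
  have hPt : P = ⊤ := eq_top_of_span_eq_top_of_cover (h₁.isSeriesExtension hhi)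
    (h₂.isSeriesExtension hlo) hρ P (key a₁ h₁.subset hX₁) (key a₂ h₂.subset hX₂)
  refine eq_top_iff.2 fun x _ => ?_
  obtain ⟨c, hc⟩ := exists_coeff_of_span_eq_top he x
  have : c ∈ P := hPt ▸ Submodule.mem_top
  rw [hc]
  exact this

theorem Generates.of_parts {L K a₁ a₂ : Below r₀} {α : I} {τ : ℚ} (hK : K ≤ L)
    (h₁ : IsOuterPart α τ a₁.1 K.1)
    (h₂ : IsInnerPart α τ a₂.1 K.1) (hlo : K.1.lo α < τ) (hhi : (τ : WithTop ℚ) < K.1.hi α)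
    {X : Set (F.sec L)} (hX₁ : F.Generates X a₁) (hX₂ : F.Generates X a₂) : F.Generates X K :=
  Generates.of_restrict hK (generates_self_iff.2
    (span_eq_top_of_parts h₁ h₂ hlo hhi (hX₁.restrict hK h₁.subset) (hX₂.restrict hK h₂.subset)))

variable (F)

/-- The sections over `b` are generated by `n` elements. -/
def NGen (b : Below r₀) (n : ℕ) : Prop :=
  ∃ g : Fin n → F.sec b, Submodule.span (IntervalRing p A b.1) (Set.range g) = ⊤

variable {F}

theorem isNGenerated_iff {R M : Type*} [CommRing R] [AddCommGroup M] [Module R M] {n : ℕ} :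
    IsNGenerated R M n ↔ ∃ g : Fin n → M, Submodule.span R (Set.range g) = ⊤ := by
  constructor
  · rintro ⟨g, hg⟩
    refine ⟨fun i => g (Pi.single i 1), eq_top_iff.2 fun x _ => ?_⟩
    obtain ⟨c, rfl⟩ := hg x
    have : c = ∑ i, c i • (Pi.single i (1 : R) : Fin n → R) := by
      ext j
      simp [Finset.sum_apply, Pi.single_apply]
    rw [this, map_sum]
    refine sum_mem fun i _ => ?_
    rw [map_smul]
    exact Submodule.smul_mem _ _ (Submodule.subset_span ⟨i, rfl⟩)
  · rintro ⟨g, hg⟩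
    refine ⟨Fintype.linearCombination R g, fun x => ?_⟩
    obtain ⟨c, rfl⟩ := exists_coeff_of_span_eq_top hg x
    exact ⟨c, rfl⟩

theorem NGen.mono {a b : Below r₀} {n : ℕ} (h : F.NGen b n) (hab : a ≤ b) : F.NGen a n := by
  obtain ⟨g, hg⟩ := h
  exact ⟨F.res hab ∘ g, span_range_comp_eq_top (F.span_range_res hab) hg⟩

/-- Generators over a smaller multi-interval can be chosen to extend. -/
theorem exists_extendable_generators {K b : Below r₀} (hb : b ≤ K) {n : ℕ} (h : F.NGen b n) :
    ∃ f : Fin n → F.sec K, F.Generates (Set.range f) b := by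
  obtain ⟨g, hg⟩ := h
  have := F.finite K
  obtain ⟨N, e, he⟩ := Module.Finite.exists_fin (R := IntervalRing p A K.1) (M := F.sec K)
  have he' := span_range_comp_eq_top (F.span_range_res hb) he
  choose y hy using fun i => exists_coeff_of_span_eq_top he' (g i)
  choose c hc using fun k => exists_coeff_of_span_eq_top hg (F.res hb (e k))
  set C : ℝ := ∑ k, ∑ j, ‖c k j‖ with hC
  have hC0 : 0 ≤ C := by positivity
  obtain ⟨u, v, x, huv, hx⟩ := exists_unit_approx (p := p) (A := A) (show b.1 ≤ K.1 from hb)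
    (fun i : Fin n × Fin N => y i.1 i.2) (ε := 1 / ((C + 1) * (n + 1))) (by positivity)
  refine ⟨fun i => ∑ k, x (i, k) • e k, generates_range hb ?_⟩
  -- Only the multiples `v • f` approximate `g`. Their span lies in that of `f`, which is enough.
  have hspan : Submodule.span (IntervalRing p A b.1)
      (Set.range fun i => v • F.res hb (∑ k, x (i, k) • e k)) = ⊤ := by
    refine span_eq_top_of_perturb g _ hg
      (fun i j => ∑ k, (v * restrict p A hb (x (i, k)) - y i k) * c k j) (fun i j => ?_) fun i => ?_
    · rw [Fintype.card_fin]
      have h1 : ‖∑ k, (v * restrict p A hb (x (i, k)) - y i k) * c k j‖ ≤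
          1 / ((C + 1) * (n + 1)) * C := by
        refine (norm_sum_le _ _).trans ?_
        rw [hC, Finset.mul_sum]
        refine Finset.sum_le_sum fun k _ => (norm_mul_le _ _).trans ?_
        refine mul_le_mul (hx (i, k)).le (Finset.single_le_sum (f := fun j => ‖c k j‖)
          (fun _ _ => norm_nonneg _) (Finset.mem_univ j)) (norm_nonneg _) (by positivity)
      calc _ ≤ 1 / ((C + 1) * (n + 1)) * C * (n + 1) := by gcongr
        _ = C / (C + 1) := by field_simp
        _ ≤ 1 := by rw [div_le_one (by positivity)]; linarith
    · simp only [Finset.sum_smul, mul_smul]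
      rw [Finset.sum_comm]
      simp only [← Finset.smul_sum, ← hc]
      conv_rhs => rw [hy i]
      rw [← Finset.sum_add_distrib, map_sum, Finset.smul_sum]
      refine Finset.sum_congr rfl fun k _ => ?_
      rw [map_smulₛₗ, Function.comp_apply, ← add_smul, ← mul_smul]
      congr 1
      ring
  rw [eq_top_iff, ← hspan, Submodule.span_le]
  rintro _ ⟨i, rfl⟩
  exact Submodule.smul_mem _ _ (Submodule.subset_span ⟨i, rfl⟩)

variable [NormedAlgebra ℚ_[p] A]

/-- Tuples of generators over separated multi-intervals can be combined. -/
theorem exists_combined_generators {K B : Below r₀} {α : I} {τ σ : ℚ} (hB : B.1.hi α = τ)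
    (hτσ : τ < σ) {n : ℕ} (f g : Fin n → F.sec K) (hg : F.Generates (Set.range g) B)
    {J : Set (Below r₀)} (hJ : J.Finite) (hJσ : ∀ b ∈ J, σ ≤ b.1.lo α)
    (hJf : ∀ b ∈ J, F.Generates (Set.range f) b) :
    ∃ f' : Fin n → F.sec K, F.Generates (Set.range f') B ∧
      ∀ b ∈ J, F.Generates (Set.range f') b := by
  obtain ⟨τ₀, h0, h1⟩ := exists_between hτσ
  have hsmall : ∀ r : ℝ, 0 ≤ r → r < 1 → ∀ C : ℝ, ∀ᶠ L : ℕ in atTop, r ^ L * C * (n + 1) ≤ 1 := by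
    intro r hr0 hr1 C
    have := ((tendsto_pow_atTop_nhds_zero_of_lt_one hr0 hr1).mul_const C).mul_const ((n : ℝ) + 1)
    rw [zero_mul, zero_mul] at this
    exact this.eventually_le_const one_pos
  have hpow : ∀ {b : MultiInterval I} {v : IntervalRing p A b} {r : ℝ}, 0 ≤ r →
      (∀ x, ‖v * x‖ ≤ r * ‖x‖) → ∀ (L : ℕ) x, ‖v ^ L * x‖ ≤ r ^ L * ‖x‖ := by
    intro b v r hr hv L x
    induction L with
    | zero => simp
    | succ L ih =>
      rw [pow_succ', mul_assoc, pow_succ', mul_assoc]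
      exact (hv _).trans (by gcongr)
  -- The cut `τ₀` lies in the gap. High powers of `U` are small on the members of `J`, where `f + U
  -- ^ L g` is a perturbation of `f`. On `B` the inverse of `U` is small, and after division by `U ^
  -- L` the tuple is a perturbation of `g`.
  set U := separatingUnit p A K.1 α τ₀ with hU
  have hev₁ : ∀ b ∈ J, ∀ᶠ L : ℕ in atTop,
      F.Generates (Set.range fun i => f i + U ^ L • g i) b := by
    intro b hb
    obtain ⟨hbK, hspan⟩ := hJf b hb
    choose c hc using fun i => (hJf b hb).exists_coeff hbK (F.res hbK (g i))
    obtain ⟨r, hr0, hr1, hr⟩ := separatingUnit_contracting (p := p) (A := A)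
      (h1.trans_le (hJσ b hb))
    filter_upwards [hsmall r hr0 hr1 (∑ i, ∑ j, ‖c i j‖)] with L hL
    refine generates_range hbK (span_eq_top_of_perturb (fun i => F.res hbK (f i)) _
      (by rw [← hspan, ← Set.range_comp]; rfl)
      (fun i j => separatingUnit p A b.1 α τ₀ ^ L * c i j) (fun i j => ?_) fun i => ?_)
    · rw [Fintype.card_fin]
      refine le_trans ?_ hL
      gcongr
      refine (hpow hr0 hr L _).trans ?_
      gcongr
      exact (Finset.single_le_sum (f := fun j => ‖c i j‖)
        (fun _ _ => norm_nonneg _) (Finset.mem_univ j)).trans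
        (Finset.single_le_sum (f := fun i => ∑ j, ‖c i j‖)
        (fun _ _ => Finset.sum_nonneg fun _ _ => norm_nonneg _) (Finset.mem_univ i))
    · simp only [mul_smul]
      rw [← Finset.smul_sum, ← hc, map_add, map_smulₛₗ, map_pow, hU, restrict_separatingUnit]
  have hev₂ : ∀ᶠ L : ℕ in atTop, F.Generates (Set.range fun i => f i + U ^ L • g i) B := by
    obtain ⟨hBK, hspan⟩ := hg
    choose c hc using fun i => Generates.exists_coeff ⟨hBK, hspan⟩ hBK (F.res hBK (f i))
    obtain ⟨v, huv, r, hr0, hr1, hr⟩ := separatingUnit_expanding (p := p) (A := A) hB h0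
    filter_upwards [hsmall r hr0 hr1 (∑ i, ∑ j, ‖c i j‖)] with L hL
    refine generates_range hBK ?_
    have h2 := span_eq_top_of_perturb (fun i => F.res hBK (g i))
      (fun i => v ^ L • F.res hBK (f i + U ^ L • g i))
      (by rw [← hspan, ← Set.range_comp]; rfl) (fun i j => v ^ L * c i j) (fun i j => ?_) fun i => ?_
    · rw [eq_top_iff, ← h2, Submodule.span_le]
      rintro _ ⟨i, rfl⟩
      exact Submodule.smul_mem _ _ (Submodule.subset_span ⟨i, rfl⟩)
    · rw [Fintype.card_fin]
      refine le_trans ?_ hL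
      gcongr
      refine (hpow hr0 hr L _).trans ?_
      gcongr
      exact (Finset.single_le_sum (f := fun j => ‖c i j‖)
        (fun _ _ => norm_nonneg _) (Finset.mem_univ j)).trans
        (Finset.single_le_sum (f := fun i => ∑ j, ‖c i j‖)
        (fun _ _ => Finset.sum_nonneg fun _ _ => norm_nonneg _) (Finset.mem_univ i))
    · simp only [mul_smul]
      rw [← Finset.smul_sum, ← hc, map_add, map_smulₛₗ, map_pow, hU, restrict_separatingUnit,
        smul_add, smul_smul, ← mul_pow, mul_comm v, huv, one_pow, one_smul, add_comm]
  obtain ⟨L, hL₁, hL₂⟩ := (((eventually_all_finite hJ).2 hev₁).and hev₂).exists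
  exact ⟨_, hL₂, hL₁⟩

end CoherentSheaf

end Generators

/-! ### Uniform generation over multi-intervals covered by an admissible covering -/

section Cells

/-- No element of `E` lies strictly between the end points in direction `α`. -/
def MultiInterval.IsCell {I : Type*} (E : Finset ℚ) (α : I) (b : MultiInterval I) : Prop :=
  ∀ e ∈ E, b.lo α < e → ¬ (e : WithTop ℚ) < b.hi α

variable {I : Type*} [Fintype I] [DecidableEq I] {p : ℕ} [hp : Fact p.Prime]
  {A : Type*} [NormedCommRing A] [IsUltrametricDist A] {r₀ : I → WithTop ℚ}
  [NormedAlgebra ℚ_[p] A] {F : CoherentSheaf p A r₀}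

namespace CoherentSheaf

/-- The inductive step in the construction of generators over a multi-interval from generators over
its cells in direction `α`. -/
theorem exists_generators_of_cells {K : Below r₀} {α : I} {E : Finset ℚ} {n : ℕ}
    (hcell : ∀ B : Below r₀, B ≤ K → (∀ β ≠ α, B.1.lo β = K.1.lo β ∧ B.1.hi β = K.1.hi β) →
      B.1.IsCell E α → F.NGen B n) (m : ℕ) :
    ∀ (τ : ℚ) (K' : Below r₀), IsInnerPart α τ K'.1 K.1 →
      (E.filter fun e => τ < e ∧ (e : WithTop ℚ) < K.1.hi α).card = m →
      ∃ (f₁ f₂ : Fin n → F.sec K) (J₁ J₂ : Set (Below r₀)) (σ : ℚ), J₁.Finite ∧ J₂.Finite ∧ τ < σ ∧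
        (∀ b ∈ J₁, τ ≤ b.1.lo α) ∧ (∀ b ∈ J₁, F.Generates (Set.range f₁) b) ∧
        (∀ b ∈ J₂, σ ≤ b.1.lo α) ∧ (∀ b ∈ J₂, F.Generates (Set.range f₂) b) ∧
        ∀ X : Set (F.sec K), (∀ b ∈ J₁, F.Generates X b) → (∀ b ∈ J₂, F.Generates X b) →
          F.Generates X K' := by
  induction m using Nat.strong_induction_on with
  | h m ih =>
    intro τ K' hK' hm
    rcases (E.filter fun e => τ < e ∧ (e : WithTop ℚ) < K.1.hi α).eq_empty_or_nonempty with
      hempty | hne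
    · have hc : K'.1.IsCell E α := by
        intro e he h1 h2
        rw [hK'.lo_self] at h1
        rw [hK'.hi] at h2
        have : e ∈ E.filter fun e => τ < e ∧ (e : WithTop ℚ) < K.1.hi α :=
          Finset.mem_filter.2 ⟨he, h1, h2⟩
        rw [hempty] at this
        exact absurd this (Finset.notMem_empty _)
      obtain ⟨f, hf⟩ := exists_extendable_generators (F := F) (K := K) (b := K') hK'.subset
        (hcell K' hK'.subset (fun β hβ => ⟨hK'.lo_ne β hβ, by rw [hK'.hi]⟩) hc)
      -- A single cell remains: the second family is empty and its separation point is arbitrary.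
      refine ⟨f, 0, {K'}, ∅, τ + 1, Set.finite_singleton _, Set.finite_empty, by linarith, ?_, ?_,
        by simp, by simp, fun X hX _ => hX K' rfl⟩
      · rintro _ rfl
        rw [hK'.lo_self]
      · rintro _ rfl
        exact hf
    -- Cutting at the first grid point splits off one cell `B`; the induction hypothesis treats the
    -- rest.
    · set τ' := (E.filter fun e => τ < e ∧ (e : WithTop ℚ) < K.1.hi α).min' hne with hτ'
      have hmem := Finset.min'_mem _ hne
      rw [← hτ', Finset.mem_filter] at hmem
      obtain ⟨hE, hlt, hhi⟩ := hmem
      obtain ⟨c, hc⟩ := exists_isInnerPart K.1 α τ' (hK'.le.trans hlt.le) hhi.le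
      let K₁ : Below r₀ := ⟨c, fun β => by rw [hc.hi]; exact K.2 β⟩
      have hcard : (E.filter fun e => τ' < e ∧ (e : WithTop ℚ) < K.1.hi α).card < m := by
        rw [← hm]
        refine Finset.card_lt_card ((Finset.ssubset_iff_of_subset ?_).2 ⟨τ', ?_, ?_⟩)
        · intro e he
          rw [Finset.mem_filter] at he ⊢
          exact ⟨he.1, hlt.trans he.2.1, he.2.2⟩
        · exact Finset.mem_filter.2 ⟨hE, hlt, hhi⟩
        · simp
      obtain ⟨f₁, f₂, J₁, J₂, σ, hJ₁, hJ₂, hσ, hlo₁, hf₁, hlo₂, hf₂, hcov⟩ :=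
        ih _ hcard τ' K₁ hc rfl
      obtain ⟨d, hd⟩ := exists_isOuterPart K'.1 α τ' (by rw [hK'.lo_self]; exact hlt.le)
        (by rw [hK'.hi]; exact hhi.le)
      let B : Below r₀ := ⟨d, fun β => (hd.subset.2 β).trans (K'.2 β)⟩
      have hBK : B ≤ K := (show B ≤ K' from hd.subset).trans hK'.subset
      have hBcell : B.1.IsCell E α := by
        intro e he h1 h2
        have h1' : τ < e := by
          have h3 : d.lo α < e := h1
          rwa [hd.lo, hK'.lo_self] at h3
        have h2' : e < τ' := by
          have h3 : (e : WithTop ℚ) < d.hi α := h2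
          rw [hd.hi_self] at h3
          exact_mod_cast h3
        refine absurd h2' (not_lt.2 (Finset.min'_le _ _ (Finset.mem_filter.2 ⟨he, h1', ?_⟩)))
        exact lt_trans (by exact_mod_cast h2') hhi
      obtain ⟨g, hg⟩ := exists_extendable_generators (F := F) hBK (hcell B hBK (fun β hβ => ⟨by
        change d.lo β = _
        rw [hd.lo, hK'.lo_ne β hβ], by
        change d.hi β = _
        rw [hd.hi_ne β hβ, hK'.hi]⟩) hBcell)
      obtain ⟨f, hfB, hfJ⟩ := exists_combined_generators (F := F) (B := B) hd.hi_self hσ f₂ g hg hJ₂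
        hlo₂ hf₂
      -- The cell `B` may touch members of `J₁` but is separated from those of `J₂`, so it joins the
      -- second family. The families then exchange roles, and two tuples suffice for any number of
      -- cells.
      refine ⟨f, f₁, insert B J₂, J₁, τ', hJ₂.insert B, hJ₁, hlt, ?_, ?_, hlo₁, hf₁, ?_⟩
      · rintro b (rfl | hb)
        · change τ ≤ d.lo α
          rw [hd.lo, hK'.lo_self]
        · exact (hlt.trans hσ).le.trans (hlo₂ b hb)
      · rintro b (rfl | hb)
        · exact hfB
        · exact hfJ b hb
      · intro X hX₁ hX₂
        have hin : IsInnerPart α τ' K₁.1 K'.1 := by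
          refine ⟨hc.hi.trans hK'.hi.symm, hc.lo_self, fun β hβ => ?_, ?_⟩
          · change c.lo β = _
            rw [hc.lo_ne β hβ, hK'.lo_ne β hβ]
          · rw [hK'.lo_self]
            exact hlt.le
        refine Generates.of_parts (K := K') (a₁ := B) (a₂ := K₁) hK'.subset hd hin ?_ ?_
          (hX₁ B (Set.mem_insert _ _))
          (hcov X hX₂ fun b hb => hX₁ b (Set.mem_insert_of_mem _ hb))
        · rw [hK'.lo_self]
          exact hlt
        · rw [hK'.hi]
          exact hhi

theorem nGen_of_cells {K : Below r₀} {α : I} {E : Finset ℚ} {n : ℕ}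
    (hcell : ∀ B : Below r₀, B ≤ K → (∀ β ≠ α, B.1.lo β = K.1.lo β ∧ B.1.hi β = K.1.hi β) →
      B.1.IsCell E α → F.NGen B n) : F.NGen K (n + n) := by
  have hK : IsInnerPart α (K.1.lo α) K.1 K.1 := ⟨rfl, rfl, fun _ _ => rfl, le_rfl⟩
  obtain ⟨f₁, f₂, J₁, J₂, σ, -, -, -, -, hf₁, -, hf₂, h⟩ :=
    exists_generators_of_cells hcell _ _ K hK rfl
  have h1 := generates_self_iff.1 (h (Set.range f₁ ∪ Set.range f₂)
    (fun b hb => (hf₁ b hb).superset Set.subset_union_left)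
    (fun b hb => (hf₂ b hb).superset Set.subset_union_right))
  refine ⟨Sum.elim f₁ f₂ ∘ finSumFinEquiv.symm, ?_⟩
  rw [Set.range_comp, Equiv.range_eq_univ, Set.image_univ, Set.Sum.elim_range]
  exact h1

/-- Directions are cut one at a time, each doubling the number of generators regardless of how fine
the grid is. The final bound therefore depends only on `n` and the number of directions. -/
theorem nGen_of_grid {K₀ : Below r₀} {E : I → Finset ℚ} {n : ℕ}
    (hcell : ∀ B : Below r₀, B ≤ K₀ → (∀ α, B.1.IsCell (E α) α) → F.NGen B n) (D : Finset I) :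
    ∀ K : Below r₀, K ≤ K₀ → (∀ α ∉ D, K.1.IsCell (E α) α) → F.NGen K (2 ^ D.card * n) := by
  induction D using Finset.induction_on with
  | empty =>
    intro K hK h
    simpa using hcell K hK fun α => h α (Finset.notMem_empty α)
  | insert α D hα ih =>
    intro K hK h
    have h1 : 2 ^ (insert α D).card * n = 2 ^ D.card * n + 2 ^ D.card * n := by
      rw [Finset.card_insert_of_notMem hα, pow_succ]
      ring
    rw [h1]
    refine nGen_of_cells (α := α) (E := E α) fun B hB hne hc => ih B (hB.trans hK) fun β hβ => ?_
    by_cases hβα : β = α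
    · subst hβα
      exact hc
    · intro e he h2 h3
      rw [(hne β hβα).1] at h2
      rw [(hne β hβα).2] at h3
      exact h β (by simp [hβα, hβ]) e he h2 h3

end CoherentSheaf

end Cells

/-! ### Compactness and admissible coverings -/

section Coverings

variable {I : Type*} {r₀ : I → WithTop ℚ}

theorem ofReal_le_radiusToENNReal {q : ℚ} {r : WithTop ℚ} (hq : 0 < q) :
    ENNReal.ofReal (q : ℝ) ≤ radiusToENNReal r ↔ (q : WithTop ℚ) ≤ r := by
  cases r with
  | top => simp [radiusToENNReal]
  | coe r =>
    simp only [radiusToENNReal]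
    rw [WithTop.coe_le_coe]
    rcases le_or_gt 0 r with hr | hr
    · rw [ENNReal.ofReal_le_ofReal_iff (by exact_mod_cast hr)]
      exact_mod_cast Iff.rfl
    · have h1 : ENNReal.ofReal (r : ℝ) = 0 := ENNReal.ofReal_of_nonpos (by exact_mod_cast hr.le)
      have h2 : 0 < ENNReal.ofReal (q : ℝ) := ENNReal.ofReal_pos.2 (by exact_mod_cast hq)
      rw [h1]
      exact ⟨fun h => absurd h (not_le.2 h2), fun h => absurd (hq.le.trans h) (not_le.2 hr)⟩

theorem ofReal_le_ofReal_rat {q q' : ℚ} (hq : 0 < q') :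
    ENNReal.ofReal (q : ℝ) ≤ ENNReal.ofReal (q' : ℝ) ↔ q ≤ q' := by
  rw [ENNReal.ofReal_le_ofReal_iff (by exact_mod_cast hq.le)]
  exact_mod_cast Iff.rfl

theorem radiusToENNReal_mono {r s : WithTop ℚ} (h : r ≤ s) :
    radiusToENNReal r ≤ radiusToENNReal s := by
  cases s with
  | top => simp [radiusToENNReal]
  | coe s =>
    cases r with
    | top => exact absurd h (by simp)
    | coe r =>
      have : (r : ℝ) ≤ s := by exact_mod_cast WithTop.coe_le_coe.1 h
      exact ENNReal.ofReal_le_ofReal this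

theorem MultiInterval.carrier_mono {a b : MultiInterval I} (h : a ≤ b) : a.carrier ⊆ b.carrier :=
  fun _ ht α => ⟨(ENNReal.ofReal_le_ofReal (by exact_mod_cast h.1 α)).trans (ht α).1,
    (ht α).2.trans (radiusToENNReal_mono (h.2 α))⟩

theorem carrier_subset_radiiSpace (b : Below r₀) : b.1.carrier ⊆ radiiSpace r₀ :=
  fun _ ht α => ⟨(ENNReal.ofReal_pos.2 (by exact_mod_cast b.1.lo_pos α)).trans_le (ht α).1,
    (ht α).2.trans (radiusToENNReal_mono (b.2 α))⟩

theorem MultiInterval.isCompact_carrier (b : MultiInterval I) : IsCompact b.carrier := by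
  have : b.carrier = Set.pi Set.univ fun α =>
      Set.Icc (ENNReal.ofReal (b.lo α : ℝ)) (radiusToENNReal (b.hi α)) := by
    ext t
    exact ⟨fun h α _ => h α, fun h α => h α (Set.mem_univ α)⟩
  rw [this]
  exact isCompact_univ_pi fun α => isCompact_Icc

theorem IsLocallyFinite.finite_setOf_meets {V : Set (Below r₀)} (hV : IsLocallyFinite V)
    (K : Below r₀) : {b ∈ V | (b.1.carrier ∩ K.1.carrier).Nonempty}.Finite := by
  refine K.1.isCompact_carrier.induction_on
    (p := fun s => {b ∈ V | (b.1.carrier ∩ s).Nonempty}.Finite) (by simp) ?_ ?_ ?_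
  · intro s t hst ht
    exact ht.subset fun b hb => ⟨hb.1, hb.2.mono (Set.inter_subset_inter_right _ hst)⟩
  · intro s t hs ht
    refine (hs.union ht).subset fun b hb => ?_
    obtain ⟨hbV, x, hxb, hx | hx⟩ := hb
    · exact Or.inl ⟨hbV, x, hxb, hx⟩
    · exact Or.inr ⟨hbV, x, hxb, hx⟩
  · intro t ht
    obtain ⟨N, hN, hfin⟩ := hV t (carrier_subset_radiiSpace K ht)
    exact ⟨N, mem_nhdsWithin_of_mem_nhds hN, hfin⟩

/-- Sufficiently fine cells are contained in members of an admissible covering. -/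
theorem IsAdmissibleCovering.exists_grid {U : Set (Below r₀)} (hU : IsAdmissibleCovering U)
    (K : Below r₀) : ∃ E : I → Finset ℚ, ∀ B : Below r₀, B ≤ K → (∀ α, B.1.IsCell (E α) α) →
      ∃ u ∈ U, B ≤ u := by
  classical
  obtain ⟨-, -, V, hVcov, hVfin, hVU⟩ := hU
  set W := (hVfin.finite_setOf_meets K).toFinset with hW
  -- The grid consists of all end points of the finitely many members of the refinement that meet
  -- `K`. An infinite end point contributes the dummy value zero; superfluous grid points do no
  -- harm.
  refine ⟨fun α => W.image (fun b => b.1.lo α) ∪ W.image (fun b => (b.1.hi α).untopD 0),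
    fun B hB hcell => ?_⟩
  -- The chosen point is interior in every nondegenerate direction. A member of the refinement
  -- containing it must contain the whole cell, since otherwise one of its end points would lie
  -- strictly inside the cell.
  have hq : ∀ α, ∃ q : ℚ, B.1.lo α ≤ q ∧ (q : WithTop ℚ) ≤ B.1.hi α ∧
      ((B.1.lo α : WithTop ℚ) < B.1.hi α → B.1.lo α < q ∧ (q : WithTop ℚ) < B.1.hi α) := by
    intro α
    rcases (B.1.lo_le_hi α).eq_or_lt with h | h
    · exact ⟨B.1.lo α, le_rfl, h.le, fun h' => absurd h h'.ne⟩
    · have : ∃ q : ℚ, B.1.lo α < q ∧ (q : WithTop ℚ) < B.1.hi α := by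
        cases hb : B.1.hi α with
        | top => exact ⟨B.1.lo α + 1, by linarith, WithTop.coe_lt_top _⟩
        | coe r =>
          rw [hb] at h
          obtain ⟨q, h1, h2⟩ := exists_between (WithTop.coe_lt_coe.1 h)
          exact ⟨q, h1, WithTop.coe_lt_coe.2 h2⟩
      obtain ⟨q, h1, h2⟩ := this
      exact ⟨q, h1.le, h2.le, fun _ => ⟨h1, h2⟩⟩
  choose q hq1 hq2 hq3 using hq
  have hq0 : ∀ α, 0 < q α := fun α => (B.1.lo_pos α).trans_le (hq1 α)
  have ht : (fun α => ENNReal.ofReal (q α : ℝ)) ∈ B.1.carrier := fun α =>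
    ⟨(ofReal_le_ofReal_rat (hq0 α)).2 (hq1 α), (ofReal_le_radiusToENNReal (hq0 α)).2 (hq2 α)⟩
  obtain ⟨v, hv, htv⟩ := hVcov _ (carrier_subset_radiiSpace B ht)
  have hvW : v ∈ W := by
    rw [hW, Set.Finite.mem_toFinset]
    exact ⟨hv, _, htv, MultiInterval.carrier_mono hB ht⟩
  obtain ⟨u, hu, hvu⟩ := hVU v hv
  refine ⟨u, hu, le_trans ⟨fun α => ?_, fun α => ?_⟩ hvu⟩
  · by_contra! hlt
    have h1 : v.1.lo α ≤ q α := (ofReal_le_ofReal_rat (hq0 α)).1 (htv α).1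
    have h2 : (B.1.lo α : WithTop ℚ) < B.1.hi α :=
      (show (B.1.lo α : WithTop ℚ) < q α by exact_mod_cast hlt.trans_le h1).trans_le (hq2 α)
    refine hcell α (v.1.lo α) (Finset.mem_union_left _ (Finset.mem_image_of_mem _ hvW)) hlt ?_
    exact lt_of_le_of_lt (by exact_mod_cast h1) (hq3 α h2).2
  · by_contra! hlt
    obtain ⟨e, he⟩ := WithTop.ne_top_iff_exists.1 hlt.ne_top
    have h1 : (q α : WithTop ℚ) ≤ v.1.hi α := (ofReal_le_radiusToENNReal (hq0 α)).1 (htv α).2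
    have h2 : (B.1.lo α : WithTop ℚ) < B.1.hi α :=
      lt_of_le_of_lt (show (B.1.lo α : WithTop ℚ) ≤ q α by exact_mod_cast hq1 α)
        (h1.trans_lt hlt)
    rw [← he] at hlt h1
    refine hcell α e (Finset.mem_union_right _ (Finset.mem_image.2 ⟨v, hvW, by rw [← he]; rfl⟩))
      ((hq3 α h2).1.trans_le (by exact_mod_cast h1)) hlt

/-- An annulus in the standard admissible covering of `(0, r]`. -/
theorem exists_annuli {r : WithTop ℚ} (hr : 0 < r) : ∃ (lo : ℕ → ℚ) (hi : ℕ → WithTop ℚ),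
    (∀ i, 0 < lo i) ∧ (∀ i, (lo i : WithTop ℚ) < hi i) ∧ (∀ i, hi i ≤ r) ∧
    (∀ t : ℝ≥0∞, 0 < t → t ≤ radiusToENNReal r →
      ∃ i, ENNReal.ofReal (lo i : ℝ) ≤ t ∧ t ≤ radiusToENNReal (hi i)) ∧
    ∀ c : ℝ≥0∞, 0 < c → {i | c ≤ radiusToENNReal (hi i)}.Finite := by
  obtain ⟨q, hq0, hqr⟩ : ∃ q : ℚ, 0 < q ∧ (q : WithTop ℚ) ≤ r := by
    cases r with
    | top => exact ⟨1, one_pos, le_top⟩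
    | coe r => exact ⟨r, by exact_mod_cast hr, le_rfl⟩
  have hq0' : (0 : ℝ) < q := by exact_mod_cast hq0
  have hstep : ∀ i : ℕ, q / (i + 2) < q / (i + 1) := fun i =>
    div_lt_div_of_pos_left hq0 (by positivity) (by linarith)
  have hle : ∀ i : ℕ, q / (i + 1) ≤ q := fun i => div_le_self hq0.le (by
    have : (0 : ℚ) ≤ i := by positivity
    linarith)
  -- The first interval is stretched up to `r`, which may be infinite; all others are consecutive
  -- harmonic intervals accumulating only at zero.
  refine ⟨fun i => q / (i + 2), fun i => if i = 0 then r else ((q / (i + 1) : ℚ) : WithTop ℚ),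
    fun i => by positivity, fun i => ?_, fun i => ?_, fun t ht htr => ?_, fun c hc => ?_⟩
  · dsimp only
    split_ifs with h
    · refine lt_of_lt_of_le ?_ hqr
      exact_mod_cast (hstep i).trans_le (hle i)
    · exact_mod_cast hstep i
  · dsimp only
    split_ifs
    · exact le_rfl
    · exact le_trans (by exact_mod_cast hle i) hqr
  · have hex : ∃ i : ℕ, ENNReal.ofReal ((q / (i + 2) : ℚ) : ℝ) ≤ t := by
      by_cases htop : t = ⊤
      · exact ⟨0, by rw [htop]; exact le_top⟩
      · have ht' : 0 < t.toReal := ENNReal.toReal_pos ht.ne' htop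
        obtain ⟨i, hi⟩ := exists_nat_gt ((q : ℝ) / t.toReal)
        refine ⟨i, ENNReal.ofReal_le_of_le_toReal ?_⟩
        push_cast
        rw [div_le_iff₀ (by positivity)]
        rw [div_lt_iff₀ ht'] at hi
        nlinarith
    classical
    refine ⟨Nat.find hex, Nat.find_spec hex, ?_⟩
    dsimp only
    split_ifs with h
    · exact htr
    · obtain ⟨j, hj⟩ := Nat.exists_eq_succ_of_ne_zero h
      have h1 := Nat.find_min hex (m := j) (by omega)
      rw [not_le] at h1
      refine h1.le.trans ?_
      rw [hj]
      simp only [radiusToENNReal]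
      refine ENNReal.ofReal_le_ofReal ?_
      push_cast
      rw [show (j : ℝ) + 1 + 1 = j + 2 by ring]
  · obtain ⟨c', hc'0, hc'⟩ := ENNReal.lt_iff_exists_nnreal_btwn.1 hc
    have hc'1 : (0 : ℝ) < c' := by exact_mod_cast hc'0
    obtain ⟨N, hN⟩ := exists_nat_gt ((q : ℝ) / c')
    refine (Set.finite_Iio (N + 1)).subset fun i hi => ?_
    by_contra hiN
    simp only [Set.mem_Iio, not_lt] at hiN
    have h0 : i ≠ 0 := by omega
    have hi' : c ≤ radiusToENNReal (if i = 0 then r else ((q / (i + 1) : ℚ) : WithTop ℚ)) := hi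
    rw [if_neg h0] at hi'
    have h1 := hc'.le.trans hi'
    simp only [radiusToENNReal] at h1
    have h2 : (c' : ℝ) ≤ ((q / (i + 1) : ℚ) : ℝ) := by
      have := (ENNReal.coe_le_iff.1 h1 _ rfl)
      rwa [← NNReal.coe_le_coe, Real.coe_toNNReal _ (by positivity)] at this
    push_cast at h2
    rw [le_div_iff₀ (by positivity)] at h2
    rw [div_lt_iff₀ hc'1] at hN
    have h3 : ((N + 1 : ℕ) : ℝ) ≤ i := by exact_mod_cast hiN
    push_cast at h3
    nlinarith

/-- Products of the one-dimensional coverings are locally finite because the outer end points tend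
to zero in each direction. Such a covering is needed for the passage from global to local, where the
bounds hold on every interval. -/
theorem exists_admissibleCovering [Fintype I] (hr₀ : ∀ α, 0 < r₀ α) :
    ∃ U : Set (Below r₀), IsAdmissibleCovering U := by
  classical
  choose lo hi hlo hlt hle hcov hfin using fun α => exists_annuli (hr₀ α)
  let B : (I → ℕ) → Below r₀ := fun i =>
    ⟨⟨fun α => lo α (i α), fun α => hi α (i α), fun α => hlo α _, fun α => (hlt α _).le⟩,
      fun α => hle α _⟩
  have hcovering : IsCovering (Set.range B) := by
    intro t ht
    choose i hi1 hi2 using fun α => hcov α (t α) (ht α).1 (ht α).2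
    exact ⟨B i, ⟨i, rfl⟩, fun α => ⟨hi1 α, hi2 α⟩⟩
  have hlf : IsLocallyFinite (Set.range B) := by
    intro t ht
    choose c hc0 hct using fun α => exists_between (ht α).1
    refine ⟨Set.pi Set.univ fun α => Set.Ioi (c α),
      set_pi_mem_nhds Set.finite_univ fun α _ => Ioi_mem_nhds (hct α), ?_⟩
    refine ((Set.Finite.pi' fun α => hfin α (c α) (hc0 α)).image B).subset ?_
    rintro _ ⟨⟨i, rfl⟩, x, hx, hx'⟩
    refine ⟨i, fun α => ?_, rfl⟩
    have h1 : c α < x α := hx' α (Set.mem_univ α)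
    exact h1.le.trans (hx α).2
  refine ⟨Set.range B, hcovering, ?_, Set.range B, hcovering, hlf, fun v hv => ⟨v, hv, le_rfl⟩⟩
  rintro _ ⟨i, rfl⟩ α
  exact hlt α _

end Coverings

section Uniform

variable {I : Type*} [Fintype I] [DecidableEq I] {p : ℕ} [hp : Fact p.Prime]
  {A : Type*} [NormedCommRing A] [IsUltrametricDist A] {r₀ : I → WithTop ℚ}
  [NormedAlgebra ℚ_[p] A] {F : CoherentSheaf p A r₀}

/-- A uniformly finitely generated sheaf has a bounded number of generators over all
multi-intervals. -/
theorem CoherentSheaf.UniformlyFinitelyGenerated.exists_nGen (hF : F.UniformlyFinitelyGenerated) :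
    ∃ n, ∀ K, F.NGen K n := by
  obtain ⟨n, -, U, hU, hgen⟩ := hF
  refine ⟨2 ^ (Finset.univ : Finset I).card * n, fun K => ?_⟩
  obtain ⟨E, hE⟩ := hU.exists_grid K
  refine nGen_of_grid (K₀ := K) (E := E) (fun B hB hc => ?_) Finset.univ K le_rfl fun α hα =>
    absurd (Finset.mem_univ α) hα
  obtain ⟨u, hu, hBu⟩ := hE B hB hc
  exact NGen.mono (isNGenerated_iff.1 (hgen u hu)) hBu

end Uniform

/-! ### Global sections as limits of towers -/

section Radii

variable {I : Type*} {r₀ : I → WithTop ℚ}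

/-- A cofinal decreasing sequence of inner radii. -/
def radii (s : InnerRadius r₀) (k : ℕ) : InnerRadius r₀ :=
  ⟨fun α => s.1 α / (k + 1), fun α => ⟨div_pos (s.2 α).1 (by positivity),
    le_trans (by
      have : s.1 α / (k + 1) ≤ s.1 α := div_le_self (s.2 α).1.le (by
        have : (0 : ℚ) ≤ k := by positivity
        linarith)
      exact_mod_cast this) (s.2 α).2⟩⟩

theorem radii_zero (s : InnerRadius r₀) : radii s 0 = s := by
  ext α
  simp [radii]

theorem radii_antitone (s : InnerRadius r₀) : Antitone (radii s) := by
  intro j k hjk α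
  change s.1 α / (k + 1) ≤ s.1 α / (j + 1)
  have h1 : (j : ℚ) ≤ k := by exact_mod_cast hjk
  have h2 := (s.2 α).1
  gcongr

theorem radii_succ_le (s : InnerRadius r₀) (k : ℕ) : radii s (k + 1) ≤ radii s k :=
  radii_antitone s k.le_succ

theorem exists_radii_le [Finite I] (s t : InnerRadius r₀) : ∃ k, radii s k ≤ t := by
  have := Fintype.ofFinite I
  have h : ∀ α, ∃ k : ℕ, s.1 α / t.1 α < k := fun α => exists_nat_gt _
  choose k hk using h
  refine ⟨∑ α, k α, fun α => ?_⟩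
  change s.1 α / ((∑ α, k α : ℕ) + 1) ≤ t.1 α
  have h1 : (k α : ℚ) ≤ ((∑ α, k α : ℕ) : ℚ) := by
    exact_mod_cast Finset.single_le_sum (f := k) (fun _ _ => Nat.zero_le _) (Finset.mem_univ α)
  have h2 := hk α
  have h3 := (t.2 α).1
  rw [div_lt_iff₀ h3] at h2
  rw [div_le_iff₀ (by positivity)]
  nlinarith

/-- Compatible families over a cofinal sequence extend uniquely. -/
theorem exists_compatible_extension [Finite I] {X : InnerRadius r₀ → Type*}
    (res : ∀ {s t : InnerRadius r₀}, s ≤ t → X s → X t)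
    (res_self : ∀ s (x : X s), res (le_refl s) x = x)
    (res_res : ∀ {s t u : InnerRadius r₀} (h : s ≤ t) (h' : t ≤ u) (x : X s),
      res h' (res h x) = res (h.trans h') x)
    (s : InnerRadius r₀) (w : ∀ k, X (radii s k))
    (hw : ∀ k, res (radii_succ_le s k) (w (k + 1)) = w k) :
    ∃ m : ∀ t, X t, (∀ t u (h : t ≤ u), res h (m t) = m u) ∧ ∀ k, m (radii s k) = w k := by
  choose κ hκ using exists_radii_le s
  have h1 : ∀ j d, res (radii_antitone s (Nat.le_add_right j d)) (w (j + d)) = w j := by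
    intro j d
    induction d with
    | zero => exact res_self _ _
    | succ d ih =>
      rw [← ih, ← hw (j + d), res_res]
      rfl
  have h2 : ∀ t j k (hj : radii s j ≤ t) (hk : radii s k ≤ t), res hj (w j) = res hk (w k) := by
    intro t j k hj hk
    rw [← h1 j k, ← h1 k j, res_res, res_res]
    -- The stages `j + k` and `k + j` carry different types, so their equality has to be eliminated
    -- with both indices generalised.
    have : ∀ a b (hab : a = b) (ha : radii s a ≤ t) (hb : radii s b ≤ t),
        res ha (w a) = res hb (w b) := by
      rintro a _ rfl _ _
      rfl
    exact this _ _ (add_comm j k) _ _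
  refine ⟨fun t => res (hκ t) (w (κ t)), fun t u h => ?_, fun k => ?_⟩
  · rw [res_res]
    exact h2 _ _ _ _ _
  · change res _ (w (κ _)) = w k
    rw [h2 _ _ k _ le_rfl, res_self]

/-- The inner radius of a multi-interval. -/
def lower (b : Below r₀) : InnerRadius r₀ :=
  ⟨b.1.lo, fun α => ⟨b.1.lo_pos α, (b.1.lo_le_hi α).trans (b.2 α)⟩⟩

theorem le_full_lower (b : Below r₀) : b ≤ full (lower b) := ⟨fun _ => le_rfl, b.2⟩

theorem lower_antitone {a b : Below r₀} (h : a ≤ b) : lower b ≤ lower a := fun α => h.1 α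

theorem nonempty_innerRadius (hr₀ : ∀ α, 0 < r₀ α) : Nonempty (InnerRadius r₀) := by
  have : ∀ α, ∃ q : ℚ, 0 < q ∧ (q : WithTop ℚ) ≤ r₀ α := by
    intro α
    have h := hr₀ α
    cases hr : r₀ α with
    | top => exact ⟨1, one_pos, le_top⟩
    | coe r =>
      rw [hr] at h
      exact ⟨r, by exact_mod_cast h, le_rfl⟩
  choose q hq using this
  exact ⟨⟨q, hq⟩⟩

end Radii

/-! ### Global functions, global sections and the sheaf of relations -/

section GlobalSections

variable {I : Type*} [Fintype I] [DecidableEq I] {p : ℕ} [hp : Fact p.Prime]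
  {A : Type*} [NormedCommRing A] [IsUltrametricDist A] {r₀ : I → WithTop ℚ}

variable (p A r₀) in
/-- The ring `Π_{an, r_{I,0}, I, A}`, as a type. -/
def GlobalRing : Type _ := AnRing p A r₀

instance : CommRing (GlobalRing p A r₀) := inferInstanceAs (CommRing (AnRing p A r₀))

/-- The component of a global function at an inner radius. -/
def GlobalRing.component (s : InnerRadius r₀) :
    GlobalRing p A r₀ →+* IntervalRing p A (full s).1 :=
  (Pi.evalRingHom (fun s : InnerRadius r₀ => IntervalRing p A (full s).1) s).comp
    (AnRing p A r₀).subtype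

theorem GlobalRing.restrict_component {s t : InnerRadius r₀} (h : s ≤ t) (f : GlobalRing p A r₀) :
    restrict p A (full_le h) (f.component s) = f.component t := f.2 s t h

/-- A global function given by compatible components. -/
def GlobalRing.mk (f : ∀ s : InnerRadius r₀, IntervalRing p A (full s).1)
    (hf : ∀ s t (h : s ≤ t), restrict p A (full_le h) (f s) = f t) : GlobalRing p A r₀ := ⟨f, hf⟩

namespace CoherentSheaf

variable {F : CoherentSheaf p A r₀}

variable (F) in
/-- The module of global sections of a coherent sheaf, as a type. -/
def GlobalSections : Type _ := F.globalSection

instance : AddCommGroup F.GlobalSections := inferInstanceAs (AddCommGroup F.globalSection)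

instance : Module (GlobalRing p A r₀) F.GlobalSections :=
  inferInstanceAs (Module (AnRing p A r₀) F.globalSection)

/-- The component of a global section at an inner radius. -/
def component (s : InnerRadius r₀) : F.GlobalSections →ₛₗ[GlobalRing.component (p := p) (A := A) s]
    F.sec (full s) where
  toFun m := m.1 s
  map_add' _ _ := rfl
  map_smul' _ _ := rfl

theorem res_component {s t : InnerRadius r₀} (h : s ≤ t) (m : F.GlobalSections) :
    F.res (full_le h) (component s m) = component t m := m.2 s t h

variable (F) in
/-- The restriction of a global section. -/
def sectionOver (b : Below r₀) :
    F.GlobalSections →ₛₗ[(restrict p A (le_full_lower b)).comp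
      (GlobalRing.component (lower b))] F.sec b where
  toFun m := F.res (le_full_lower b) (component (lower b) m)
  map_add' m m' := by rw [map_add, map_add]
  map_smul' f m := by rw [map_smulₛₗ, map_smulₛₗ]; rfl

theorem sectionOver_full (s : InnerRadius r₀) (m : F.GlobalSections) :
    F.sectionOver (full s) m = component s m := F.res_self _ _

theorem res_sectionOver {a b : Below r₀} (h : a ≤ b) (m : F.GlobalSections) :
    F.res h (F.sectionOver b m) = F.sectionOver a m := by
  change F.res h (F.res _ (component (lower b) m)) = F.res _ (component (lower a) m)
  rw [F.res_res, ← res_component (lower_antitone h), F.res_res]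

variable (F) in
/-- A global section given by compatible components. -/
def GlobalSections.mk (m : ∀ s : InnerRadius r₀, F.sec (full s))
    (hm : ∀ s t (h : s ≤ t), F.res (full_le h) (m s) = m t) : F.GlobalSections := ⟨m, hm⟩

theorem GlobalSections.ext {m m' : F.GlobalSections} (h : ∀ s, component s m = component s m') :
    m = m' := Subtype.ext (funext h)

theorem globalSections_ext {m m' : F.GlobalSections} (s : InnerRadius r₀)
    (h : ∀ k, component (radii s k) m = component (radii s k) m') : m = m' := by
  apply Subtype.ext
  funext t
  obtain ⟨k, hk⟩ := exists_radii_le s t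
  change component t m = component t m'
  rw [← res_component hk, ← res_component hk, h]

theorem exists_globalSection (s : InnerRadius r₀) (w : ∀ k, F.sec (full (radii s k)))
    (hw : ∀ k, F.res (full_le (radii_succ_le s k)) (w (k + 1)) = w k) :
    ∃ m : F.GlobalSections, ∀ k, component (radii s k) m = w k := by
  obtain ⟨m, hm, hmw⟩ := exists_compatible_extension (X := fun s => F.sec (full s))
    (fun h => F.res (full_le h)) (fun s x => F.res_self _ x) (fun h h' x => F.res_res _ _ x) s w hw
  exact ⟨.mk F m hm, hmw⟩

theorem exists_globalRing (s : InnerRadius r₀) (w : ∀ k, IntervalRing p A (full (radii s k)).1)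
    (hw : ∀ k, restrict p A (full_le (radii_succ_le s k)) (w (k + 1)) = w k) :
    ∃ f : GlobalRing p A r₀, ∀ k, f.component (radii s k) = w k := by
  obtain ⟨m, hm, hmw⟩ := exists_compatible_extension
    (X := fun s : InnerRadius r₀ => IntervalRing p A (full s).1)
    (fun h => restrict p A (full_le h)) (fun s x => restrict_self x)
    (fun h h' x => restrict_restrict _ _ x) s w hw
  exact ⟨⟨m, hm⟩, hmw⟩

theorem denseRange_restrict_radii (s : InnerRadius r₀) (k : ℕ) :
    DenseRange (restrict p A (full_le (radii_succ_le s k))) :=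
  denseRange_restrict (a := (full (radii s k)).1) (b := (full (radii s (k + 1))).1)
    (full_le (radii_succ_le s k)) rfl

theorem exists_coboundary (s : InnerRadius r₀) (v : ∀ k, F.sec (full (radii s k))) :
    ∃ w : ∀ k, F.sec (full (radii s k)),
      ∀ k, w k - F.res (full_le (radii_succ_le s k)) (w (k + 1)) = v k := by
  have := fun k => F.finite (full (radii s k))
  exact exists_sub_eq_of_tower (R := fun k => IntervalRing p A (full (radii s k)).1)
    (V := fun k => F.sec (full (radii s k)))
    (ρ := fun k => restrict p A (full_le (radii_succ_le s k))) (fun k x => norm_restrict_le _ x)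
    (denseRange_restrict_radii s) (fun k => F.res (full_le (radii_succ_le s k)))
    (fun k => F.span_range_res _) v

theorem span_sectionOver_of_generates {b K : Below r₀}
    (h : F.Generates (Set.range (F.sectionOver K)) b) :
    Submodule.span (IntervalRing p A b.1) (Set.range (F.sectionOver b)) = ⊤ := by
  obtain ⟨hb, h⟩ := h
  have : F.res hb '' Set.range (F.sectionOver K) = Set.range (F.sectionOver b) := by
    rw [← Set.range_comp]
    exact congrArg Set.range (funext fun m => res_sectionOver hb m)
  rwa [this] at h

/-- Global sections generate the sections over every multi-interval. -/
theorem span_range_sectionOver (b : Below r₀) :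
    Submodule.span (IntervalRing p A b.1) (Set.range (F.sectionOver b)) = ⊤ := by
  set s := lower b with hs
  have := fun k => F.finite (full (radii s k))
  -- The interval `b` lies in the one reaching from its own lower end points up to `r₀`. This is the
  -- bottom of a tower, so compatible families generate there and then over `b`.
  have h1 := span_compatible_eq_top (R := fun k => IntervalRing p A (full (radii s k)).1)
    (V := fun k => F.sec (full (radii s k)))
    (ρ := fun k => restrict p A (full_le (radii_succ_le s k))) (fun k x => norm_restrict_le _ x)
    (denseRange_restrict_radii s) (fun k => F.res (full_le (radii_succ_le s k)))
    (fun k => F.span_range_res _)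
  have hb : b ≤ full (radii s 0) := by rw [radii_zero]; exact le_full_lower b
  have h2 : F.Generates (Set.range (F.sectionOver (full (radii s 0)))) b := by
    refine Generates.mono (generates_self_iff.2 ?_) hb
    refine eq_top_iff.2 (h1.ge.trans (Submodule.span_mono ?_))
    rintro _ ⟨w, hw, rfl⟩
    obtain ⟨m, hm⟩ := exists_globalSection s w hw
    exact ⟨m, by rw [sectionOver_full, hm]⟩
  exact span_sectionOver_of_generates h2

theorem span_sectionOver_eq_top {ι : Type*} {g : ι → F.GlobalSections}
    (hg : Submodule.span (GlobalRing p A r₀) (Set.range g) = ⊤) (b : Below r₀) :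
    Submodule.span (IntervalRing p A b.1) (Set.range fun i => F.sectionOver b (g i)) = ⊤ :=
  span_range_comp_eq_top (span_range_sectionOver b) hg

/-! ### The sheaf of relations -/

/-- The sheaf of relations between finitely many global sections. -/
def relations (hR : ∀ b : MultiInterval I, HasBoundedGeneration (IntervalRing p A b)) {ι : Type*}
    [Fintype ι] (g : ι → F.GlobalSections) : CoherentSheaf p A r₀ where
  sec b := LinearMap.ker (Fintype.linearCombination (IntervalRing p A b.1)
    fun i => F.sectionOver b (g i))
  -- Coherence of the relations uses noetherianity for finiteness here, and flatness of restriction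
  -- for base change below.
  finite b := by
    have := (hR b.1).isNoetherianRing
    infer_instance
  res {a b} h :=
    { toFun := fun c => ⟨fun i => restrict p A h (c.1 i), by
        have hc : ∑ i, c.1 i • F.sectionOver b (g i) = 0 := c.2
        have := congrArg (F.res h) hc
        rw [map_sum, map_zero] at this
        simp only [map_smulₛₗ, res_sectionOver] at this
        exact this⟩
      map_add' := fun c d => by
        ext i
        exact map_add _ _ _
      map_smul' := fun r c => by
        ext i
        exact map_mul _ _ _ }
  res_self b c := by
    ext i
    exact restrict_self _
  res_res hab hbc c := by
    ext i
    exact restrict_restrict _ _ _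
  baseChange {a b} h := by
    refine (F.baseChange h).ker (flat_restrict hR h) _ _ (fun c => ?_) _ fun x => rfl
    rw [Fintype.linearCombination_apply, Fintype.linearCombination_apply, map_sum]
    simp only [map_smulₛₗ, res_sectionOver]
    rfl

/-- Global sections that generate locally generate globally. -/
theorem span_eq_top_of_local (hR : ∀ b : MultiInterval I, HasBoundedGeneration (IntervalRing p A b))
    {ι : Type*} [Fintype ι] (g : ι → F.GlobalSections) (s : InnerRadius r₀)
    (hg : ∀ k, Submodule.span (IntervalRing p A (full (radii s k)).1)
      (Set.range fun i => F.sectionOver (full (radii s k)) (g i)) = ⊤) :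
    Submodule.span (GlobalRing p A r₀) (Set.range g) = ⊤ := by
  refine eq_top_iff.2 fun m _ => ?_
  choose c hc using fun k => exists_coeff_of_span_eq_top (hg k) (component (radii s k) m)
  -- The local coefficients of `m` are incompatible only by relations. A primitive of this defect in
  -- the tower of relations corrects them to global functions.
  let v : ∀ k, (relations hR g).sec (full (radii s k)) := fun k =>
    ⟨c k - fun i => restrict p A (full_le (radii_succ_le s k)) (c (k + 1) i), by
      rw [LinearMap.mem_ker, map_sub, sub_eq_zero, Fintype.linearCombination_apply,
        Fintype.linearCombination_apply, ← hc, ← res_component (radii_succ_le s k), hc (k + 1), map_sum]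
      simp only [map_smulₛₗ, res_sectionOver]⟩
  obtain ⟨w, hw⟩ := exists_coboundary s v
  have hcompat : ∀ k i, restrict p A (full_le (radii_succ_le s k)) ((c (k + 1) - (w (k + 1)).1) i) =
      (c k - (w k).1) i := by
    intro k i
    have h1 := congrFun (congrArg Subtype.val (hw k)) i
    have h2 : (w k).1 i - restrict p A (full_le (radii_succ_le s k)) ((w (k + 1)).1 i) =
        c k i - restrict p A (full_le (radii_succ_le s k)) (c (k + 1) i) := h1
    rw [Pi.sub_apply, Pi.sub_apply, map_sub]
    linear_combination h2
  choose f hf using fun i => exists_globalRing (p := p) (A := A) s (fun k => (c k - (w k).1) i)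
    fun k => hcompat k i
  have hm : m = ∑ i, f i • g i := by
    refine globalSections_ext s fun k => ?_
    rw [hc k, map_sum]
    have h2 : ∑ i, (w k).1 i • F.sectionOver (full (radii s k)) (g i) = 0 := (w k).2
    simp only [map_smulₛₗ, hf, Pi.sub_apply, sub_smul, Finset.sum_sub_distrib]
    simp only [sectionOver_full] at h2 ⊢
    rw [h2, sub_zero]
  rw [hm]
  exact sum_mem fun i _ => Submodule.smul_mem _ _ (Submodule.subset_span ⟨i, rfl⟩)

end CoherentSheaf

end GlobalSections

/-! ### Presentations and retractions -/

section Presentations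

variable {R M ι : Type*} [CommRing R] [AddCommGroup M] [Module R M] [Fintype ι]

theorem sum_smul_single_one [DecidableEq ι] (c : ι → R) :
    ∑ i, c i • (Pi.single i (1 : R) : ι → R) = c := by
  ext j
  simp [Finset.sum_apply, Pi.single_apply]

theorem linearCombination_surjective {e : ι → M} (he : Submodule.span R (Set.range e) = ⊤) :
    Function.Surjective (Fintype.linearCombination R e) := fun x => by
  obtain ⟨c, rfl⟩ := exists_coeff_of_span_eq_top he x
  exact ⟨c, rfl⟩

/-- The relations between generators of a presented module are generated by a bounded number of
elements. -/
theorem IsMNPresented.exists_span_ker {m n : ℕ} (h : IsMNPresented R M m n) {e : ι → M}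
    (he : Submodule.span R (Set.range e) = ⊤) :
    ∃ x : Fin m ⊕ ι → LinearMap.ker (Fintype.linearCombination R e),
      Submodule.span R (Set.range x) = ⊤ := by
  classical
  obtain ⟨f, π, hex, hπ⟩ := h
  set γ := Fintype.linearCombination R e with hγ
  obtain ⟨φ, hφ⟩ := Module.projective_lifting_property π γ hπ
  obtain ⟨ψ, hψ⟩ := Module.projective_lifting_property γ π (linearCombination_surjective he)
  have hφ' : ∀ x, π (φ x) = γ x := fun x => LinearMap.congr_fun hφ x
  have hψ' : ∀ x, γ (ψ x) = π x := fun x => LinearMap.congr_fun hψ x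
  -- Schanuel's argument: with `φ` and `ψ` comparing the two free covers, a relation `x` is `ψ (φ
  -- x)`, which comes from the given relations, plus `x - ψ (φ x)`.
  let u : (Fin m → R) →ₗ[R] LinearMap.ker γ := (ψ.comp f).codRestrict _ fun x => by
    change γ (ψ (f x)) = 0
    rw [hψ', hex.apply_apply_eq_zero]
  let v : (ι → R) →ₗ[R] LinearMap.ker γ := (LinearMap.id - ψ.comp φ).codRestrict _ fun x => by
    change γ (x - ψ (φ x)) = 0
    rw [map_sub, hψ', hφ', sub_self]
  refine ⟨Sum.elim (fun j => u (Pi.single j 1)) fun i => v (Pi.single i 1),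
    eq_top_iff.2 fun x _ => ?_⟩
  obtain ⟨y, hy⟩ : φ x.1 ∈ Set.range f := (hex _).1 (by rw [hφ']; exact x.2)
  have hx : x = u y + v x.1 := by
    apply Subtype.ext
    change x.1 = ψ (f y) + (x.1 - ψ (φ x.1))
    rw [hy]
    abel
  rw [hx]
  refine add_mem ?_ ?_
  · rw [← sum_smul_single_one y, map_sum]
    refine sum_mem fun j _ => ?_
    rw [map_smul]
    exact Submodule.smul_mem _ _ (Submodule.subset_span ⟨Sum.inl j, rfl⟩)
  · rw [← sum_smul_single_one x.1, map_sum]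
    refine sum_mem fun j _ => ?_
    rw [map_smul]
    exact Submodule.smul_mem _ _ (Submodule.subset_span ⟨Sum.inr j, rfl⟩)

theorem isMNPresented_of_span {m n : ℕ} {e : Fin n → M}
    (he : Submodule.span R (Set.range e) = ⊤)
    {x : Fin m → LinearMap.ker (Fintype.linearCombination R e)}
    (hx : Submodule.span R (Set.range x) = ⊤) : IsMNPresented R M m n := by
  refine ⟨(LinearMap.ker (Fintype.linearCombination R e)).subtype.comp
    (Fintype.linearCombination R x), _, fun y => ⟨fun hy => ?_, ?_⟩,
    linearCombination_surjective he⟩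
  · obtain ⟨c, hc⟩ := linearCombination_surjective hx ⟨y, hy⟩
    exact ⟨c, congrArg Subtype.val hc⟩
  · rintro ⟨c, rfl⟩
    exact (Fintype.linearCombination R x c).2

/-- A quotient of a free module by the kernel of a projector is projective. -/
theorem projective_of_projector {γ : (ι → R) →ₗ[R] M} (hγ : Function.Surjective γ)
    (q : (ι → R) →ₗ[R] (ι → R)) (hq : ∀ x, γ x = 0 → q x = 0) (hγq : ∀ x, γ (q x) = γ x) :
    Module.Projective R M := by
  choose s hs using hγ
  have hwd : ∀ x y, γ x = γ y → q x = q y := fun x y h => by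
    rw [← sub_eq_zero, ← map_sub]
    exact hq _ (by rw [map_sub, h, sub_self])
  refine Module.Projective.of_split
    { toFun := fun x => q (s x)
      map_add' := fun x y => by
        rw [← map_add]
        exact hwd _ _ (by rw [map_add, hs, hs, hs])
      map_smul' := fun r x => by
        rw [RingHom.id_apply, ← map_smul]
        exact hwd _ _ (by rw [map_smul, hs, hs]) } γ (LinearMap.ext fun x => ?_)
  change γ (q (s x)) = x
  rw [hγq, hs]

/-- A section `σ` of `γ` gives the retraction `id - σ γ`. It is recorded by its values on the
standard basis, a finite tuple that can be restricted along ring maps. -/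
theorem exists_retraction [Module.Projective R M] {γ : (ι → R) →ₗ[R] M}
    (hγ : Function.Surjective γ) :
    ∃ e : ι → LinearMap.ker γ, ∀ c : LinearMap.ker γ, ∑ i, c.1 i • e i = c := by
  classical
  obtain ⟨σ, hσ⟩ := Module.projective_lifting_property γ LinearMap.id hγ
  let v : (ι → R) →ₗ[R] LinearMap.ker γ := (LinearMap.id - σ.comp γ).codRestrict _ fun x => by
    change γ (x - σ (γ x)) = 0
    have : γ (σ (γ x)) = γ x := LinearMap.congr_fun hσ _
    rw [map_sub, this, sub_self]
  refine ⟨fun i => v (Pi.single i 1), fun c => ?_⟩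
  simp only [← map_smul, ← map_sum]
  rw [sum_smul_single_one]
  apply Subtype.ext
  change c.1 - σ (γ c.1) = c.1
  rw [show γ c.1 = 0 from c.2, map_zero, sub_zero]

/-- The maps from the free module to a submodule that vanish on that submodule. -/
def vanishing (P : Submodule R (ι → R)) : Submodule R (ι → P) where
  carrier := {d | ∀ c : P, ∑ i, c.1 i • d i = 0}
  zero_mem' c := by simp
  add_mem' hd hd' c := by
    simp only [Pi.add_apply, smul_add, Finset.sum_add_distrib, hd c, hd' c, add_zero]
  smul_mem' r d hd c := by
    simp only [Pi.smul_apply, smul_comm _ r, ← Finset.smul_sum, hd c, smul_zero]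

variable {S : Type*} [CommRing S] {f : S →+* R} {P : Submodule R (ι → R)} {Q : Submodule S (ι → S)}
  (τ : Q →ₛₗ[f] P) (hτ : ∀ x i, (τ x).1 i = f (x.1 i))
  (hspan : Submodule.span R (Set.range τ) = ⊤)

include hτ hspan

/-- Both sides are linear in `c`, so the identity need only hold on the spanning image of `τ`. The
scalar `a` is `0` for vanishing maps and `1` for retractions. -/
theorem sum_smul_map_eq (a : S) {d : ι → Q} (hd : ∀ c : Q, ∑ i, c.1 i • d i = a • c) (c : P) :
    ∑ i, c.1 i • τ (d i) = f a • c := by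
  have hc : c ∈ Submodule.span R (Set.range τ) := hspan ▸ Submodule.mem_top
  induction hc using Submodule.span_induction with
  | mem x hx =>
    obtain ⟨x, rfl⟩ := hx
    simp only [hτ, ← map_smulₛₗ, ← map_sum, hd]
  | zero => simp
  | add x y _ _ hx hy =>
    simp only [Submodule.coe_add, Pi.add_apply, add_smul, Finset.sum_add_distrib, hx, hy, smul_add]
  | smul r x _ hx =>
    simp only [Submodule.coe_smul, Pi.smul_apply, smul_eq_mul, mul_smul, ← Finset.smul_sum, hx]
    exact smul_comm _ _ _

theorem map_mem_vanishing {d : ι → Q} (hd : d ∈ vanishing Q) : τ ∘ d ∈ vanishing P := fun c => by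
  have := sum_smul_map_eq τ hτ hspan 0 (d := d) (fun c => by rw [hd c, zero_smul]) c
  rwa [map_zero, zero_smul] at this

theorem map_retraction {e : ι → Q} (he : ∀ c : Q, ∑ i, c.1 i • e i = c) (c : P) :
    ∑ i, c.1 i • τ (e i) = c := by
  have := sum_smul_map_eq τ hτ hspan 1 (d := e) (fun c => by rw [he c, one_smul]) c
  rwa [map_one, one_smul] at this

/-- Restriction of vanishing maps. -/
def mapVanishing : vanishing Q →ₛₗ[f] vanishing P where
  toFun d := ⟨τ ∘ d.1, map_mem_vanishing τ hτ hspan d.2⟩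
  map_add' _ _ := Subtype.ext (funext fun _ => map_add τ _ _)
  map_smul' _ _ := Subtype.ext (funext fun _ => map_smulₛₗ τ _ _)

/-- A map vanishing on `P` is unchanged when composed with the projector `1 - e`. It is thus a sum
of maps taking one coordinate of this projector times an element of `P`; those with element from `Q`
are already defined over `S`. -/
theorem span_range_mapVanishing {e : ι → Q} (he : ∀ c : Q, ∑ i, c.1 i • e i = c) :
    Submodule.span R (Set.range (mapVanishing τ hτ hspan)) = ⊤ := by
  classical
  let D : ι → Q → vanishing Q := fun i x =>
    ⟨fun l => (((Pi.single l 1 : ι → S) i - (e l).1 i) • x), fun c => by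
      have h1 := congrFun (congrArg Subtype.val (he c)) i
      simp only [AddSubmonoidClass.coe_finsetSum, Finset.sum_apply, Submodule.coe_smul,
        Pi.smul_apply, smul_eq_mul] at h1
      simp only [smul_smul, ← Finset.sum_smul, mul_sub, Finset.sum_sub_distrib, h1]
      simp [Pi.single_apply]⟩
  have hD : ∀ i x l, (mapVanishing τ hτ hspan (D i x)).1 l =
      ((Pi.single l 1 : ι → R) i - (τ (e l)).1 i) • τ x := by
    intro i x l
    change τ (((Pi.single l 1 : ι → S) i - (e l).1 i) • x) = _
    rw [map_smulₛₗ, map_sub, hτ]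
    congr 2
    simp only [Pi.single_apply]
    split_ifs <;> simp
  have key : ∀ i (y : P), ∃ w ∈ Submodule.span R (Set.range (mapVanishing τ hτ hspan)),
      ∀ l, w.1 l = ((Pi.single l 1 : ι → R) i - (τ (e l)).1 i) • y := by
    intro i y
    have hy : y ∈ Submodule.span R (Set.range τ) := hspan ▸ Submodule.mem_top
    induction hy using Submodule.span_induction with
    | mem y hy =>
      obtain ⟨x, rfl⟩ := hy
      exact ⟨_, Submodule.subset_span ⟨D i x, rfl⟩, hD i x⟩
    | zero => exact ⟨0, zero_mem _, fun l => by rw [smul_zero]; rfl⟩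
    | add y y' _ _ hy hy' =>
      obtain ⟨w, hw, h⟩ := hy
      obtain ⟨w', hw', h'⟩ := hy'
      exact ⟨w + w', add_mem hw hw', fun l => by rw [smul_add, ← h, ← h']; rfl⟩
    | smul r y _ hy =>
      obtain ⟨w, hw, h⟩ := hy
      exact ⟨r • w, Submodule.smul_mem _ r hw, fun l => by rw [smul_comm, ← h]; rfl⟩
  refine eq_top_iff.2 fun d _ => ?_
  choose w hw hwl using fun i => key i (d.1 i)
  have hd : d = ∑ i, w i := by
    apply Subtype.ext
    rw [AddSubmonoidClass.coe_finsetSum]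
    funext l
    rw [Finset.sum_apply]
    have h1 : ∑ i, (τ (e l)).1 i • d.1 i = 0 := d.2 (τ (e l))
    have h2 : ∑ i, (Pi.single l 1 : ι → R) i • d.1 i = d.1 l := by simp [Pi.single_apply]
    rw [← sub_zero (d.1 l), ← h1, ← h2, ← Finset.sum_sub_distrib]
    refine Finset.sum_congr rfl fun i _ => ?_
    rw [hwl]
    exact (sub_smul _ _ _).symm
  rw [hd]
  exact sum_mem fun i _ => hw i

end Presentations

/-- Retractions onto the members of a tower of submodules can be chosen compatibly. -/
theorem exists_compatible_retraction {R : ℕ → Type*} [∀ k, NormedCommRing (R k)]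
    [∀ k, CompleteSpace (R k)] [∀ k, IsNoetherianRing (R k)] {ρ : ∀ k, R (k + 1) →+* R k}
    (hρ : ∀ k x, ‖ρ k x‖ ≤ ‖x‖) (hd : ∀ k, DenseRange (ρ k)) {ι : Type*} [Fintype ι]
    {P : ∀ k, Submodule (R k) (ι → R k)} (τ : ∀ k, P (k + 1) →ₛₗ[ρ k] P k)
    (hτ : ∀ k x i, (τ k x).1 i = ρ k (x.1 i))
    (hspan : ∀ k, Submodule.span (R k) (Set.range (τ k)) = ⊤)
    (hret : ∀ k, ∃ e : ι → P k, ∀ c : P k, ∑ i, c.1 i • e i = c) :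
    ∃ e : ∀ k, ι → P k, (∀ k i, τ k (e (k + 1) i) = e k i) ∧
      ∀ k (c : P k), ∑ i, c.1 i • e k i = c := by
  choose e he using hret
  have hsub : ∀ k (a b : ι → P k), (∀ c : P k, ∑ i, c.1 i • a i = c) →
      (∀ c : P k, ∑ i, c.1 i • b i = c) → a - b ∈ vanishing (P k) := by
    intro k a b ha hb c
    rw [← sub_eq_zero.2 ((ha c).trans (hb c).symm), ← Finset.sum_sub_distrib]
    exact Finset.sum_congr rfl fun i _ => smul_sub _ _ _
  -- Two retractions differ by a vanishing map. The vanishing maps form a tower of finite modules by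
  -- noetherianity, so the defect of compatibility is a coboundary, and subtracting a primitive
  -- leaves retractions.
  obtain ⟨w, hw⟩ := exists_sub_eq_of_tower (V := fun k => vanishing (P k)) hρ hd
    (fun k => mapVanishing (τ k) (hτ k) (hspan k))
    (fun k => span_range_mapVanishing (τ k) (hτ k) (hspan k) (he (k + 1)))
    (fun k => ⟨e k - τ k ∘ e (k + 1), hsub k _ _ (he k)
      (map_retraction (τ k) (hτ k) (hspan k) (he (k + 1)))⟩)
  refine ⟨fun k i => e k i - (w k).1 i, fun k i => ?_, fun k c => ?_⟩
  · have h1 : (w k).1 i - τ k ((w (k + 1)).1 i) = e k i - τ k (e (k + 1) i) :=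
      congrFun (congrArg Subtype.val (hw k)) i
    rw [map_sub]
    rw [sub_eq_sub_iff_add_eq_add] at h1 ⊢
    rw [add_comm, ← h1, add_comm]
  · have h1 := (w k).2 c
    calc ∑ i, c.1 i • (e k i - (w k).1 i) = ∑ i, c.1 i • e k i - ∑ i, c.1 i • (w k).1 i := by
          rw [← Finset.sum_sub_distrib]
          exact Finset.sum_congr rfl fun i _ => smul_sub _ _ _
      _ = c := by rw [he, h1, sub_zero]

/-! ### Finiteness of the module of global sections -/

section Finiteness

variable {I : Type*} [Fintype I] [DecidableEq I] {p : ℕ} [hp : Fact p.Prime]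
  {A : Type*} [NormedCommRing A] [IsUltrametricDist A] {r₀ : I → WithTop ℚ}

namespace CoherentSheaf

variable {F : CoherentSheaf p A r₀}

/-- The doubling comes from padding with zeros to make the stagewise generators compatible.
Generation of the limit then needs the coherence of the relations. -/
theorem exists_global_generators (hR : ∀ b : MultiInterval I, HasBoundedGeneration (IntervalRing p A b))
    (hr₀ : ∀ α, 0 < r₀ α) {n : ℕ} (h : ∀ K, F.NGen K n) :
    ∃ g : Fin n ⊕ Fin n → F.GlobalSections,
      Submodule.span (GlobalRing p A r₀) (Set.range g) = ⊤ := by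
  obtain ⟨s⟩ := nonempty_innerRadius hr₀
  have hspan : ∀ k, Submodule.span (IntervalRing p A (full (radii s k)).1)
    (Set.range (F.res (full_le (radii_succ_le s k)))) = ⊤ := fun k => F.span_range_res _
  obtain ⟨w, hw, hwspan⟩ := exists_compatible_generators
    (R := fun k => IntervalRing p A (full (radii s k)).1)
    (V := fun k => F.sec (full (radii s k)))
    (ρ := fun k => restrict p A (full_le (radii_succ_le s k))) (fun k x => norm_restrict_le _ x)
    (denseRange_restrict_radii s) (fun k => F.res (full_le (radii_succ_le s k)))
    hspan (fun k => h (full (radii s k)))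
  choose g hg using fun i => exists_globalSection s (fun k => w k i) fun k => hw k i
  refine ⟨g, span_eq_top_of_local hR g s fun k => ?_⟩
  rw [← hwspan k]
  congr 2
  funext i
  rw [sectionOver_full, hg]

theorem nGen_of_span {b : Below r₀} {ι : Type*} [Fintype ι] {n : ℕ} (hn : Fintype.card ι = n)
    {g : ι → F.sec b} (hg : Submodule.span (IntervalRing p A b.1) (Set.range g) = ⊤) :
    F.NGen b n :=
  ⟨g ∘ (Fintype.equivFinOfCardEq hn).symm, by rwa [EquivLike.range_comp]⟩

theorem exists_pos_generators {R M : Type*} [CommRing R] [AddCommGroup M] [Module R M]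
    [Module.Finite R M] : ∃ (n : ℕ) (g : Fin n → M), 0 < n ∧ Submodule.span R (Set.range g) = ⊤ := by
  obtain ⟨n, g, hg⟩ := Module.Finite.exists_fin (R := R) (M := M)
  -- A zero generator ensures that the number is positive, as the uniform notions require.
  refine ⟨n + 1, Fin.cons 0 g, n.succ_pos, eq_top_iff.2 (hg ▸ Submodule.span_mono ?_)⟩
  rintro _ ⟨i, rfl⟩
  exact ⟨i.succ, rfl⟩

variable [NormedAlgebra ℚ_[p] A]

theorem uniformlyFinitelyGenerated_iff
    (hR : ∀ b : MultiInterval I, HasBoundedGeneration (IntervalRing p A b))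
    (hr₀ : ∀ α, 0 < r₀ α) :
    F.UniformlyFinitelyGenerated ↔ Module.Finite (GlobalRing p A r₀) F.GlobalSections := by
  constructor
  · intro h
    obtain ⟨n, hn⟩ := h.exists_nGen
    obtain ⟨g, hg⟩ := exists_global_generators hR hr₀ hn
    exact ⟨Submodule.fg_def.2 ⟨_, Set.finite_range g, hg⟩⟩
  · intro h
    obtain ⟨n, g, hn, hg⟩ := exists_pos_generators (R := GlobalRing p A r₀) (M := F.GlobalSections)
    obtain ⟨U, hU⟩ := exists_admissibleCovering hr₀
    exact ⟨n, hn, U, hU, fun b _ => isNGenerated_iff.2 ⟨_, span_sectionOver_eq_top hg b⟩⟩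

omit [NormedAlgebra ℚ_[p] A]

/-- A global section of the sheaf of relations, as a tuple of global functions. -/
def relationCoeff {hR : ∀ b : MultiInterval I, HasBoundedGeneration (IntervalRing p A b)}
    {ι : Type*} [Fintype ι] {g : ι → F.GlobalSections} (x : (relations hR g).GlobalSections)
    (i : ι) : GlobalRing p A r₀ :=
  .mk (fun s => (component s x).1 i) fun s t h => by
    have h1 := congrFun (congrArg Subtype.val (res_component h x)) i
    exact h1

theorem sum_relationCoeff_smul
    {hR : ∀ b : MultiInterval I, HasBoundedGeneration (IntervalRing p A b)}
    {ι : Type*} [Fintype ι] {g : ι → F.GlobalSections} (x : (relations hR g).GlobalSections) :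
    ∑ i, relationCoeff x i • g i = 0 := by
  refine GlobalSections.ext fun s => ?_
  have h1 : ∑ i, (component s x).1 i • F.sectionOver (full s) (g i) = 0 := (component s x).2
  rw [map_sum, map_zero, ← h1]
  refine Finset.sum_congr rfl fun i _ => ?_
  rw [map_smulₛₗ, sectionOver_full]
  rfl

/-- Global sections of the sheaf of relations are the relations between the global sections. -/
def relationsEquiv (hR : ∀ b : MultiInterval I, HasBoundedGeneration (IntervalRing p A b))
    {ι : Type*} [Fintype ι] (g : ι → F.GlobalSections) :
    (relations hR g).GlobalSections ≃ₗ[GlobalRing p A r₀]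
      LinearMap.ker (Fintype.linearCombination (GlobalRing p A r₀) g) where
  toFun x := ⟨relationCoeff x, sum_relationCoeff_smul x⟩
  map_add' _ _ := rfl
  map_smul' _ _ := rfl
  invFun c := .mk (relations hR g) (fun s => ⟨fun i => (c.1 i).component s, by
      have h1 : ∑ i, c.1 i • g i = 0 := c.2
      have h2 := congrArg (component s) h1
      rw [map_sum, map_zero] at h2
      change ∑ i, (c.1 i).component s • F.sectionOver (full s) (g i) = 0
      simp only [sectionOver_full]
      rw [← h2]
      exact Finset.sum_congr rfl fun i _ => (map_smulₛₗ _ _ _).symm⟩) fun s t h =>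
    Subtype.ext (funext fun i => GlobalRing.restrict_component h (c.1 i))
  left_inv _ := rfl
  right_inv _ := rfl

theorem linearCombination_sectionOver_surjective {ι : Type*} [Fintype ι] {g : ι → F.GlobalSections}
    (hg : Submodule.span (GlobalRing p A r₀) (Set.range g) = ⊤) (b : Below r₀) :
    Function.Surjective (Fintype.linearCombination (IntervalRing p A b.1)
      fun i => F.sectionOver b (g i)) :=
  linearCombination_surjective (span_sectionOver_eq_top hg b)

variable [NormedAlgebra ℚ_[p] A]

/-- The global sections of the sheaf of relations form the kernel of the presentation by `g`, so the
criterion for finite generation, applied to that sheaf, decides finite presentation. -/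
theorem relations_uniformlyFinitelyGenerated_iff
    (hR : ∀ b : MultiInterval I, HasBoundedGeneration (IntervalRing p A b))
    (hr₀ : ∀ α, 0 < r₀ α) {ι : Type*} [Fintype ι] {g : ι → F.GlobalSections}
    (hg : Submodule.span (GlobalRing p A r₀) (Set.range g) = ⊤) :
    (relations hR g).UniformlyFinitelyGenerated ↔
      Module.FinitePresentation (GlobalRing p A r₀) F.GlobalSections := by
  rw [uniformlyFinitelyGenerated_iff hR hr₀, Module.Finite.equiv_iff (relationsEquiv hR g)]
  constructor
  · intro h
    exact Module.finitePresentation_of_surjective _ (linearCombination_surjective hg)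
      (Module.Finite.iff_fg.1 h)
  · intro h
    exact Module.Finite.iff_fg.2
      (Module.FinitePresentation.fg_ker _ (linearCombination_surjective hg))

theorem uniformlyFinitelyPresented_iff
    (hR : ∀ b : MultiInterval I, HasBoundedGeneration (IntervalRing p A b))
    (hr₀ : ∀ α, 0 < r₀ α) :
    F.UniformlyFinitelyPresented ↔
      Module.FinitePresentation (GlobalRing p A r₀) F.GlobalSections := by
  constructor
  · rintro ⟨m, n, hm, hn, U, hU, hpres⟩
    have hfin : Module.Finite (GlobalRing p A r₀) F.GlobalSections :=
      (uniformlyFinitelyGenerated_iff hR hr₀).1 ⟨n, hn, U, hU, fun b hb => by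
        obtain ⟨_, π, _, hπ⟩ := hpres b hb
        exact ⟨π, hπ⟩⟩
    obtain ⟨N, g, hN, hg⟩ := exists_pos_generators (R := GlobalRing p A r₀) (M := F.GlobalSections)
    refine (relations_uniformlyFinitelyGenerated_iff hR hr₀ hg).1
      ⟨m + N, by omega, U, hU, fun b hb => isNGenerated_iff.2 ?_⟩
    -- Changing from the local generators to the `N` global ones raises the number of relations by
    -- `N` at most, so the same covering bounds the sheaf of relations.
    obtain ⟨x, hx⟩ := (hpres b hb).exists_span_ker (span_sectionOver_eq_top hg b)
    exact nGen_of_span (F := relations hR g) (by simp) hx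
  · intro h
    obtain ⟨n, g, hn, hg⟩ := exists_pos_generators (R := GlobalRing p A r₀) (M := F.GlobalSections)
    have := (uniformlyFinitelyGenerated_iff hR hr₀).1
      ((relations_uniformlyFinitelyGenerated_iff hR hr₀ hg).2 h)
    obtain ⟨m, x, hm, hx⟩ := exists_pos_generators (R := GlobalRing p A r₀)
      (M := (relations hR g).GlobalSections)
    obtain ⟨U, hU⟩ := exists_admissibleCovering hr₀
    exact ⟨m, n, hm, hn, U, hU, fun b _ => isMNPresented_of_span (span_sectionOver_eq_top hg b)
      (span_sectionOver_eq_top hx b)⟩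

omit [NormedAlgebra ℚ_[p] A]

/-- Finite flat modules over the noetherian stages are projective and give retractions there. Made
compatible along the tower, they are global sections of the sheaf of relations. -/
theorem exists_global_retraction
    (hR : ∀ b : MultiInterval I, HasBoundedGeneration (IntervalRing p A b))
    (hr₀ : ∀ α, 0 < r₀ α) (hF : F.IsVectorBundle) {ι : Type*} [Fintype ι]
    {g : ι → F.GlobalSections}
    (hg : Submodule.span (GlobalRing p A r₀) (Set.range g) = ⊤) :
    ∃ e : ι → LinearMap.ker (Fintype.linearCombination (GlobalRing p A r₀) g),
      ∀ c : LinearMap.ker (Fintype.linearCombination (GlobalRing p A r₀) g),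
        ∑ i, c.1 i • e i = c := by
  obtain ⟨s⟩ := nonempty_innerRadius hr₀
  let P : ∀ k, Submodule (IntervalRing p A (full (radii s k)).1)
      (ι → IntervalRing p A (full (radii s k)).1) := fun k =>
    LinearMap.ker (Fintype.linearCombination (IntervalRing p A (full (radii s k)).1)
      fun i => F.sectionOver (full (radii s k)) (g i))
  let τ : ∀ k, P (k + 1) →ₛₗ[restrict p A (full_le (radii_succ_le s k))] P k :=
    fun k => (relations hR g).res (full_le (radii_succ_le s k))
  have hτ : ∀ k (x : P (k + 1)) i,
    (τ k x).1 i = restrict p A (full_le (radii_succ_le s k)) (x.1 i) := fun _ _ _ => rfl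
  have hspan : ∀ k, Submodule.span (IntervalRing p A (full (radii s k)).1) (Set.range (τ k)) = ⊤ :=
    fun k => (relations hR g).span_range_res (full_le (radii_succ_le s k))
  have hret : ∀ k, ∃ e : ι → P k, ∀ c : P k, ∑ i, c.1 i • e i = c := by
    intro k
    have := (hR (full (radii s k)).1).isNoetherianRing
    have := F.finite (full (radii s k))
    have := hF (full (radii s k))
    have := Module.finitePresentation_of_finite (IntervalRing p A (full (radii s k)).1)
      (F.sec (full (radii s k)))
    have := Module.Flat.projective_of_finitePresentation
      (R := IntervalRing p A (full (radii s k)).1) (M := F.sec (full (radii s k)))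
    exact exists_retraction (linearCombination_sectionOver_surjective hg _)
  have := fun k => (hR (full (radii s k)).1).isNoetherianRing
  obtain ⟨e, hcompat, he⟩ := exists_compatible_retraction
    (R := fun k => IntervalRing p A (full (radii s k)).1)
    (ρ := fun k => restrict p A (full_le (radii_succ_le s k))) (fun k x => norm_restrict_le _ x)
    (denseRange_restrict_radii s) τ hτ hspan hret
  choose ε hε using fun i => exists_globalSection (F := relations hR g) s
    (fun k => e k i) fun k => hcompat k i
  refine ⟨fun i => relationsEquiv hR g (ε i), fun c => ?_⟩
  obtain ⟨c, rfl⟩ := (relationsEquiv hR g).surjective c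
  simp only [← map_smul, ← map_sum]
  congr 1
  refine globalSections_ext s fun k => ?_
  rw [map_sum]
  simp only [map_smulₛₗ, hε]
  exact he k (component (radii s k) c)

theorem projective_of_isVectorBundle
    (hR : ∀ b : MultiInterval I, HasBoundedGeneration (IntervalRing p A b))
    (hr₀ : ∀ α, 0 < r₀ α) (hF : F.IsVectorBundle)
    [Module.Finite (GlobalRing p A r₀) F.GlobalSections] :
    Module.Projective (GlobalRing p A r₀) F.GlobalSections := by
  obtain ⟨n, g, -, hg⟩ := exists_pos_generators (R := GlobalRing p A r₀) (M := F.GlobalSections)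
  obtain ⟨e, he⟩ := exists_global_retraction hR hr₀ hF hg
  refine projective_of_projector (linearCombination_surjective hg)
    (LinearMap.id - (Submodule.subtype _).comp (Fintype.linearCombination _ e))
    (fun x hx => ?_) fun x => ?_
  · have := congrArg Subtype.val (he ⟨x, hx⟩)
    change x - (∑ i, x i • e i : LinearMap.ker _).1 = 0
    rw [this, sub_self]
  · rw [LinearMap.sub_apply, map_sub]
    have : Fintype.linearCombination (GlobalRing p A r₀) g
      (Fintype.linearCombination (GlobalRing p A r₀) e x).1 = 0 := (Fintype.linearCombination _ e x).2
    change _ - Fintype.linearCombination (GlobalRing p A r₀) g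
      (Fintype.linearCombination (GlobalRing p A r₀) e x).1 = _
    rw [this, sub_zero]
    rfl

/-- A retraction onto the global relations restricts to one over every interval, because global
relations generate the local ones. The complementary projector splits the local presentation. -/
theorem isVectorBundle_of_projective
    (hR : ∀ b : MultiInterval I, HasBoundedGeneration (IntervalRing p A b))
    [Module.Finite (GlobalRing p A r₀) F.GlobalSections]
    [Module.Projective (GlobalRing p A r₀) F.GlobalSections] : F.IsVectorBundle := by
  classical
  intro b
  obtain ⟨n, g, -, hg⟩ := exists_pos_generators (R := GlobalRing p A r₀) (M := F.GlobalSections)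
  obtain ⟨e, he⟩ := exists_retraction (linearCombination_surjective hg)
  let e' : Fin n → (relations hR g).sec b := fun i =>
    (relations hR g).sectionOver b ((relationsEquiv hR g).symm (e i))
  have he' : ∀ c : (relations hR g).sec b, ∑ i, c.1 i • e' i = c := by
    intro c
    have hc : c ∈ Submodule.span (IntervalRing p A b.1)
        (Set.range ((relations hR g).sectionOver b)) := by
      rw [span_range_sectionOver (F := relations hR g)]
      exact Submodule.mem_top
    induction hc using Submodule.span_induction with
    | mem x hx =>
      obtain ⟨x, rfl⟩ := hx
      have h1 := congrArg (relationsEquiv hR g).symm (he (relationsEquiv hR g x))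
      rw [map_sum, LinearEquiv.symm_apply_apply] at h1
      have h2 := congrArg ((relations hR g).sectionOver b) h1
      rw [map_sum] at h2
      refine Eq.trans (Finset.sum_congr rfl fun i _ => ?_) h2
      rw [map_smul, map_smulₛₗ]
      rfl
    | zero => exact Finset.sum_eq_zero fun i _ => zero_smul _ _
    | add x y _ _ hx hy =>
      conv_rhs => rw [← hx, ← hy, ← Finset.sum_add_distrib]
      exact Finset.sum_congr rfl fun i _ => add_smul _ _ _
    | smul r x _ hx =>
      conv_rhs => rw [← hx, Finset.smul_sum]
      exact Finset.sum_congr rfl fun i _ => mul_smul _ _ _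
  have hproj : Module.Projective (IntervalRing p A b.1) (F.sec b) := by
    refine projective_of_projector (linearCombination_sectionOver_surjective hg b)
      (LinearMap.id - (Submodule.subtype _).comp (Fintype.linearCombination _ e'))
      (fun x hx => ?_) fun x => ?_
    · have h1 := congrArg Subtype.val (he' ⟨x, hx⟩)
      change x - (∑ i, x i • e' i).1 = 0
      rw [h1]
      exact sub_self x
    · rw [LinearMap.sub_apply, map_sub]
      have h1 : Fintype.linearCombination (IntervalRing p A b.1) (fun i => F.sectionOver b (g i))
        (Fintype.linearCombination (IntervalRing p A b.1) e' x).1 = 0 :=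
        (Fintype.linearCombination _ e' x).2
      exact (congrArg (_ - ·) h1).trans (sub_zero _)
  infer_instance

end CoherentSheaf

end Finiteness

end MultiRobba

end

theorem mainTheorem6 (p : ℕ) [Fact p.Prime] {I : Type*} [Fintype I] [DecidableEq I]
    (A : Type*) [NormedCommRing A] [IsUltrametricDist A] [NormedAlgebra ℚ_[p] A]
    (hA : MultiRobba.IsAffinoidAlgebra p A)
    (r₀ : I → WithTop ℚ) (hr₀ : ∀ α, 0 < r₀ α)
    (F : MultiRobba.CoherentSheaf p A r₀) :
    (F.UniformlyFinitelyGenerated ↔ Module.Finite (MultiRobba.AnRing p A r₀) F.globalSection) ∧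
    (F.UniformlyFinitelyPresented ↔
      Module.FinitePresentation (MultiRobba.AnRing p A r₀) F.globalSection) ∧
    (F.IsVectorBundle ∧ F.UniformlyFinitelyPresented ↔
      Module.Finite (MultiRobba.AnRing p A r₀) F.globalSection ∧
      Module.Projective (MultiRobba.AnRing p A r₀) F.globalSection) := by
  have hR : ∀ b : MultiRobba.MultiInterval I, MultiRobba.HasBoundedGeneration (MultiRobba.IntervalRing p A b) :=
    fun b => hA.hasBoundedGeneration b
  have h1 := MultiRobba.CoherentSheaf.uniformlyFinitelyGenerated_iff (F := F) hR hr₀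
  have h2 := MultiRobba.CoherentSheaf.uniformlyFinitelyPresented_iff (F := F) hR hr₀
  have h3 : F.IsVectorBundle ∧ F.UniformlyFinitelyPresented ↔
      Module.Finite (MultiRobba.GlobalRing p A r₀) F.GlobalSections ∧
      Module.Projective (MultiRobba.GlobalRing p A r₀) F.GlobalSections := by
    constructor
    · rintro ⟨hF, hP⟩
      have := h2.1 hP
      have hfin : Module.Finite (MultiRobba.GlobalRing p A r₀) F.GlobalSections := inferInstance
      exact ⟨hfin, MultiRobba.CoherentSheaf.projective_of_isVectorBundle hR hr₀ hF⟩
    · rintro ⟨hfin, hproj⟩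
      exact ⟨MultiRobba.CoherentSheaf.isVectorBundle_of_projective hR,
        h2.2 (Module.finitePresentation_of_projective _ _)⟩
  -- The types `GlobalRing` and `GlobalSections` unfold to the ring and module of the statement,
  -- with the same structures.
  exact ⟨h1, h2, h3⟩
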